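/- **Notation.** Let $\mathfrak H$ be the upper half plane, $\mathfrak H^*=\mathfrak H\cup\mathbf Q\cup\{i\infty\}$, $q=e^{2\pi i\tau}$, $\dot f=df/d\tau$, $f'=q\,df/dq=(2\pi i)^{-1}\dot f$, and $E_2(q)=1-24\sum_{n\ge1}\sigma_1(n)q^n$; $f(q^m)$ means $f$ evaluated at $m\tau$. For $\chi:\mathbf Z/N\mathbf Z\to\mathbf C$, written out as $\chi(0),\dots,\chi(N-1)$, put $\sigma_1(n;\chi)=\sum_{d\mid n}\chi(d)\,d$ and $\sigma_1^{\rm c}(n;\chi)=\sum_{d\mid n}\chi(n/d)\,d$. For holomorphic $u$ on $\mathfrak H$ put $u_4=\dot u-u^2$ and $u_{k+2}=\dot u_k-k\,u\,u_k$. A generalized Chazy equation $C_p$ for $u$ is $p(u_4,u_6,u_8)=0$ with $0\ne p\in\mathbf C[u_4,u_6,u_8]$ homogeneous when $u_k$ has weight $k$. A holomorphic $f$ on $\mathfrak H$ is quasi-modular of weight $2$ and depth $\le1$ on $\Gamma$ if for some $s\in\mathbf C$ one has $f(\frac{a\tau+b}{c\tau+d})=(c\tau+d)^2f(\tau)+\frac{s}{2\pi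 i}c(c\tau+d)$ for all $\begin{pmatrix}a&b\\c&d\end{pmatrix}\in\Gamma$, and $(c\tau+d)^{-2}f(\frac{a\tau+b}{c\tau+d})$ is bounded as $\operatorname{Im}\tau\to\infty$ for every $\begin{pmatrix}a&b\\c&d\end{pmatrix}\in SL(2,\mathbf Z)$. A (single-valued) modular form of weight $k$ on $\Gamma$ is a function holomorphic on $\mathfrak H$ and at all cusps with $f(\frac{a\tau+b}{c\tau+d})=\hat\chi(\gamma)(c\tau+d)^kf(\tau)$ for all $\gamma=\begin{pmatrix}a&b\\c&d\end{pmatrix}\in\Gamma$, with some multipliers $\hat\chi(\gamma)\in\mathbf C^\times$; a multivalued one of weight $k$ is an $m$-th root, for some $m\ge1$, of a single-valued form of weight $mk$. Orders of vanishing are computed with respect to a local parameter for $\Gamma$ (the order in $\tau$ divided by $2$ or $3$ at a quadratic or cubic elliptic point of $\Gamma$; the order in $q_h=e^{2\pi i\tau/h}$ at a cusp of width $h$, after moving the cusp to $i\infty$), and the order of an $m$-th root is $1/m$ times that of its $m$-th power. **Theorem.** Let $(r,N)$ be $(4,2)$, $(3,3)$ or $(2,4)$. Let the third fixed point of $\Gamma_0(N)$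 be the quadratic elliptic point $(1+i)/2$ for $N=2$, the cubic elliptic point $(3+i\sqrt3)/6$ for $N=3$, and the cusp $1/2$ for $N=4$. 1. Define $$\mathscr E_4(q)=\tfrac13[4E_2(q^2)-E_2(q)],\quad \mathscr E_3(q)=\tfrac18[9E_2(q^3)-E_2(q)],\quad \mathscr E_2(q)=\tfrac13[4E_2(q^4)-E_2(q^2)].$$ Then $\mathscr E_r$ is quasi-modular of weight $2$ and depth $\le1$ on $\Gamma_0(N)$, equals $1$ at $i\infty$, and $$\begin{aligned}\mathscr E_4&=1+8\sum_{n\ge1}\sigma_1(n;-1,1)q^n=1+8\sum_{n\ge1}\sigma_1^{\rm c}(n;-3,1)q^n,\\ \mathscr E_3&=1+3\sum_{n\ge1}\sigma_1(n;-2,1,1)q^n=1+3\sum_{n\ge1}\sigma_1^{\rm c}(n;-8,1,1)q^n,\\ \mathscr E_2&=1+4\sum_{n\ge1}\sigma_1(n;-1,0,1,0)q^n=1+8\sum_{n\ge1}\sigma_1^{\rm c}(n;-3,0,1,0)q^n,\end{aligned}$$ so that $\mathscr E_2(q)=\mathscr E_4(q^2)$. The function $u=(2\pi i/r)\mathscr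 E_r$ satisfies the generalized Chazy equation $C_{p_r}$, where $$p_4=p_2=u_4u_8-u_6^2+8u_4^3,\qquad p_3=u_4u_8^2-u_6^2u_8+24u_4^3u_8-15u_4^2u_6^2+144u_4^5 .$$ 2. There are weight-$1$ modular forms $\mathscr A_r,\mathscr B_r,\mathscr C_r$ on $\Gamma_0(N)$, all single-valued except that $\mathscr A_4$ is allowed to be a square root of a single-valued form of weight $2$, such that: (a) $\mathscr A_r^r=\mathscr B_r^r+\mathscr C_r^r$, each term being a single-valued form of weight $r$; (b) $\mathscr A_r,\mathscr B_r,\mathscr C_r$ vanish respectively at the points equivalent under $\Gamma_0(N)$ to the third fixed point, the cusp $0$, and the cusp $i\infty$, in each case to order $1/r$, and vanish nowhere else on $\mathfrak H^*$; (c) with $\mathscr E=\mathscr E_r$, $\mathscr A=\mathscr A_r$, and so on, $$\begin{aligned}(\mathscr A^r)'&=\mathscr E\mathscr A^r-\mathscr A^2\mathscr B^r,& (\mathscr B^r)'&=\mathscr E\mathscr B^r-\mathscr A^2\mathscr B^r,\\ (\mathscr C^r)'&=\mathscr E\mathscr C^r,& r\,\mathscr E'&=\mathscr E^2-\mathscr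 A^{4-r}\mathscr B^r.\end{aligned}$$ In particular $u=\dot{\mathscr C}_r/\mathscr C_r$. Moreover the generalized Chazy equation follows from this system by elimination: if $\mathscr A,\mathscr B,\mathscr C,\mathscr E$ are functions on $\mathfrak H$ with $\mathscr A\not\equiv0$ and $\mathscr A^r,\mathscr B^r,\mathscr C^r,\mathscr A^2,\mathscr A^{4-r},\mathscr E$ holomorphic, satisfying $\mathscr A^r=\mathscr B^r+\mathscr C^r$ and the four equations, then $u=(2\pi i/r)\mathscr E$ satisfies $C_{p_r}$. -/

import Mathlib

open UpperHalfPlane hiding I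
open Complex Filter Topology OnePoint
open scoped Manifold MatrixGroups ModularForm

noncomputable section

namespace TripleForms

/-! ### Modular forms with multiplier system, roots of such forms, quasi-modular forms -/

/-- A (single-valued) modular form of weight `k` on `Γ ≤ SL(2, ℤ)`, with a multiplier system:
holomorphic on `ℍ`, `f ((aτ+b)/(cτ+d)) = χ (γ) (cτ+d)^k f (τ)` for `γ ∈ Γ` with nonzero
multipliers `χ (γ)`, and holomorphic at every cusp. -/
structure IsMultiplierForm (Γ : Subgroup SL(2, ℤ)) (k : ℤ) (f : ℍ → ℂ) : Prop where
  holo : MDiff f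
  transform : ∃ χ : SL(2, ℤ) → ℂˣ, ∀ γ ∈ Γ, ∀ τ : ℍ,
    f (γ • τ) = χ γ * ((γ 1 0 : ℂ) * τ + (γ 1 1 : ℂ)) ^ k * f τ
  bdd_at_cusps : ∀ γ : SL(2, ℤ), IsBoundedAtImInfty (f ∣[k] γ)

/-- A possibly multivalued modular form of weight `k`, i.e. an `m`-th root of a single-valued
modular form of weight `m * k`. The function `f` records one value of the root at each point;
`f` itself need not be continuous. -/
def IsRootForm (Γ : Subgroup SL(2, ℤ)) (k : ℤ) (f : ℍ → ℂ) : Prop :=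
  ∃ m : ℕ, 0 < m ∧ IsMultiplierForm Γ (m * k) (f ^ m)

/-- A quasi-modular form of weight `2` and depth at most `1` on `Γ`, with trivial multiplier
system. The number `s` is the coefficient of affinity. -/
structure IsQuasimodularTwo (Γ : Subgroup SL(2, ℤ)) (f : ℍ → ℂ) : Prop where
  holo : MDiff f
  transform : ∃ s : ℂ, ∀ γ ∈ Γ, ∀ τ : ℍ,
    f (γ • τ) = ((γ 1 0 : ℂ) * τ + (γ 1 1 : ℂ)) ^ 2 * f τ
      + s / (2 * Real.pi * I) * (γ 1 0 : ℂ) * ((γ 1 0 : ℂ) * τ + (γ 1 1 : ℂ))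
  bdd_at_cusps : ∀ γ : SL(2, ℤ), IsBoundedAtImInfty (f ∣[(2 : ℤ)] γ)

/-! ### The extended upper half plane and orders of vanishing -/

/-- The extended upper half plane `ℍ ∪ ℚ ∪ {i∞}`. -/
abbrev ExtHalfPlane : Type := ℍ ⊕ OnePoint ℚ

/-- Equivalence of points of the extended upper half plane under `Γ`. -/
def Equivalent (Γ : Subgroup SL(2, ℤ)) : ExtHalfPlane → ExtHalfPlane → Prop
  | .inl z, .inl w => ∃ γ ∈ Γ, γ • z = w
  | .inr s, .inr t =>
      ∃ γ ∈ Γ, (Matrix.SpecialLinearGroup.mapGL ℚ γ : GL (Fin 2) ℚ) • s = t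
  | _, _ => False

/-- The number of Möbius transformations in the image of `Γ` that fix `z`: it is `2` or `3` at a
quadratic or cubic elliptic fixed point of `Γ`, and `1` at all other points of `ℍ`. -/
def ellipticIndex (Γ : Subgroup SL(2, ℤ)) (z : ℍ) : ℕ :=
  Nat.card ((MulAction.stabilizer SL(2, ℤ) z ⊓ Γ).map (MulAction.toPermHom SL(2, ℤ) ℍ))

/-- The width of the cusp `γ • i∞` of `Γ`. -/
def cuspWidth (Γ : Subgroup SL(2, ℤ)) (γ : SL(2, ℤ)) : ℕ :=
  sInf {h : ℕ | 0 < h ∧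
    (γ * ModularGroup.T ^ h * γ⁻¹ ∈ Γ ∨ -(γ * ModularGroup.T ^ h * γ⁻¹) ∈ Γ)}

/-- The single-valued form `f` of weight `k` on `Γ` has order of vanishing `o` at the given point,
with respect to a local parameter for `Γ`. At a cusp `γ • i∞` of width `h` this means that the
expansion of `f ∣[k] γ` starts with a nonzero multiple of `exp (2πi o τ / h)`. -/
def HasFormOrder (Γ : Subgroup SL(2, ℤ)) (k : ℤ) (f : ℍ → ℂ) : ExtHalfPlane → ℚ → Prop
  | .inl z, o => ∃ n : ℕ, analyticOrderAt (f ∘ ofComplex) (z : ℂ) = n ∧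
      o = (n : ℚ) / ellipticIndex Γ z
  | .inr s, o => ∀ γ : SL(2, ℤ),
      (Matrix.SpecialLinearGroup.mapGL ℚ γ : GL (Fin 2) ℚ) • (∞ : OnePoint ℚ) = s →
      ∃ c : ℂ, c ≠ 0 ∧
        Tendsto (fun τ : ℍ => (f ∣[k] γ) τ *
          cexp (-(2 * Real.pi * I * (o : ℂ) * τ / (cuspWidth Γ γ : ℂ)))) atImInfty (𝓝 c)

/-- The possibly multivalued form `f` of weight `k` on `Γ` has order of vanishing `o` at `s`, with
respect to a local parameter for `Γ`: some power `f ^ m` is single-valued, with order `m * o`. -/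
def HasOrder (Γ : Subgroup SL(2, ℤ)) (k : ℤ) (f : ℍ → ℂ) (s : ExtHalfPlane) (o : ℚ) : Prop :=
  ∃ m : ℕ, 0 < m ∧ IsMultiplierForm Γ (m * k) (f ^ m) ∧
    HasFormOrder Γ (m * k) (f ^ m) s (m * o)

/-- `f` vanishes, to order `o`, at the points equivalent to `P`, and nowhere else on the extended
upper half plane. -/
def VanishesExactlyAt (Γ : Subgroup SL(2, ℤ)) (k : ℤ) (f : ℍ → ℂ) (P : ExtHalfPlane) (o : ℚ) :
    Prop :=
  ∀ s : ExtHalfPlane, (Equivalent Γ P s → HasOrder Γ k f s o) ∧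
    (¬ Equivalent Γ P s → HasOrder Γ k f s 0)

/-! ### Generalized Chazy equations -/

/-- The derivative `d/dτ`. -/
def dot (f : ℍ → ℂ) : ℍ → ℂ := fun τ => deriv (f ∘ ofComplex) (τ : ℂ)

/-- `chazyU u j` is `u_{2j+4}`: one has `u_4 = u̇ - u ^ 2` and `u_{k+2} = u̇_k - k u u_k`. -/
def chazyU (u : ℍ → ℂ) : ℕ → ℍ → ℂ
  | 0 => fun τ => dot u τ - u τ ^ 2
  | j + 1 => fun τ => dot (chazyU u j) τ - ((2 * j + 4 : ℕ) : ℂ) * u τ * chazyU u j τ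

/-- `u` satisfies the generalized Chazy equation `C_p`. Here the variables `X 0`, `X 1`, `X 2` of
`p` stand for `u_4`, `u_6`, `u_8`, and `p` has to be nonzero and homogeneous in the weights. -/
def SatisfiesChazy (p : MvPolynomial (Fin 3) ℂ) (u : ℍ → ℂ) : Prop :=
  p ≠ 0 ∧ (∃ n : ℕ, p.IsWeightedHomogeneous (![4, 6, 8] : Fin 3 → ℕ) n) ∧
    ∀ τ : ℍ, MvPolynomial.eval ![chazyU u 0 τ, chazyU u 1 τ, chazyU u 2 τ] p = 0

/-! ### Weighted divisor functions -/

/-- `σ_k(n; χ) = ∑_{d ∣ n} χ(d mod N) d ^ k`. -/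
def sigmaW {N : ℕ} (k n : ℕ) (χ : ZMod N → ℂ) : ℂ :=
  ∑ d ∈ n.divisors, χ (d : ZMod N) * (d : ℂ) ^ k

/-- `σᶜ_k(n; χ) = ∑_{d ∣ n} χ((n/d) mod N) d ^ k`. -/
def sigmaC {N : ℕ} (k n : ℕ) (χ : ZMod N → ℂ) : ℂ :=
  ∑ d ∈ n.divisors, χ ((n / d : ℕ) : ZMod N) * (d : ℂ) ^ k

/-! ### The three signatures -/

/-- The signatures `4`, `3`, `2`. -/
inductive Signature : Type
  | four
  | three
  | two

/-- The signature as a number. -/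
def Signature.r : Signature → ℕ
  | .four => 4
  | .three => 3
  | .two => 2

/-- The level `N` of the group `Γ₀(N)` belonging to a signature. -/
def Signature.level : Signature → ℕ
  | .four => 2
  | .three => 3
  | .two => 4

/-- The group `Γ₀(N)` belonging to a signature. -/
def Signature.group (S : Signature) : Subgroup SL(2, ℤ) := CongruenceSubgroup.Gamma0 S.level

/-- The third fixed point: the quadratic elliptic point `(1 + i) / 2` of `Γ₀(2)`, the cubic elliptic
point `(3 + i √3) / 6` of `Γ₀(3)`, and the cusp `1 / 2` of `Γ₀(4)`. -/
def Signature.thirdPoint : Signature → ExtHalfPlane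
  | .four => .inl ⟨⟨1 / 2, 1 / 2⟩, by norm_num⟩
  | .three => .inl ⟨⟨1 / 2, √3 / 6⟩, by positivity⟩
  | .two => .inr ((1 / 2 : ℚ) : OnePoint ℚ)

/-- The point `n τ`, so that `f (scale n hn τ)` is `f(q ^ n)`. -/
def scale (n : ℕ) (hn : 0 < n) (τ : ℍ) : ℍ :=
  ⟨(n : ℂ) * τ, by
    have h : (0 : ℝ) < n := Nat.cast_pos.mpr hn
    simpa using mul_pos h τ.im_pos⟩

/-- The Eisenstein series `ℰ_r`. -/
def eisE : Signature → ℍ → ℂ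
  | .four => fun τ =>
      (1 / 3) * (4 * EisensteinSeries.E2 (scale 2 (by norm_num) τ) - EisensteinSeries.E2 τ)
  | .three => fun τ =>
      (1 / 8) * (9 * EisensteinSeries.E2 (scale 3 (by norm_num) τ) - EisensteinSeries.E2 τ)
  | .two => fun τ =>
      (1 / 3) * (4 * EisensteinSeries.E2 (scale 4 (by norm_num) τ)
        - EisensteinSeries.E2 (scale 2 (by norm_num) τ))

/-- The function `u = (2πi / r) E`. -/
def uOf (r : ℕ) (E : ℍ → ℂ) : ℍ → ℂ := fun τ => (2 * Real.pi * I / (r : ℂ)) * E τ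

open MvPolynomial in
/-- The polynomials `p_4`, `p_3`, `p_2`. -/
def chazyPoly : Signature → MvPolynomial (Fin 3) ℂ
  | .four => X 0 * X 2 - X 1 ^ 2 + 8 * X 0 ^ 3
  | .three => X 0 * X 2 ^ 2 - X 1 ^ 2 * X 2 + 24 * X 0 ^ 3 * X 2
      - 15 * X 0 ^ 2 * X 1 ^ 2 + 144 * X 0 ^ 5
  | .two => X 0 * X 2 - X 1 ^ 2 + 8 * X 0 ^ 3

/-- The coupled first-order system for `A ^ r`, `B ^ r`, `C ^ r` and `E`. The derivation is
`q d/dq = (2πi)⁻¹ d/dτ`. -/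
structure CoupledSystem (r : ℕ) (A B C E : ℍ → ℂ) : Prop where
  eqA : Derivative.normalizedDerivOfComplex (A ^ r) = E * A ^ r - A ^ 2 * B ^ r
  eqB : Derivative.normalizedDerivOfComplex (B ^ r) = E * B ^ r - A ^ 2 * B ^ r
  eqC : Derivative.normalizedDerivOfComplex (C ^ r) = E * C ^ r
  eqE : (r : ℂ) • Derivative.normalizedDerivOfComplex E = E * E - A ^ (4 - r) * B ^ r

/-- The nome `q = exp (2πiτ)`. -/
def nome (τ : ℍ) : ℂ := cexp (2 * Real.pi * I * τ)

end TripleForms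

end

/-!
The forms `B` and `C` are eta quotients, namely the `r`-th roots of forms `b`, `c` of weight `r`
without zeros on `ℍ` whose only zeros are simple and located at the cusps `0` and `i∞`. Since
`E₂ / 24` is the logarithmic derivative of `η` with respect to `q d/dq`, the function `ℰ_r` is the
logarithmic derivative of `c`; this gives its quasi-modularity, the value `1` at `i∞`, and the
equation for `C ^ r`.

The remaining identities hold because spaces of forms on `Γ₀(N)` are small. The difference of the
logarithmic derivatives of `c` and `b` is a form `X` of weight `2` (`UnitForm.logD_sub`), and
`ℰ ^ 2 - r ℰ'` is a form of weight `4` (`quadCov_slash`, `UnitForm.quadCov`), which vanishes at all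
cusps but `i∞`. A form that vanishes wherever a form of the same weight without zeros on `ℍ` does is
a multiple of the latter, as the quotient is a modular form of weight `0`
(`eq_const_of_hasPeriod`, `PeriodicForm.eq_smul`). In this way one gets `A ^ 2 = X`,
`A ^ r = B ^ r + C ^ r` and `ℰ ^ 2 - r ℰ' = A ^ (4 - r) B ^ r`; together with the equations for the
logarithmic derivatives they make up the differential system (`coupledSystem_of_logD`). For `r = 3`
the single-valued form `A` is constructed as `(ℰ ^ 2 - 3 ℰ') / b`, and for `r = 2` it is an eta
quotient as well. All these forms are controlled by their behaviour at representatives of the cusps,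
since `Γ₀(N)` is generated by `-1`, `T` and `S T^N S⁻¹` for `N ≤ 4` (`Gamma0_le_of_generators`); the
expansions at the cusps follow from the transformation laws of `η`.

For `N = 2, 3` the zeros of `A` on `ℍ` are determined without a valence formula. A fundamental
domain is covered by the half plane `Im τ ≥ √3 / (2N)` and its image under the Fricke involution,
which maps `X = (N E₂(Nτ) - E₂(τ)) / (N - 1)` to a multiple of itself. In this half plane `|q|` is
so small that the `q`-expansion of `X` is injective for `N = 2` (`eq_of_hasSum_two`), whereas for
`N = 3` it has at most one zero modulo translations if one of its zeros is double
(`eq_of_hasSum_three`). At the elliptic point `X` vanishes because of the automorphy factor of the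
stabilizer, and for `N = 3` the zero is double as `X = A ^ 2`. Hence the zeros form the orbit of the
elliptic point (`exists_smul_eq_of_eisTwo_eq_zero`), and the differential system shows that the
zeros of `X`, respectively `A`, are simple.

The generalized Chazy equations result from the system by expressing `u_4`, `u_6`, `u_8` as
polynomials in `A` and `B ^ r` (`satisfiesChazy`), and the divisor sums from the expansion of `E₂`.
-/


namespace TripleForms

open Derivative Function.Periodic

/-! ### Periodic functions and logarithmic derivatives -/

/-- `f` is invariant under `τ ↦ τ + h`. -/
def HasPeriod (h : ℕ) (f : ℍ → ℂ) : Prop := ∀ τ : ℍ, f ((h : ℝ) +ᵥ τ) = f τ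

lemma HasPeriod.comp_ofComplex {h : ℕ} {f : ℍ → ℂ} (hf : HasPeriod h f) :
    Function.Periodic (f ∘ ofComplex) ((h : ℝ) : ℂ) := by
  intro w
  by_cases! hw : 0 < im w
  · have h1 : 0 < im (w + ((h : ℝ) : ℂ)) := by simpa using hw
    simp only [Function.comp_apply, ofComplex_apply_of_im_pos h1, ofComplex_apply_of_im_pos hw]
    rw [← hf ⟨w, hw⟩]
    congr 1
    ext
    simp [add_comm]
  · have h1 : im (w + ((h : ℝ) : ℂ)) ≤ 0 := by simpa using hw
    rw [Function.comp_apply, Function.comp_apply, ofComplex_apply_of_im_nonpos h1,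
      ofComplex_apply_of_im_nonpos hw]

lemma tendsto_vadd_atImInfty (x : ℝ) : Tendsto (fun τ : ℍ => x +ᵥ τ) atImInfty atImInfty := by
  simp only [atImInfty, tendsto_comap_iff]
  refine tendsto_comap.congr fun τ => ?_
  simp

lemma isBoundedAtImInfty_of_tendsto {f : ℍ → ℂ} {c : ℂ} (h : Tendsto f atImInfty (𝓝 c)) :
    IsBoundedAtImInfty f := h.isBigO_one ℝ

/-- The logarithmic derivative, with respect to the derivation `q d/dq`. -/
noncomputable def logD (f : ℍ → ℂ) : ℍ → ℂ := D f / f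

lemma D_eq_mul_logD {f : ℍ → ℂ} (hne : ∀ τ, f τ ≠ 0) : D f = logD f * f := by
  ext τ; simp [logD, hne τ]

lemma D_mul_apply {f g : ℍ → ℂ} (hf : MDiff f) (hg : MDiff g) (τ : ℍ) :
    D (f * g) τ = D f τ * g τ + f τ * D g τ := by
  rw [normalizedDerivOfComplex_mul f g hf hg]; simp

lemma logD_mul {f g : ℍ → ℂ} (hf : MDiff f) (hg : MDiff g) (hf0 : ∀ τ, f τ ≠ 0)
    (hg0 : ∀ τ, g τ ≠ 0) : logD (f * g) = logD f + logD g := by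
  ext τ
  simp only [logD, Pi.div_apply, Pi.add_apply, D_mul_apply hf hg, Pi.mul_apply]
  have := hf0 τ; have := hg0 τ
  field_simp

lemma logD_div {f g : ℍ → ℂ} (hf : MDiff f) (hg : MDiff g) (hf0 : ∀ τ, f τ ≠ 0)
    (hg0 : ∀ τ, g τ ≠ 0) : logD (f / g) = logD f - logD g := by
  have h := logD_mul (hf.div hg hg0) hg (fun τ => div_ne_zero (hf0 τ) (hg0 τ)) hg0
  have h2 : f / g * g = f := by ext τ; simp [hg0 τ]
  rw [h2] at h
  rw [h, add_sub_cancel_right]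

lemma logD_pow {f : ℍ → ℂ} (hf : MDiff f) (hf0 : ∀ τ, f τ ≠ 0) (n : ℕ) :
    logD (f ^ n) = (n : ℂ) • logD f := by
  ext τ
  rcases n with _ | n
  · have : (f ^ 0 : ℍ → ℂ) = fun _ => (1 : ℂ) := by ext; simp
    rw [logD, this, normalizedDerivOfComplex_const]
    simp
  · simp only [logD, Pi.div_apply, normalizedDerivOfComplex_pow f (n + 1) hf, Pi.mul_apply,
      Pi.pow_apply, Pi.smul_apply, smul_eq_mul]
    have := hf0 τ
    simp only [Pi.natCast_apply, Nat.add_sub_cancel]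
    field_simp
    ring

lemma logD_smul {f : ℍ → ℂ} (hf : MDiff f) {c : ℂ} (hc : c ≠ 0) : logD (c • f) = logD f := by
  ext τ
  simp only [logD, normalizedDerivOfComplex_smul c f hf, Pi.div_apply, Pi.smul_apply, smul_eq_mul]
  exact mul_div_mul_left _ _ hc

lemma mdiff_logD {f : ℍ → ℂ} (hf : MDiff f) (hf0 : ∀ τ, f τ ≠ 0) : MDiff (logD f) :=
  (normalizedDerivOfComplex_mdifferentiable hf).div hf hf0

lemma D_vadd {f g : ℍ → ℂ} {x : ℝ} (h : ∀ τ : ℍ, f (x +ᵥ τ) = g τ) (τ : ℍ) :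
    D f (x +ᵥ τ) = D g τ := by
  simp only [normalizedDerivOfComplex]
  congr 1
  rw [coe_vadd, add_comm, ← deriv_comp_add_const]
  refine Filter.EventuallyEq.deriv_eq ?_
  filter_upwards [isOpen_upperHalfPlaneSet.mem_nhds τ.im_pos] with w hw
  have hw' : 0 < w.im := hw
  have h1 : 0 < (w + x).im := by simpa using hw'
  simp only [Function.comp_apply, ofComplex_apply_of_im_pos h1, ofComplex_apply_of_im_pos hw']
  rw [← h]
  congr 1
  ext
  simp [add_comm]

lemma HasPeriod.D {h : ℕ} {f : ℍ → ℂ} (hf : HasPeriod h f) : HasPeriod h (D f) := D_vadd hf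

/-- A holomorphic periodic function that is bounded at `i∞` is an analytic function of
`q_h = exp (2πiτ/h)`, so its derivative tends to `0`. -/
lemma HasPeriod.tendsto_D {h : ℕ} (hh : 0 < h) {f : ℍ → ℂ} (hf : HasPeriod h f) (hd : MDiff f)
    (hb : IsBoundedAtImInfty f) :
    Tendsto (Derivative.normalizedDerivOfComplex f) atImInfty (𝓝 0) := by
  have hh' : (0 : ℝ) < h := by exact_mod_cast hh
  have hp := hf.comp_ofComplex
  set Φ := cuspFunction h f with hΦ
  have hΦ0 : AnalyticAt ℂ Φ 0 := analyticAt_cuspFunction_zero hh' hp hd hb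
  have key : ∀ τ : ℍ, Derivative.normalizedDerivOfComplex f τ
      = (h : ℂ)⁻¹ * (qParam h τ * deriv Φ (qParam h τ)) := by
    intro τ
    have hq : ‖qParam h τ‖ < 1 := norm_qParam_lt_one hh' τ.im_pos
    have hΦd := (differentiableAt_cuspFunction hh' hp hd hb hq).hasDerivAt
    have hqd : HasDerivAt (qParam h) (qParam h τ * (2 * Real.pi * I / h)) (τ : ℂ) := by
      have h1 : HasDerivAt (fun z : ℂ => 2 * Real.pi * I * z / ((h : ℝ) : ℂ))
          (2 * Real.pi * I / h) (τ : ℂ) := by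
        simpa using ((hasDerivAt_id (τ : ℂ)).const_mul (2 * Real.pi * I)).div_const ((h : ℝ) : ℂ)
      exact h1.cexp
    have h2 := hΦd.comp (τ : ℂ) hqd
    have h3 : f ∘ ofComplex =ᶠ[𝓝 (τ : ℂ)] Φ ∘ qParam h := by
      filter_upwards [isOpen_upperHalfPlaneSet.mem_nhds τ.im_pos] with w hw
      have hw' : 0 < w.im := hw
      simp only [Function.comp_apply, ofComplex_apply_of_im_pos hw']
      exact (eq_cuspFunction ⟨w, hw'⟩ hh'.ne' hp).symm
    simp only [Derivative.normalizedDerivOfComplex]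
    rw [h3.deriv_eq, h2.deriv]
    have hpi : (2 * Real.pi * I : ℂ) ≠ 0 := Complex.two_pi_I_ne_zero
    have hhc : (h : ℂ) ≠ 0 := by exact_mod_cast hh.ne'
    rw [← hΦ]
    field_simp
  have h0 : Tendsto (fun q : ℂ => (h : ℂ)⁻¹ * (q * deriv Φ q)) (𝓝 0) (𝓝 0) := by
    have := (continuousAt_const.mul (continuousAt_id.mul hΦ0.deriv.continuousAt) :
      ContinuousAt (fun q : ℂ => (h : ℂ)⁻¹ * (q * deriv Φ q)) 0)
    have h1 := this.tendsto
    rwa [Pi.mul_apply, zero_mul, mul_zero] at h1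
  exact (h0.comp (qParam_tendsto_atImInfty hh')).congr fun τ => (key τ).symm

/-! ### Forms without zeros near a cusp -/

/-- The exponential `exp (2πi x τ)`. -/
noncomputable def expTwoPi (x : ℂ) (τ : ℍ) : ℂ := cexp (2 * Real.pi * I * x * τ)

lemma expTwoPi_ne_zero (x : ℂ) (τ : ℍ) : expTwoPi x τ ≠ 0 := exp_ne_zero _

lemma expTwoPi_add (x y : ℂ) (τ : ℍ) : expTwoPi (x + y) τ = expTwoPi x τ * expTwoPi y τ := by
  rw [expTwoPi, expTwoPi, expTwoPi, ← Complex.exp_add]; ring_nf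

lemma expTwoPi_neg (x : ℂ) (τ : ℍ) : expTwoPi (-x) τ = (expTwoPi x τ)⁻¹ := by
  rw [expTwoPi, expTwoPi, ← Complex.exp_neg]; ring_nf

lemma expTwoPi_natMul (n : ℕ) (x : ℂ) (τ : ℍ) : expTwoPi (n * x) τ = expTwoPi x τ ^ n := by
  rw [expTwoPi, expTwoPi, ← Complex.exp_nat_mul]; ring_nf

lemma expTwoPi_vadd (x : ℂ) (h : ℝ) (τ : ℍ) :
    expTwoPi x (h +ᵥ τ) = cexp (2 * Real.pi * I * (x * h)) * expTwoPi x τ := by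
  rw [expTwoPi, expTwoPi, ← Complex.exp_add, coe_vadd]; ring_nf

lemma mdiff_expTwoPi (x : ℂ) : MDiff (expTwoPi x) := by
  rw [UpperHalfPlane.mdifferentiable_iff]
  refine DifferentiableOn.congr (f := fun z : ℂ => cexp (2 * Real.pi * I * x * z)) (by fun_prop) ?_
  intro z hz
  have hz' : 0 < z.im := hz
  simp [expTwoPi, ofComplex_apply_of_im_pos hz']

lemma logD_expTwoPi (x : ℂ) (τ : ℍ) : logD (expTwoPi x) τ = x := by
  have h1 : HasDerivAt (fun z : ℂ => cexp (2 * Real.pi * I * x * z))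
      (expTwoPi x τ * (2 * Real.pi * I * x)) (τ : ℂ) := by
    have : HasDerivAt (fun z : ℂ => 2 * Real.pi * I * x * z) (2 * Real.pi * I * x) (τ : ℂ) := by
      simpa using (hasDerivAt_id (τ : ℂ)).const_mul (2 * Real.pi * I * x)
    exact this.cexp
  have h2 : expTwoPi x ∘ ofComplex =ᶠ[𝓝 (τ : ℂ)] fun z : ℂ => cexp (2 * Real.pi * I * x * z) := by
    filter_upwards [isOpen_upperHalfPlaneSet.mem_nhds τ.im_pos] with w hw
    have hw' : 0 < w.im := hw
    simp [expTwoPi, ofComplex_apply_of_im_pos hw']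
  simp only [logD, Pi.div_apply, normalizedDerivOfComplex]
  rw [h2.deriv_eq, h1.deriv]
  have := expTwoPi_ne_zero x τ
  have hpi : (2 * Real.pi * I : ℂ) ≠ 0 := Complex.two_pi_I_ne_zero
  field_simp

/-- The behaviour at `i∞` of a nowhere vanishing form: `f` is holomorphic without zeros on `ℍ`,
picks up a constant under `τ ↦ τ + h`, and is asymptotic to a nonzero multiple of
`exp (2πi o τ / h)`. -/
structure Lead (h : ℕ) (o : ℚ) (f : ℍ → ℂ) : Prop where
  holo : MDiff f
  ne_zero : ∀ τ, f τ ≠ 0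
  period : ∃ ξ : ℂ, ∀ τ : ℍ, f ((h : ℝ) +ᵥ τ) = ξ * f τ
  lim : ∃ c : ℂ, c ≠ 0 ∧ Tendsto (fun τ : ℍ => f τ * expTwoPi (-(o / h)) τ) atImInfty (𝓝 c)

namespace Lead

variable {h : ℕ} {o o' : ℚ} {f g : ℍ → ℂ}

lemma mul (hf : Lead h o f) (hg : Lead h o' g) : Lead h (o + o') (f * g) where
  holo := hf.holo.mul hg.holo
  ne_zero τ := mul_ne_zero (hf.ne_zero τ) (hg.ne_zero τ)
  period := by
    obtain ⟨ξ, hξ⟩ := hf.period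
    obtain ⟨ζ, hζ⟩ := hg.period
    exact ⟨ξ * ζ, fun τ => by simp only [Pi.mul_apply, hξ, hζ]; ring⟩
  lim := by
    obtain ⟨c, hc, hl⟩ := hf.lim
    obtain ⟨d, hd, hl'⟩ := hg.lim
    refine ⟨c * d, mul_ne_zero hc hd, (hl.mul hl').congr fun τ => ?_⟩
    rw [show (-(((o + o' : ℚ) : ℂ) / h)) = -((o : ℂ) / h) + -((o' : ℂ) / h) by push_cast; ring,
      expTwoPi_add]
    simp only [Pi.mul_apply]; ring

lemma inv (hf : Lead h o f) : Lead h (-o) f⁻¹ where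
  holo := hf.holo.inv hf.ne_zero
  ne_zero τ := inv_ne_zero (hf.ne_zero τ)
  period := by
    obtain ⟨ξ, hξ⟩ := hf.period
    exact ⟨ξ⁻¹, fun τ => by simp only [Pi.inv_apply, hξ, mul_inv]⟩
  lim := by
    obtain ⟨c, hc, hl⟩ := hf.lim
    refine ⟨c⁻¹, inv_ne_zero hc, (hl.inv₀ hc).congr fun τ => ?_⟩
    rw [show (-(((-o : ℚ) : ℂ) / h)) = -(-((o : ℂ) / h)) by push_cast; ring, expTwoPi_neg (-_)]
    simp only [Pi.inv_apply, mul_inv]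

lemma div (hf : Lead h o f) (hg : Lead h o' g) : Lead h (o - o') (f / g) := by
  simpa [div_eq_mul_inv, sub_eq_add_neg] using hf.mul hg.inv

lemma pow (hf : Lead h o f) (n : ℕ) : Lead h (n * o) (f ^ n) where
  holo := hf.holo.pow n
  ne_zero τ := pow_ne_zero n (hf.ne_zero τ)
  period := by
    obtain ⟨ξ, hξ⟩ := hf.period
    exact ⟨ξ ^ n, fun τ => by simp only [Pi.pow_apply, hξ, mul_pow]⟩
  lim := by
    obtain ⟨c, hc, hl⟩ := hf.lim
    refine ⟨c ^ n, pow_ne_zero n hc, (hl.pow n).congr fun τ => ?_⟩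
    rw [show (-(((n * o : ℚ) : ℂ) / h)) = n * -((o : ℂ) / h) by push_cast; ring, expTwoPi_natMul]
    simp only [Pi.pow_apply]; ring

lemma smul (hf : Lead h o f) {c : ℂ} (hc : c ≠ 0) : Lead h o (c • f) where
  holo := hf.holo.const_smul c
  ne_zero τ := mul_ne_zero hc (hf.ne_zero τ)
  period := by
    obtain ⟨ξ, hξ⟩ := hf.period
    exact ⟨ξ, fun τ => by simp only [Pi.smul_apply, hξ, smul_eq_mul]; ring⟩
  lim := by
    obtain ⟨d, hd, hl⟩ := hf.lim
    refine ⟨c * d, mul_ne_zero hc hd, (hl.const_mul c).congr fun τ => ?_⟩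
    simp only [Pi.smul_apply, smul_eq_mul]; ring

/-- After removal of the exponential factor one has a periodic function, as it has a nonzero
limit. -/
lemma reduced_period (hf : Lead h o f) :
    HasPeriod h (f * expTwoPi (-(o / h))) := by
  obtain ⟨ξ, hξ⟩ := hf.period
  obtain ⟨c, hc, hl⟩ := hf.lim
  set e : ℂ := cexp (2 * Real.pi * I * (-(o / h) * (h : ℝ)))
  have key : ∀ τ : ℍ, (f * expTwoPi (-(o / h))) ((h : ℝ) +ᵥ τ)
      = ξ * e * (f * expTwoPi (-(o / h))) τ := by
    intro τ
    simp only [Pi.mul_apply, hξ, expTwoPi_vadd, e]; ring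
  have h1 := hl.comp (tendsto_vadd_atImInfty h)
  have h2 : Tendsto (fun τ => ξ * e * (f τ * expTwoPi (-(o / h)) τ)) atImInfty (𝓝 c) :=
    h1.congr fun τ => by simpa using key τ
  have h3 : c = ξ * e * c := tendsto_nhds_unique h2 (hl.const_mul _)
  have h4 : ξ * e = 1 := by
    apply mul_right_cancel₀ hc; rw [← h3, one_mul]
  intro τ
  rw [key, h4, one_mul]

lemma hasPeriod {n : ℤ} (hh : 0 < h) (hf : Lead h n f) : HasPeriod h f := by
  intro τ
  have h1 := hf.reduced_period τ
  simp only [Pi.mul_apply, expTwoPi_vadd] at h1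
  have hhc : (h : ℂ) ≠ 0 := by exact_mod_cast hh.ne'
  have h2 : cexp (2 * Real.pi * I * (-(((n : ℚ) : ℂ) / h) * (h : ℝ))) = 1 := by
    rw [Complex.exp_eq_one_iff]
    exact ⟨-n, by push_cast; field_simp⟩
  rw [h2, one_mul] at h1
  exact mul_right_cancel₀ (expTwoPi_ne_zero _ _) h1

lemma period_ne_zero (hf : Lead h o f) : ∃ ξ : ℂ, ξ ≠ 0 ∧ ∀ τ : ℍ, f ((h : ℝ) +ᵥ τ) = ξ * f τ := by
  obtain ⟨ξ, hξ⟩ := hf.period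
  refine ⟨ξ, ?_, hξ⟩
  rintro rfl
  exact hf.ne_zero _ (by rw [hξ UpperHalfPlane.I, zero_mul])

lemma mdiff_logD (hf : Lead h o f) : MDiff (logD f) := TripleForms.mdiff_logD hf.holo hf.ne_zero

lemma logD_hasPeriod (hf : Lead h o f) : HasPeriod h (logD f) := by
  obtain ⟨ξ, h0, hξ⟩ := hf.period_ne_zero
  intro τ
  simp only [logD, Pi.div_apply, hξ]
  have h1 : ∀ τ : ℍ, f ((h : ℝ) +ᵥ τ) = (ξ • f) τ := hξ
  rw [D_vadd h1, normalizedDerivOfComplex_smul _ _ hf.holo]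
  simp only [Pi.smul_apply, smul_eq_mul]
  exact mul_div_mul_left _ _ h0

lemma tendsto_logD (hh : 0 < h) (hf : Lead h o f) :
    Tendsto (logD f) atImInfty (𝓝 (o / h)) := by
  obtain ⟨c, hc, hl⟩ := hf.lim
  have hd : MDiff (f * expTwoPi (-(o / h))) := hf.holo.mul (mdiff_expTwoPi _)
  have h1 := (hf.reduced_period).tendsto_D hh hd (isBoundedAtImInfty_of_tendsto hl)
  have h2 : logD (f * expTwoPi (-(o / h))) = fun τ => logD f τ - o / h := by
    rw [logD_mul hf.holo (mdiff_expTwoPi _) hf.ne_zero (expTwoPi_ne_zero _)]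
    ext τ; simp only [Pi.add_apply, logD_expTwoPi]; ring
  have h3 : Tendsto (fun τ => logD f τ - o / h) atImInfty (𝓝 0) := by
    rw [← h2]
    simpa [logD] using! h1.div hl hc
  simpa using h3.add_const ((o : ℂ) / h)

lemma bdd_logD (hh : 0 < h) (hf : Lead h o f) : IsBoundedAtImInfty (logD f) :=
  isBoundedAtImInfty_of_tendsto (hf.tendsto_logD hh)

lemma tendsto_D_logD (hh : 0 < h) (hf : Lead h o f) :
    Tendsto (D (logD f)) atImInfty (𝓝 0) :=
  hf.logD_hasPeriod.tendsto_D hh hf.mdiff_logD (hf.bdd_logD hh)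

lemma tendsto_ne_zero (hf : Lead h 0 f) : ∃ c : ℂ, c ≠ 0 ∧ Tendsto f atImInfty (𝓝 c) := by
  simpa [expTwoPi] using hf.lim

lemma bdd_inv (hf : Lead h 0 f) : IsBoundedAtImInfty f⁻¹ := by
  obtain ⟨c, hc, hl⟩ := hf.tendsto_ne_zero
  exact isBoundedAtImInfty_of_tendsto (hl.inv₀ hc)

lemma norm_expTwoPi {x : ℝ} (τ : ℍ) : ‖expTwoPi x τ‖ = Real.exp (-2 * Real.pi * x * τ.im) := by
  rw [expTwoPi, Complex.norm_exp]
  congr 1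
  rw [show (2 * Real.pi * I * x * τ : ℂ) = ((2 * Real.pi * x : ℝ) : ℂ) * (I * τ) by
    push_cast; ring, Complex.re_ofReal_mul]
  simp

lemma tendsto_zero (hh : 0 < h) (hf : Lead h o f) (ho : 0 < o) :
    Tendsto f atImInfty (𝓝 0) := by
  obtain ⟨c, hc, hl⟩ := hf.lim
  have hx : (0 : ℝ) < o / h := by
    have : (0 : ℝ) < o := by exact_mod_cast ho
    positivity
  have h1 : Tendsto (expTwoPi ((o : ℂ) / h)) atImInfty (𝓝 0) := by
    rw [tendsto_zero_iff_norm_tendsto_zero]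
    have h2 : ∀ τ : ℍ, ‖expTwoPi ((o : ℂ) / h) τ‖
        = Real.exp (-(2 * Real.pi * ((o : ℝ) / h) * τ.im)) := by
      intro τ
      have := norm_expTwoPi (x := (o : ℝ) / h) τ
      push_cast at this
      rw [this]; ring_nf
    simp_rw [h2]
    refine Real.tendsto_exp_neg_atTop_nhds_zero.comp ?_
    exact Tendsto.const_mul_atTop (by positivity) tendsto_comap
  have h3 := hl.mul h1
  rw [mul_zero] at h3
  refine h3.congr fun τ => ?_
  rw [expTwoPi_neg, mul_assoc, inv_mul_cancel₀ (expTwoPi_ne_zero _ _), mul_one]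

lemma bdd (hh : 0 < h) (hf : Lead h o f) (ho : 0 ≤ o) : IsBoundedAtImInfty f := by
  rcases ho.eq_or_lt with rfl | ho
  · obtain ⟨c, hc, hl⟩ := hf.tendsto_ne_zero
    exact isBoundedAtImInfty_of_tendsto hl
  · exact isBoundedAtImInfty_of_tendsto (hf.tendsto_zero hh ho)

/-- A periodic holomorphic function vanishing at `i∞` is `O(q_h)`, hence it may be divided by any
form with a simple zero at `i∞`. -/
lemma bdd_div (hh : 0 < h) (hf : Lead h 1 f) (hg : HasPeriod h g) (hgd : MDiff g)
    (hg0 : Tendsto g atImInfty (𝓝 0)) : IsBoundedAtImInfty (g / f) := by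
  have hh' : (0 : ℝ) < h := by exact_mod_cast hh
  have hdecay : g =O[atImInfty] fun τ => Real.exp (-2 * Real.pi * τ.im / h) :=
    IsZeroAtImInfty.exp_decay_atImInfty hg0 hh' hg.comp_ofComplex hgd
      (isBoundedAtImInfty_of_tendsto hg0)
  obtain ⟨c, hc, hl⟩ := hf.lim
  have h1 : (fun τ => (f τ * expTwoPi (-((1 : ℚ) / h)) τ)⁻¹) =O[atImInfty] (1 : ℍ → ℝ) :=
    (hl.inv₀ hc).isBigO_one ℝ
  have h2 : (expTwoPi (-(((1 : ℚ) : ℂ) / h))) =O[atImInfty]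
      fun τ : ℍ => Real.exp (2 * Real.pi * τ.im / h) := by
    refine Asymptotics.IsBigO.of_bound 1 (Eventually.of_forall fun τ => ?_)
    have := norm_expTwoPi (x := -(1 / h : ℝ)) τ
    push_cast at this
    rw [Rat.cast_one, this, one_mul, Real.norm_of_nonneg (Real.exp_pos _).le]
    apply le_of_eq; congr 1; ring
  have h3 := (hdecay.mul h2).mul h1
  refine (h3.congr (fun τ => ?_) fun τ => ?_ : (g / f) =O[atImInfty] (1 : ℍ → ℝ))
  · have := expTwoPi_ne_zero (-(((1 : ℚ) : ℂ) / h)) τ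
    have := hf.ne_zero τ
    simp only [Pi.div_apply, mul_inv]
    field_simp
  · rw [← Real.exp_add]
    simp only [Pi.one_apply, mul_one]
    rw [show -2 * Real.pi * τ.im / h + 2 * Real.pi * τ.im / h = 0 by ring, Real.exp_zero]

end Lead

end TripleForms

namespace TripleForms

open ModularGroup CongruenceSubgroup Matrix.SpecialLinearGroup

/-! ### Generators of `Γ₀(N)` -/

lemma mul_apply_zero_zero (A B : SL(2, ℤ)) : (A * B) 0 0 = A 0 0 * B 0 0 + A 0 1 * B 1 0 := by
  simp [Matrix.mul_apply]

lemma mul_apply_one_zero (A B : SL(2, ℤ)) : (A * B) 1 0 = A 1 0 * B 0 0 + A 1 1 * B 1 0 := by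
  simp [Matrix.mul_apply]

lemma mul_apply_one_one (A B : SL(2, ℤ)) : (A * B) 1 1 = A 1 0 * B 0 1 + A 1 1 * B 1 1 := by
  simp [Matrix.mul_apply]

lemma det_eq_one (A : SL(2, ℤ)) : A 0 0 * A 1 1 - A 0 1 * A 1 0 = 1 := by
  have := A.det_coe
  rwa [Matrix.det_fin_two] at this

lemma ext_entries {A B : SL(2, ℤ)} (h00 : A 0 0 = B 0 0) (h01 : A 0 1 = B 0 1)
    (h10 : A 1 0 = B 1 0) (h11 : A 1 1 = B 1 1) : A = B := by
  ext i j; fin_cases i <;> fin_cases j <;> assumption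

lemma T_zpow_entries (n : ℤ) : (T ^ n) 0 0 = 1 ∧ (T ^ n) 0 1 = n ∧ (T ^ n) 1 0 = 0 ∧
    (T ^ n) 1 1 = 1 := by
  have := coe_T_zpow n
  simp [this]

lemma S_entries : S 0 0 = 0 ∧ S 0 1 = -1 ∧ S 1 0 = 1 ∧ S 1 1 = 0 := by
  simp [S]

lemma inv_entries (A : SL(2, ℤ)) : A⁻¹ 0 0 = A 1 1 ∧ A⁻¹ 0 1 = -A 0 1 ∧ A⁻¹ 1 0 = -A 1 0 ∧
    A⁻¹ 1 1 = A 0 0 := by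
  simp [Matrix.SpecialLinearGroup.coe_inv, Matrix.adjugate_fin_two]

lemma neg_entries (A : SL(2, ℤ)) (i j : Fin 2) : (-A) i j = -A i j := by
  simp

lemma eq_T_zpow_of_lower_left_eq_zero {γ : SL(2, ℤ)} (hc : γ 1 0 = 0) :
    ∃ n : ℤ, γ = T ^ n ∨ γ = -T ^ n := by
  have hdet := det_eq_one γ
  rw [hc, mul_zero, sub_zero] at hdet
  rcases Int.mul_eq_one_iff_eq_one_or_neg_one.mp hdet with ⟨ha, hd⟩ | ⟨ha, hd⟩
  · obtain ⟨h1, h2, h3, h4⟩ := T_zpow_entries (γ 0 1)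
    exact ⟨γ 0 1, Or.inl (ext_entries (by rw [h1, ha]) (by rw [h2]) (by rw [h3, hc])
      (by rw [h4, hd]))⟩
  · obtain ⟨h1, h2, h3, h4⟩ := T_zpow_entries (-γ 0 1)
    refine ⟨-γ 0 1, Or.inr (ext_entries ?_ ?_ ?_ ?_)⟩ <;> rw [neg_entries]
    · rw [h1, ha]
    · rw [h2, neg_neg]
    · rw [h3, hc, neg_zero]
    · rw [h4, hd]

lemma mem_Gamma0_iff {N : ℕ} {γ : SL(2, ℤ)} : γ ∈ Gamma0 N ↔ (N : ℤ) ∣ γ 1 0 := by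
  rw [Gamma0_mem, ZMod.intCast_zmod_eq_zero_iff_dvd]

/-- Division with remainder of least absolute value. -/
lemma exists_two_mul_abs_add_mul_le (a : ℤ) {c : ℤ} (hc : c ≠ 0) :
    ∃ k : ℤ, 2 * |a + k * c| ≤ |c| := by
  have h0 := Int.emod_nonneg a hc
  have h1 := Int.emod_lt_abs a hc
  have h2 := Int.emod_add_mul_ediv a c
  by_cases h : 2 * (a % c) ≤ |c|
  · refine ⟨-(a / c), ?_⟩
    rw [show a + -(a / c) * c = a % c by linarith, abs_of_nonneg h0]
    exact h
  · push Not at h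
    refine ⟨-(a / c) - SignType.sign c, ?_⟩
    rw [show a + (-(a / c) - SignType.sign c) * c = a % c - |c| by
      rw [← sign_mul_self c]; linarith, abs_of_neg (by linarith)]
    linarith

/-- `Γ₀(N)` is generated by `-1`, `T` and `S T^N S⁻¹` for `N ≤ 4`, by a Euclidean algorithm on the
first column. -/
theorem Gamma0_le_of_generators {N : ℕ} (hN : 2 ≤ N) (hN4 : N ≤ 4) {H : Subgroup SL(2, ℤ)}
    (h1 : -1 ∈ H) (hT : T ∈ H) (hV : S * T ^ (N : ℤ) * S⁻¹ ∈ H) : Gamma0 N ≤ H := by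
  suffices ∀ n : ℕ, ∀ γ : SL(2, ℤ), (γ 1 0).natAbs = n → (N : ℤ) ∣ γ 1 0 → γ ∈ H from
    fun γ hγ => this _ γ rfl (mem_Gamma0_iff.mp hγ)
  intro n
  induction n using Nat.strong_induction_on with
  | _ n ih =>
  intro γ hn hdvd
  -- `a` is reduced modulo `c` by a power of `T`, then `c` modulo `N a` by a power of `S T^N S⁻¹`
  by_cases hc : γ 1 0 = 0
  · obtain ⟨m, rfl | rfl⟩ := eq_T_zpow_of_lower_left_eq_zero hc
    · exact H.zpow_mem hT m
    · rw [← neg_one_mul]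
      exact H.mul_mem h1 (H.zpow_mem hT m)
  obtain ⟨k, hk⟩ := exists_two_mul_abs_add_mul_le (γ 0 0) hc
  obtain ⟨t1, t2, t3, t4⟩ := T_zpow_entries k
  set γ' := T ^ k * γ with hγ'
  have e00 : γ' 0 0 = γ 0 0 + k * γ 1 0 := by rw [hγ', mul_apply_zero_zero, t1, t2]; ring
  have e10 : γ' 1 0 = γ 1 0 := by rw [hγ', mul_apply_one_zero, t3, t4]; ring
  have hdet := det_eq_one γ'
  rw [← e00] at hk
  rw [← e10] at hk hc hn hdvd
  set a := γ' 0 0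
  set c := γ' 1 0
  have hN0 : (N : ℤ) ≠ 0 := by positivity
  have ha : a ≠ 0 := by
    intro ha
    rw [ha, zero_mul, zero_sub] at hdet
    have : (N : ℤ) ∣ 1 := hdet ▸ (hdvd.mul_left _).neg_right
    have := Int.le_of_dvd one_pos this
    omega
  obtain ⟨m, hm⟩ := exists_two_mul_abs_add_mul_le c (mul_ne_zero hN0 ha)
  set V := S * T ^ (N : ℤ) * S⁻¹ with hVdef
  have hVm : ∀ m : ℤ, (V ^ m) 1 0 = -(m * N) ∧ (V ^ m) 1 1 = 1 := by
    intro m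
    have : V ^ m = S * T ^ (N * m : ℤ) * S⁻¹ := by
      rw [hVdef, conj_zpow, ← zpow_mul]
    obtain ⟨q1, q2, q3, q4⟩ := T_zpow_entries (N * m)
    obtain ⟨s1, s2, s3, s4⟩ := S_entries
    obtain ⟨i1, i2, i3, i4⟩ := inv_entries S
    rw [this, mul_apply_one_zero, mul_apply_one_one, mul_apply_one_one, mul_apply_one_zero,
      q1, q2, q3, q4, i1, i2, i3, i4, s1, s2, s3, s4]
    constructor <;> ring
  set γ'' := V ^ (-m) * γ' with hγ''
  have f10 : γ'' 1 0 = c + m * (N * a) := by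
    rw [hγ'', mul_apply_one_zero, (hVm _).1, (hVm _).2]; ring
  have hlt : (γ'' 1 0).natAbs < n := by
    rw [f10, ← hn]
    zify
    by_contra! hle
    rw [abs_mul, Nat.abs_cast] at hm
    have hN4' : (N : ℤ) ≤ 4 := by exact_mod_cast hN4
    have hcpos : 0 < |c| := abs_pos.mpr hc
    have hapos : 0 < |a| := abs_pos.mpr ha
    -- `2 |a| ≤ |c|` gives `|c + m N a| ≤ N |a| / 2 ≤ N |c| / 4`; equality `N = 4`, `2 |a| = |c|`
    -- would make `a` a unit and `|c| = 2`, against `4 ∣ c`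
    have hN' : (N : ℤ) = 4 := by
      by_contra hne
      have : (N : ℤ) ≤ 3 := by omega
      nlinarith
    have h2a : 2 * |a| = |c| := by rw [hN'] at hm hle; linarith
    have hac : a ∣ c := (abs_dvd_abs a c).mp ⟨2, by linarith⟩
    have h1' : a ∣ 1 := hdet ▸ dvd_sub (dvd_mul_right _ _) (hac.mul_left _)
    have h4 : (4 : ℤ) ∣ |c| := (dvd_abs _ _).mpr (hN' ▸ hdvd)
    have := Int.isUnit_iff_abs_eq.mp (isUnit_of_dvd_one h1')
    omega
  have hdvd'' : (N : ℤ) ∣ γ'' 1 0 := by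
    rw [f10]
    exact dvd_add hdvd (Dvd.intro (m * a) (by ring))
  have hmem := ih _ hlt γ'' rfl hdvd''
  have : γ = (T ^ k)⁻¹ * ((V ^ (-m))⁻¹ * γ'') := by
    rw [hγ'', hγ']; group
  rw [this]
  exact H.mul_mem (H.inv_mem (H.zpow_mem hT k))
    (H.mul_mem (H.inv_mem (H.zpow_mem hV _)) hmem)

/-! ### Cusps of `Γ₀(N)` -/

/-- The matrix `(1, 0; 2, 1)`, which sends `i∞` to `1 / 2`. -/
def halfCusp : SL(2, ℤ) := ⟨!![1, 0; 2, 1], by simp⟩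

lemma halfCusp_entries : halfCusp 0 0 = 1 ∧ halfCusp 0 1 = 0 ∧ halfCusp 1 0 = 2 ∧
    halfCusp 1 1 = 1 := by
  simp [halfCusp]

/-- `IsRep N g h`: the cusp `g • i∞` is one of the chosen representatives `i∞`, `0` and (for
`N = 4`) `1 / 2` of the cusps of `Γ₀(N)`, and `h` is its width. -/
inductive IsRep (N : ℕ) : SL(2, ℤ) → ℕ → Prop
  | infty : IsRep N 1 1
  | zero : IsRep N S N
  | half : N = 4 → IsRep N halfCusp 1

lemma IsRep.pos {N : ℕ} (hN : 2 ≤ N) {g : SL(2, ℤ)} {h : ℕ} (hg : IsRep N g h) : 0 < h := by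
  cases hg <;> omega

lemma gcd_lower_left_mul {N : ℕ} {δ : SL(2, ℤ)} (hδ : δ ∈ Gamma0 N) (g : SL(2, ℤ)) :
    Int.gcd ((δ * g) 1 0) N = Int.gcd (g 1 0) N := by
  obtain ⟨k, hk⟩ := mem_Gamma0_iff.mp hδ
  have hdet := det_eq_one δ
  have hcop : IsCoprime (δ 1 1) (N : ℤ) := ⟨δ 0 0, -(δ 0 1 * k), by
    linear_combination hdet + δ 0 1 * hk⟩
  rw [mul_apply_one_zero, hk, mul_assoc, add_comm, Int.gcd_add_mul_left_left]
  exact Int.gcd_mul_right_left_of_gcd_eq_one (Int.isCoprime_iff_gcd_eq_one.mp hcop)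

lemma lower_left_mul_T_zpow (g : SL(2, ℤ)) (j : ℤ) : (g * T ^ j) 1 0 = g 1 0 := by
  obtain ⟨t1, t2, t3, t4⟩ := T_zpow_entries j
  rw [mul_apply_one_zero, t1, t3]; ring

lemma IsRep.eq_of_gcd_eq {N : ℕ} (hN : 2 ≤ N) {g g' : SL(2, ℤ)} {h h' : ℕ} (hg : IsRep N g h)
    (hg' : IsRep N g' h') (he : Int.gcd (g 1 0) N = Int.gcd (g' 1 0) N) : g = g' ∧ h = h' := by
  have h1 : ((1 : SL(2, ℤ)) 1 0).gcd N = N := by simp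
  have h2 : (S 1 0).gcd N = 1 := by rw [S_entries.2.2.1, Int.one_gcd]
  have h3 : N = 4 → (halfCusp 1 0).gcd N = 2 := by rintro rfl; rw [halfCusp_entries.2.2.1]; rfl
  cases hg <;> cases hg' <;> first | exact ⟨rfl, rfl⟩ | (exfalso; omega)

lemma exists_rep {N : ℕ} (hN : N = 2 ∨ N = 3 ∨ N = 4) (γ : SL(2, ℤ)) :
    ∃ g h, IsRep N g h ∧ ∃ δ ∈ Gamma0 N, ∃ j : ℤ, γ = δ * g * T ^ j := by
  have hS : ∀ (_ : (N : ℤ) ∣ 1 - γ 1 0 ^ 2),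
      ∃ g h, IsRep N g h ∧ ∃ δ ∈ Gamma0 N, ∃ j : ℤ, γ = δ * g * T ^ j := by
    intro hd
    set j := γ 1 0 * γ 1 1
    refine ⟨S, N, .zero, γ * (T ^ j)⁻¹ * S⁻¹, ?_, j, by group⟩
    obtain ⟨t1, t2, t3, t4⟩ := T_zpow_entries (-j)
    obtain ⟨s1, s2, s3, s4⟩ := S_entries
    obtain ⟨i1, i2, i3, i4⟩ := inv_entries S
    rw [mem_Gamma0_iff, mul_apply_one_zero, ← zpow_neg, mul_apply_one_zero, mul_apply_one_one,
      t1, t2, t3, t4, i1, i3, s3, s4]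
    obtain ⟨k, hk⟩ := hd
    exact ⟨-(γ 1 1 * k), by linear_combination (-γ 1 1) * hk⟩
  have h1 : ∀ (_ : (N : ℤ) ∣ γ 1 0),
      ∃ g h, IsRep N g h ∧ ∃ δ ∈ Gamma0 N, ∃ j : ℤ, γ = δ * g * T ^ j := fun hd =>
    ⟨1, 1, .infty, γ, mem_Gamma0_iff.mpr hd, 0, by simp⟩
  rcases hN with rfl | rfl | rfl
  · obtain ⟨k, hk | hk⟩ := Int.even_or_odd' (γ 1 0)
    · exact h1 ⟨k, hk⟩
    · exact hS ⟨-(2 * k ^ 2 + 2 * k), by rw [hk]; push_cast; ring⟩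
  · obtain h | h | h : γ 1 0 % 3 = 0 ∨ γ 1 0 % 3 = 1 ∨ γ 1 0 % 3 = 2 := by omega
    · exact h1 (Int.dvd_of_emod_eq_zero h)
    · obtain ⟨k, hk⟩ : ∃ k, γ 1 0 = 3 * k + 1 := ⟨γ 1 0 / 3, by omega⟩
      exact hS ⟨-(3 * k ^ 2 + 2 * k), by rw [hk]; push_cast; ring⟩
    · obtain ⟨k, hk⟩ : ∃ k, γ 1 0 = 3 * k + 2 := ⟨γ 1 0 / 3, by omega⟩
      exact hS ⟨-(3 * k ^ 2 + 4 * k + 1), by rw [hk]; push_cast; ring⟩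
  · obtain ⟨k, hk | hk⟩ := Int.even_or_odd' (γ 1 0)
    · obtain ⟨l, hl | hl⟩ := Int.even_or_odd' k
      · exact h1 ⟨l, by rw [hk, hl]; push_cast; ring⟩
      · refine ⟨halfCusp, 1, .half rfl, γ * halfCusp⁻¹, ?_, 0, by group⟩
        have hdet := det_eq_one γ
        obtain ⟨u1, u2, u3, u4⟩ := halfCusp_entries
        obtain ⟨i1, i2, i3, i4⟩ := inv_entries halfCusp
        rw [mem_Gamma0_iff, mul_apply_one_zero, i1, i3, u3, u4]
        obtain ⟨m, hm | hm⟩ := Int.even_or_odd' (γ 1 1)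
        · rw [hk, hm] at hdet; exfalso
          have : (2 : ℤ) ∣ 1 := ⟨γ 0 0 * m - γ 0 1 * k, by linarith⟩
          omega
        · exact ⟨l - m, by rw [hk, hl, hm]; push_cast; ring⟩
    · exact hS ⟨-(k ^ 2 + k), by rw [hk]; push_cast; ring⟩

lemma smul_infty_eq_iff {γ γ' : SL(2, ℤ)} :
    (mapGL ℚ γ : GL (Fin 2) ℚ) • (∞ : OnePoint ℚ) = (mapGL ℚ γ' : GL (Fin 2) ℚ) • ∞ ↔
      (γ'⁻¹ * γ) 1 0 = 0 := by
  have h : ∀ γ : SL(2, ℤ), (mapGL ℚ γ : GL (Fin 2) ℚ) • (∞ : OnePoint ℚ) = ∞ ↔ γ 1 0 = 0 := by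
    intro γ
    rw [OnePoint.smul_infty_eq_self_iff]
    simp
  rw [← h, map_mul, mul_smul, map_inv, inv_smul_eq_iff]

/-- Two cusps `g • i∞` and `γ • i∞` of `Γ₀(N)`, the first one a chosen representative, are
equivalent if and only if their denominators have the same greatest common divisor with `N`. -/
lemma equivalent_iff {N : ℕ} (hN : N = 2 ∨ N = 3 ∨ N = 4) {g : SL(2, ℤ)} {h : ℕ}
    (hg : IsRep N g h) (γ : SL(2, ℤ)) :
    Equivalent (Gamma0 N) (.inr ((mapGL ℚ g : GL (Fin 2) ℚ) • ∞))
      (.inr ((mapGL ℚ γ : GL (Fin 2) ℚ) • ∞)) ↔ Int.gcd (g 1 0) N = Int.gcd (γ 1 0) N := by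
  constructor
  · rintro ⟨δ, hδ, he⟩
    rw [← mul_smul, ← map_mul, smul_infty_eq_iff] at he
    have h2 : δ * g = γ * (γ⁻¹ * (δ * g)) := by group
    rw [← gcd_lower_left_mul hδ g, h2]
    obtain ⟨n, hn | hn⟩ := eq_T_zpow_of_lower_left_eq_zero he <;> rw [hn]
    · rw [lower_left_mul_T_zpow]
    · rw [mul_neg, neg_entries, lower_left_mul_T_zpow, Int.neg_gcd]
  · intro he
    obtain ⟨g', h', hg', δ, hδ, j, rfl⟩ := exists_rep hN γ
    rw [lower_left_mul_T_zpow, gcd_lower_left_mul hδ] at he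
    obtain ⟨rfl, -⟩ := hg.eq_of_gcd_eq (by omega) hg' he
    refine ⟨δ, hδ, ?_⟩
    rw [← mul_smul, ← map_mul, smul_infty_eq_iff]
    have : (δ * g * T ^ j)⁻¹ * (δ * g) = T ^ (-j) := by group
    rw [this]
    exact (T_zpow_entries _).2.2.1

lemma cuspWidth_eq {N : ℕ} (hN : 2 ≤ N) {g : SL(2, ℤ)} {h : ℕ} (hg : IsRep N g h)
    {δ : SL(2, ℤ)} (hδ : δ ∈ Gamma0 N) (j : ℤ) : cuspWidth (Gamma0 N) (δ * g * T ^ j) = h := by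
  have hgcd : Int.gcd ((δ * g * T ^ j) 1 0) N = Int.gcd (g 1 0) N := by
    rw [lower_left_mul_T_zpow, gcd_lower_left_mul hδ]
  generalize δ * g * T ^ j = γ at hgcd ⊢
  have hmem : ∀ m : ℕ, (γ * T ^ m * γ⁻¹ ∈ Gamma0 N ∨ -(γ * T ^ m * γ⁻¹) ∈ Gamma0 N) ↔
      (N : ℤ) ∣ m * γ 1 0 ^ 2 := by
    intro m
    have h1 : (γ * T ^ m * γ⁻¹) 1 0 = -(m * γ 1 0 ^ 2) := by
      obtain ⟨t1, t2, t3, t4⟩ := T_zpow_entries m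
      obtain ⟨i1, i2, i3, i4⟩ := inv_entries γ
      rw [← zpow_natCast, mul_apply_one_zero, mul_apply_one_zero, mul_apply_one_one, t1, t2, t3,
        t4, i1, i3]
      ring
    rw [mem_Gamma0_iff, mem_Gamma0_iff, neg_entries, h1, neg_neg, dvd_neg, or_self]
  have hdvd : ∀ m : ℕ, (N : ℤ) ∣ m * γ 1 0 ^ 2 ↔ h ∣ m := by
    intro m
    cases hg with
    | infty =>
      have h0 : (N : ℤ) ∣ γ 1 0 := by
        rw [← Int.gcd_eq_right_iff_dvd (by positivity), hgcd]; simp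
      simpa using Dvd.dvd.mul_left (dvd_pow h0 two_ne_zero) (m : ℤ)
    | zero =>
      rw [S_entries.2.2.1, Int.one_gcd] at hgcd
      have hcop : IsCoprime (N : ℤ) (γ 1 0 ^ 2) :=
        (Int.isCoprime_iff_gcd_eq_one.mpr hgcd).symm.pow_right
      rw [← Int.natCast_dvd_natCast]
      exact ⟨hcop.dvd_of_dvd_mul_right, fun h => h.mul_right _⟩
    | half h4 =>
      subst h4
      rw [halfCusp_entries.2.2.1] at hgcd
      have h0 : (2 : ℤ) ∣ γ 1 0 := by
        have := Int.gcd_dvd_left (a := γ 1 0) (b := (4 : ℕ))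
        rw [hgcd] at this
        exact this
      have : ((4 : ℕ) : ℤ) ∣ γ 1 0 ^ 2 := by
        obtain ⟨k, hk⟩ := h0
        exact ⟨k ^ 2, by rw [hk]; push_cast; ring⟩
      simpa using Dvd.dvd.mul_left this (m : ℤ)
  have hset : {m : ℕ | 0 < m ∧ (γ * T ^ m * γ⁻¹ ∈ Gamma0 N ∨ -(γ * T ^ m * γ⁻¹) ∈ Gamma0 N)}
      = {m : ℕ | 0 < m ∧ h ∣ m} := by
    ext m; simp only [Set.mem_ofPred_eq, hmem, hdvd]
  rw [cuspWidth, hset]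
  have hpos := hg.pos hN
  exact le_antisymm (Nat.sInf_le ⟨hpos, dvd_rfl⟩)
    (le_csInf ⟨h, hpos, dvd_rfl⟩ fun m hm => Nat.le_of_dvd hm.1 hm.2)

end TripleForms

namespace TripleForms

open Derivative ModularGroup CongruenceSubgroup Matrix.SpecialLinearGroup ModularForm

/-! ### Forms with multipliers on `Γ₀(N)` -/

lemma slash_T_zpow_apply (k : ℤ) (f : ℍ → ℂ) (j : ℤ) (τ : ℍ) :
    (f ∣[k] (T ^ j)) τ = f ((j : ℝ) +ᵥ τ) := by
  obtain ⟨t1, t2, t3, t4⟩ := T_zpow_entries j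
  rw [SL_slash_apply, modular_T_zpow_smul, denom_apply, t3, t4]
  simp

lemma slash_neg_one (k : ℤ) (f : ℍ → ℂ) : f ∣[k] (-1 : SL(2, ℤ)) = ((-1 : ℂ) ^ (-k)) • f := by
  ext τ
  rw [SL_slash_apply, ModularGroup.SL_neg_smul, one_smul, denom_apply]
  simp [mul_comm]

lemma mdiff_slash {f : ℍ → ℂ} (hf : MDiff f) (k : ℤ) (γ : SL(2, ℤ)) : MDiff (f ∣[k] γ) :=
  hf.slash k _

lemma slash_ne_zero {f : ℍ → ℂ} (hf : ∀ τ, f τ ≠ 0) (k : ℤ) (γ : SL(2, ℤ)) (τ : ℍ) :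
    (f ∣[k] γ) τ ≠ 0 := by
  rw [SL_slash_apply]
  exact mul_ne_zero (hf _) (zpow_ne_zero _ (denom_ne_zero _ _))

lemma slash_pow (k : ℤ) (γ : SL(2, ℤ)) (f : ℍ → ℂ) (m : ℕ) :
    (f ^ m) ∣[(m * k : ℤ)] γ = (f ∣[k] γ) ^ m := by
  ext τ
  rw [Pi.pow_apply, SL_slash_apply, SL_slash_apply, Pi.pow_apply, mul_pow, ← zpow_natCast (_ ^ _),
    ← zpow_mul]
  ring_nf

/-- A criterion for modular forms with multipliers on `Γ₀(N)`: the expansions of the form `f` at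
the representatives of the cusps are bounded, and under translation by the width of the cusp they
pick up a constant. -/
structure QuasiPeriodic (N : ℕ) (k : ℤ) (f : ℍ → ℂ) : Prop where
  holo : MDiff f
  period : ∀ g h, IsRep N g h →
    ∃ ξ : ℂ, ξ ≠ 0 ∧ ∀ τ : ℍ, (f ∣[k] g) ((h : ℝ) +ᵥ τ) = ξ * (f ∣[k] g) τ
  bdd : ∀ g h, IsRep N g h → IsBoundedAtImInfty (f ∣[k] g)

/-- The subgroup of the matrices that multiply `f` by a constant in `M`. It is used with `M = ⊤` for
arbitrary multipliers, and with `M = ⊥` for invariance. -/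
def multiplierSubgroup (k : ℤ) (f : ℍ → ℂ) (M : Subgroup ℂˣ) : Subgroup SL(2, ℤ) where
  carrier := {γ | ∃ χ ∈ M, f ∣[k] γ = (χ : ℂ) • f}
  mul_mem' := by
    rintro γ δ ⟨χ, hχ, h1⟩ ⟨ψ, hψ, h2⟩
    refine ⟨χ * ψ, M.mul_mem hχ hψ, ?_⟩
    rw [SlashAction.slash_mul, h1, SL_smul_slash, h2, smul_smul, Units.val_mul]
  one_mem' := ⟨1, M.one_mem, by simp⟩
  inv_mem' := by
    rintro γ ⟨χ, hχ, h1⟩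
    refine ⟨χ⁻¹, M.inv_mem hχ, ?_⟩
    have h2 : f = (χ : ℂ) • (f ∣[k] γ⁻¹) := by
      rw [← SL_smul_slash, ← h1, ← SlashAction.slash_mul]; simp
    conv_rhs => rw [h2]
    rw [smul_smul, Units.inv_mul, one_smul]

lemma conj_T_mem_multiplierSubgroup {k : ℤ} {f : ℍ → ℂ} {M : Subgroup ℂˣ} {g : SL(2, ℤ)} {h : ℕ}
    {χ : ℂˣ} (hχ : χ ∈ M) (hf : ∀ τ : ℍ, (f ∣[k] g) ((h : ℝ) +ᵥ τ) = χ * (f ∣[k] g) τ) :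
    g * T ^ (h : ℤ) * g⁻¹ ∈ multiplierSubgroup k f M := by
  refine ⟨χ, hχ, ?_⟩
  have h1 : (f ∣[k] g) ∣[k] (T ^ (h : ℤ)) = (χ : ℂ) • (f ∣[k] g) := by
    ext τ
    rw [slash_T_zpow_apply]
    simpa using hf τ
  rw [SlashAction.slash_mul, SlashAction.slash_mul, h1, SL_smul_slash, ← SlashAction.slash_mul,
    mul_inv_cancel, SlashAction.slash_one]

namespace QuasiPeriodic

variable {N : ℕ} {k : ℤ} {f : ℍ → ℂ}

lemma exists_char (hN : N = 2 ∨ N = 3 ∨ N = 4) (hf : QuasiPeriodic N k f) :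
    Gamma0 N ≤ multiplierSubgroup k f ⊤ := by
  have key : ∀ g h, IsRep N g h → g * T ^ (h : ℤ) * g⁻¹ ∈ multiplierSubgroup k f ⊤ := by
    intro g h hg
    obtain ⟨ξ, h0, hξ⟩ := hf.period g h hg
    exact conj_T_mem_multiplierSubgroup (χ := Units.mk0 ξ h0) trivial hξ
  refine Gamma0_le_of_generators (by omega) (by omega) ?_ ?_ (key S N .zero)
  · exact ⟨Units.mk0 ((-1 : ℂ) ^ (-k)) (zpow_ne_zero _ (by norm_num)), trivial, slash_neg_one k f⟩
  · simpa using key 1 1 .infty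

/-- The expansion of `f` at an arbitrary cusp, in terms of that at the representative. -/
lemma exists_slash_eq (hN : N = 2 ∨ N = 3 ∨ N = 4) (hf : QuasiPeriodic N k f) {δ g : SL(2, ℤ)}
    (hδ : δ ∈ Gamma0 N) (j : ℤ) :
    ∃ χ : ℂ, χ ≠ 0 ∧ ∀ τ : ℍ, (f ∣[k] (δ * g * T ^ j)) τ = χ * (f ∣[k] g) ((j : ℝ) +ᵥ τ) := by
  obtain ⟨χ, -, hχ⟩ := hf.exists_char hN hδ
  refine ⟨χ, χ.ne_zero, fun τ => ?_⟩
  rw [SlashAction.slash_mul, SlashAction.slash_mul, hχ, SL_smul_slash, slash_T_zpow_apply]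
  rfl

theorem isMultiplierForm (hN : N = 2 ∨ N = 3 ∨ N = 4) (hf : QuasiPeriodic N k f) :
    IsMultiplierForm (Gamma0 N) k f where
  holo := hf.holo
  transform := by
    choose! χ hχ using fun γ (hγ : γ ∈ Gamma0 N) => hf.exists_char hN hγ
    refine ⟨χ, fun γ hγ τ => ?_⟩
    have h1 := congrFun (hχ γ hγ).2 τ
    rw [SL_slash_apply, zpow_neg, ← div_eq_mul_inv,
      div_eq_iff (zpow_ne_zero _ (denom_ne_zero _ _))] at h1
    rw [h1, denom_apply, Pi.smul_apply, smul_eq_mul]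
    ring
  bdd_at_cusps γ := by
    obtain ⟨g, h, hg, δ, hδ, j, rfl⟩ := exists_rep hN γ
    obtain ⟨χ, -, hχ⟩ := hf.exists_slash_eq hN (g := g) hδ j
    have h1 : IsBoundedAtImInfty fun τ : ℍ => (f ∣[k] g) ((j : ℝ) +ᵥ τ) :=
      (hf.bdd g h hg).comp_tendsto (tendsto_vadd_atImInfty j)
    rw [funext hχ]
    exact Asymptotics.IsBigO.const_mul_left h1 χ

/-- The order of a form at a cusp may be read off from its expansion at the equivalent
representative. -/
theorem hasFormOrder_cusp (hN : N = 2 ∨ N = 3 ∨ N = 4) (hf : QuasiPeriodic N k f) {s : OnePoint ℚ}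
    {o : ℚ} (ho : ∀ g h, IsRep N g h →
      Equivalent (Gamma0 N) (.inr ((mapGL ℚ g : GL (Fin 2) ℚ) • ∞)) (.inr s) →
      ∃ c : ℂ, c ≠ 0 ∧
        Tendsto (fun τ : ℍ => (f ∣[k] g) τ * expTwoPi (-(o / h)) τ) atImInfty (𝓝 c)) :
    HasFormOrder (Gamma0 N) k f (.inr s) o := by
  intro γ hγ
  obtain ⟨g, h, hg, δ, hδ, j, rfl⟩ := exists_rep hN γ
  have heq := (equivalent_iff hN hg (δ * g * T ^ j)).mpr
    (by rw [lower_left_mul_T_zpow, gcd_lower_left_mul hδ])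
  rw [hγ] at heq
  obtain ⟨c, hc, hl⟩ := ho g h hg heq
  obtain ⟨χ, hχ0, hχ⟩ := hf.exists_slash_eq hN (g := g) hδ j
  set e : ℂ := cexp (2 * Real.pi * I * (-(o / h) * (j : ℝ))) with he
  have he0 : e ≠ 0 := exp_ne_zero _
  refine ⟨χ * (c * e⁻¹), mul_ne_zero hχ0 (mul_ne_zero hc (inv_ne_zero he0)), ?_⟩
  have h1 := ((hl.comp (tendsto_vadd_atImInfty (j : ℝ))).mul_const e⁻¹).const_mul χ
  refine h1.congr fun τ => ?_
  rw [hχ, cuspWidth_eq (by omega) hg hδ]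
  simp only [Function.comp_apply, expTwoPi_vadd, ← he]
  have h2 : cexp (-(2 * Real.pi * I * o * τ / h)) = expTwoPi (-(o / h)) τ := by
    rw [expTwoPi]; ring_nf
  rw [h2]
  field_simp

end QuasiPeriodic

/-- In even weight, the generator `-1` of `Γ₀(N)` acts trivially, so that invariance under the
translations at the cusps is invariance under `Γ₀(N)`. -/
lemma slash_eq_of_hasPeriod {N : ℕ} (hN : N = 2 ∨ N = 3 ∨ N = 4) {k : ℤ} (hk : Even k) {f : ℍ → ℂ}
    (hp : ∀ g h, IsRep N g h → HasPeriod h (f ∣[k] g)) {γ : SL(2, ℤ)} (hγ : γ ∈ Gamma0 N) :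
    f ∣[k] γ = f := by
  have key : ∀ g h, IsRep N g h → g * T ^ (h : ℤ) * g⁻¹ ∈ multiplierSubgroup k f ⊥ := by
    intro g h hg
    exact conj_T_mem_multiplierSubgroup (χ := 1) (one_mem _) fun τ => by
      simpa using hp g h hg τ
  have hle : Gamma0 N ≤ multiplierSubgroup k f ⊥ := by
    refine Gamma0_le_of_generators (by omega) (by omega) ?_ ?_ (key S N .zero)
    · exact ⟨1, one_mem _, by rw [slash_neg_one, hk.neg.neg_one_zpow]; simp⟩
    · simpa using key 1 1 .infty
  obtain ⟨χ, hχ, h1⟩ := hle hγ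
  rw [Subgroup.mem_bot.mp hχ] at h1
  simpa using h1

/-- The forms of weight `0` with trivial multipliers are the constants. -/
theorem eq_const_of_hasPeriod {N : ℕ} (hN : N = 2 ∨ N = 3 ∨ N = 4) {f : ℍ → ℂ} (hf : MDiff f)
    (hp : ∀ g h, IsRep N g h → HasPeriod h (f ∣[(0 : ℤ)] g))
    (hb : ∀ g h, IsRep N g h → IsBoundedAtImInfty (f ∣[(0 : ℤ)] g)) :
    ∃ c : ℂ, ∀ τ, f τ = c := by
  have hq : QuasiPeriodic N 0 f := ⟨hf, fun g h hg => ⟨1, one_ne_zero, fun τ => by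
    rw [hp g h hg τ, one_mul]⟩, hb⟩
  have : NeZero N := ⟨by omega⟩
  let F : ModularForm ((Gamma0 N).map (mapGL ℝ)) 0 :=
    { toFun := f
      slash_action_eq' := by
        rintro _ ⟨γ, hγ, rfl⟩
        exact slash_eq_of_hasPeriod hN Even.zero hp hγ
      holo' := hf
      bdd_at_cusps' := by
        intro c hc
        rw [Subgroup.IsArithmetic.isCusp_iff_isCusp_SL2Z] at hc
        rw [OnePoint.isBoundedAt_iff_forall_SL2Z hc]
        intro γ _
        exact (hq.isMultiplierForm hN).bdd_at_cusps γ }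
  obtain ⟨c, hc⟩ := ModularForm.eq_const_of_weight_zero F
  exact ⟨c, fun τ => congrFun hc τ⟩

/-! ### Forms without zeros on the upper half plane -/

/-- A form `f` of weight `k` on `Γ₀(N)` without zeros on `ℍ`, of order `o g` at each of the
representatives `g • i∞` of the cusps. -/
def UnitForm (N : ℕ) (k : ℤ) (f : ℍ → ℂ) (o : SL(2, ℤ) → ℚ) : Prop :=
  ∀ g h, IsRep N g h → Lead h (o g) (f ∣[k] g)

namespace UnitForm

variable {N : ℕ} {k l : ℤ} {f f' : ℍ → ℂ} {o o' : SL(2, ℤ) → ℚ}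

lemma holo (hf : UnitForm N k f o) : MDiff f := by
  simpa using (hf 1 1 .infty).holo

lemma ne_zero (hf : UnitForm N k f o) (τ : ℍ) : f τ ≠ 0 := by
  simpa using (hf 1 1 .infty).ne_zero τ

lemma mul (hf : UnitForm N k f o) (hf' : UnitForm N l f' o') :
    UnitForm N (k + l) (f * f') (o + o') := fun g h hg => by
  rw [mul_slash_SL2]; exact (hf g h hg).mul (hf' g h hg)

lemma pow (hf : UnitForm N k f o) (m : ℕ) : UnitForm N (m * k) (f ^ m) (m * o) :=
  fun g h hg => by
    rw [slash_pow]
    exact (hf g h hg).pow m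

lemma smul (hf : UnitForm N k f o) {c : ℂ} (hc : c ≠ 0) : UnitForm N k (c • f) o :=
  fun g h hg => by
    rw [SL_smul_slash]; exact (hf g h hg).smul hc

lemma quasiPeriodic (hN : N = 2 ∨ N = 3 ∨ N = 4) (hf : UnitForm N k f o)
    (ho : ∀ g h, IsRep N g h → 0 ≤ o g) : QuasiPeriodic N k f where
  holo := hf.holo
  period g h hg := (hf g h hg).period_ne_zero
  bdd g h hg := (hf g h hg).bdd (hg.pos (by omega)) (ho g h hg)

end UnitForm

lemma analyticOrderAt_of_ne_zero {f : ℍ → ℂ} (hf : MDiff f) {z : ℍ} (h : f z ≠ 0) :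
    analyticOrderAt (f ∘ ofComplex) (z : ℂ) = 0 := by
  have han : AnalyticAt ℂ (f ∘ ofComplex) (z : ℂ) :=
    (UpperHalfPlane.mdifferentiable_iff.mp hf).analyticAt
      (isOpen_upperHalfPlaneSet.mem_nhds z.im_pos)
  rw [han.analyticOrderAt_eq_zero]
  simpa using h

lemma hasFormOrder_of_ne_zero (Γ : Subgroup SL(2, ℤ)) (k : ℤ) {f : ℍ → ℂ} (hf : MDiff f) {z : ℍ}
    (h : f z ≠ 0) : HasFormOrder Γ k f (.inl z) 0 :=
  ⟨0, by simpa using analyticOrderAt_of_ne_zero hf h, by simp⟩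

/-- A form of weight `1` without zeros on `ℍ` which has order `1 / r` at one of the representatives
of the cusps, and order `0` at the others. -/
theorem UnitForm.vanishesExactlyAt {N r : ℕ} (hN : N = 2 ∨ N = 3 ∨ N = 4) (hr : 0 < r)
    {f : ℍ → ℂ} {g₀ : SL(2, ℤ)} {h₀ : ℕ} (hg₀ : IsRep N g₀ h₀)
    (hf : UnitForm N 1 f (Pi.single g₀ (1 / r))) :
    VanishesExactlyAt (Gamma0 N) 1 f (.inr ((mapGL ℚ g₀ : GL (Fin 2) ℚ) • ∞)) (1 / r) := by
  have hfr := hf.pow r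
  have ho : ∀ g, 0 ≤ ((r : SL(2, ℤ) → ℚ) * (Pi.single g₀ (1 / (r : ℚ)) : SL(2, ℤ) → ℚ)) g := by
    intro g
    simp only [Pi.mul_apply, Pi.natCast_apply, Pi.single_apply]
    split_ifs <;> positivity
  have hq := hfr.quasiPeriodic hN fun g _ _ => ho g
  -- the representative of the cusp `s` is `g₀` if and only if `s` is equivalent to `g₀ • i∞`
  have hrep : ∀ g h, IsRep N g h → ∀ s : OnePoint ℚ,
      Equivalent (Gamma0 N) (.inr ((mapGL ℚ g : GL (Fin 2) ℚ) • ∞)) (.inr s) →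
      (Equivalent (Gamma0 N) (.inr ((mapGL ℚ g₀ : GL (Fin 2) ℚ) • ∞)) (.inr s) ↔ g = g₀) := by
    intro g h hg s hs
    obtain ⟨γ, rfl⟩ := OnePoint.exists_mem_SL2 ℤ s
    rw [equivalent_iff hN hg] at hs
    rw [equivalent_iff hN hg₀, ← hs]
    exact ⟨fun he => (hg₀.eq_of_gcd_eq (by omega) hg he).1.symm, fun he => by rw [he]⟩
  intro s
  refine ⟨fun hs => ⟨r, hr, hq.isMultiplierForm hN, ?_⟩,
    fun hs => ⟨r, hr, hq.isMultiplierForm hN, ?_⟩⟩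
  · rcases s with z | s
    · exact hs.elim
    refine hq.hasFormOrder_cusp hN fun g h hg hgs => ?_
    have hgg := (hrep g h hg s hgs).mp hs
    have := (hfr g h hg).lim
    simpa [hgg] using this
  · rcases s with z | s
    · rw [mul_zero]
      exact hasFormOrder_of_ne_zero _ _ hfr.holo (hfr.ne_zero z)
    refine hq.hasFormOrder_cusp hN fun g h hg hgs => ?_
    have hgg : g ≠ g₀ := fun he => hs ((hrep g h hg s hgs).mpr he)
    have := (hfr g h hg).lim
    simpa [hgg] using this

/-! ### Logarithmic derivatives -/

lemma denom_SL (γ : SL(2, ℤ)) (τ : ℍ) : denom γ τ = (γ 1 0 : ℂ) * τ + (γ 1 1 : ℂ) := by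
  rw [denom_apply]

/-- The correction term `c / (2πi (cτ + d))` in the transformation of derivatives. -/
noncomputable def cocycle (γ : SL(2, ℤ)) (τ : ℍ) : ℂ :=
  (2 * Real.pi * I)⁻¹ * ((γ 1 0 : ℂ) / denom γ τ)

lemma logD_slash {k : ℤ} {f : ℍ → ℂ} (hf : MDiff f) (hf0 : ∀ τ, f τ ≠ 0) (γ : SL(2, ℤ)) :
    logD f ∣[(2 : ℤ)] γ = logD (f ∣[k] γ) + (k : ℂ) • cocycle γ := by
  have h1 : logD f ∣[((k + 2) - k : ℤ)] γ = (D f ∣[k + 2] γ) / (f ∣[k] γ) := div_slash_SL2 _ _ _ _ _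
  rw [add_sub_cancel_left] at h1
  rw [h1]
  ext τ
  have h2 := congrFun (normalizedDerivOfComplex_SL_slash (k := k) hf (γ := γ)) τ
  have h3 := slash_ne_zero hf0 k γ τ
  simp only [Pi.sub_apply] at h2
  simp only [logD, Pi.div_apply, Pi.add_apply, Pi.smul_apply, smul_eq_mul, cocycle]
  rw [h2]
  field_simp
  ring

lemma mdiff_cocycle (γ : SL(2, ℤ)) : MDiff (cocycle γ) := by
  have h : cocycle γ = ((2 * Real.pi * I)⁻¹ * (γ 1 0 : ℂ)) • fun τ : ℍ => (denom γ τ)⁻¹ := by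
    ext τ; simp only [cocycle, Pi.smul_apply, smul_eq_mul]; ring
  rw [h]
  exact (mdifferentiable_inv_denom _).const_smul _

lemma D_cocycle (γ : SL(2, ℤ)) : D (cocycle γ) = -(cocycle γ * cocycle γ) := by
  have h : cocycle γ = ((2 * Real.pi * I)⁻¹ * (γ 1 0 : ℂ)) • fun τ : ℍ => (denom γ τ)⁻¹ := by
    ext τ; simp only [cocycle, Pi.smul_apply, smul_eq_mul]; ring
  ext τ
  conv_lhs => rw [h]
  rw [normalizedDerivOfComplex_smul _ _ (mdifferentiable_inv_denom _)]
  have h1 := deriv_denom_zpow (γ : GL (Fin 2) ℝ) (-1) τ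
  have h2 : (fun τ : ℍ => (denom γ τ)⁻¹) ∘ ofComplex =ᶠ[𝓝 (τ : ℂ)]
      fun z => denom γ z ^ (-1 : ℤ) := by
    filter_upwards [isOpen_upperHalfPlaneSet.mem_nhds τ.im_pos] with w hw
    have hw' : 0 < w.im := hw
    simp [ofComplex_apply_of_im_pos hw']
  simp only [Pi.smul_apply, smul_eq_mul, normalizedDerivOfComplex, Pi.neg_apply, Pi.mul_apply]
  rw [h2.deriv_eq, h1]
  have h3 := denom_ne_zero γ τ
  simp only [cocycle]
  rw [show (-1 - 1 : ℤ) = -2 by norm_num, zpow_neg]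
  simp
  field_simp

lemma bdd_cocycle (γ : SL(2, ℤ)) : IsBoundedAtImInfty (cocycle γ) := by
  have h : IsBoundedAtImInfty fun τ : ℍ => (γ 1 0 : ℂ) / denom γ τ := by
    rw [isBoundedAtImInfty_iff]
    refine ⟨1, 1, fun τ hτ => ?_⟩
    rw [norm_div, div_le_one (norm_pos_iff.mpr (denom_ne_zero _ _)), denom_SL]
    have h1 := Complex.abs_im_le_norm ((γ 1 0 : ℂ) * τ + (γ 1 1 : ℂ))
    have h2 : ((γ 1 0 : ℂ) * τ + (γ 1 1 : ℂ)).im = (γ 1 0 : ℝ) * τ.im := by simp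
    rw [h2, abs_mul, abs_of_pos τ.im_pos] at h1
    have h3 : ‖((γ 1 0 : ℤ) : ℂ)‖ = |((γ 1 0 : ℤ) : ℝ)| := by
      rw [Complex.norm_intCast]
    rw [h3]
    nlinarith [abs_nonneg ((γ 1 0 : ℤ) : ℝ)]
  exact Asymptotics.IsBigO.const_mul_left h _

/-- The covariant `E ^ 2 - k E'` of weight `4`, where `E` is the logarithmic derivative of a form
`f` of weight `k`; up to the factor `f ^ (-2)` it is a Rankin–Cohen bracket of `f` with itself. -/
noncomputable def quadCov (k : ℤ) (f : ℍ → ℂ) : ℍ → ℂ :=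
  logD f * logD f - (k : ℂ) • D (logD f)

lemma mdiff_quadCov (k : ℤ) {f : ℍ → ℂ} (hf : MDiff f) (hf0 : ∀ τ, f τ ≠ 0) :
    MDiff (quadCov k f) :=
  ((mdiff_logD hf hf0).mul (mdiff_logD hf hf0)).sub
    ((normalizedDerivOfComplex_mdifferentiable (mdiff_logD hf hf0)).const_smul _)

lemma quadCov_slash {k : ℤ} {f : ℍ → ℂ} (hf : MDiff f) (hf0 : ∀ τ, f τ ≠ 0) (γ : SL(2, ℤ)) :
    quadCov k f ∣[(4 : ℤ)] γ = quadCov k (f ∣[k] γ) := by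
  set E := logD f with hE
  set G := logD (f ∣[k] γ) with hG
  have hEd : MDiff E := mdiff_logD hf hf0
  have hGd : MDiff G := mdiff_logD (mdiff_slash hf k γ) (slash_ne_zero hf0 k γ)
  have h1 : E ∣[(2 : ℤ)] γ = G + (k : ℂ) • cocycle γ := logD_slash hf hf0 γ
  have h2 : (E * E) ∣[(4 : ℤ)] γ = (E ∣[(2 : ℤ)] γ) * (E ∣[(2 : ℤ)] γ) :=
    mul_slash_SL2 2 2 γ E E
  have h3 := normalizedDerivOfComplex_SL_slash (k := 2) hEd (γ := γ)
  rw [h1, normalizedDerivOfComplex_add _ _ hGd ((mdiff_cocycle γ).const_smul _),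
    normalizedDerivOfComplex_smul _ _ (mdiff_cocycle γ), D_cocycle] at h3
  have h4 : quadCov k f ∣[(4 : ℤ)] γ = (E * E) ∣[(4 : ℤ)] γ - (k : ℂ) • (D E ∣[(4 : ℤ)] γ) := by
    rw [quadCov, sub_eq_add_neg, SlashAction.add_slash, SlashAction.neg_slash, SL_smul_slash,
      ← sub_eq_add_neg]
  rw [h4, h2, h1, quadCov, ← hG]
  ext τ
  have h5 := congrFun h3 τ
  simp only [Pi.add_apply, Pi.sub_apply, Pi.smul_apply, Pi.mul_apply, Pi.neg_apply, smul_eq_mul]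
    at h5 ⊢
  have h6 : (2 * Real.pi * I : ℂ)⁻¹ * ((γ 1 0 : ℂ) / denom γ τ) = cocycle γ τ := rfl
  have h7 : (D E ∣[(4 : ℤ)] γ) τ = D G τ - k * (cocycle γ τ * cocycle γ τ)
      + 2 * cocycle γ τ * (G τ + k * cocycle γ τ) := by
    rw [← h6] at h5 ⊢
    have h8 : (D E ∣[(2 + 2 : ℤ)] γ) τ = (D E ∣[(4 : ℤ)] γ) τ := rfl
    rw [h8] at h5
    push_cast at h5
    linear_combination -h5
  rw [h7]
  ring

lemma quadCov_smul (k : ℤ) {f : ℍ → ℂ} (hf : MDiff f) {c : ℂ} (hc : c ≠ 0) :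
    quadCov k (c • f) = quadCov k f := by
  rw [quadCov, logD_smul hf hc, ← quadCov]

lemma Lead.quadCov_hasPeriod {h : ℕ} {o : ℚ} {f : ℍ → ℂ} (hf : Lead h o f) (k : ℤ) :
    HasPeriod h (quadCov k f) := by
  intro τ
  simp only [quadCov, Pi.sub_apply, Pi.mul_apply, Pi.smul_apply]
  rw [hf.logD_hasPeriod τ, hf.logD_hasPeriod.D τ]

lemma Lead.tendsto_quadCov {h : ℕ} (hh : 0 < h) {o : ℚ} {f : ℍ → ℂ} (hf : Lead h o f) (k : ℤ) :
    Tendsto (quadCov k f) atImInfty (𝓝 ((o / h) ^ 2)) := by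
  have h1 := hf.tendsto_logD hh
  have := (h1.mul h1).sub ((hf.tendsto_D_logD hh).const_smul (k : ℂ))
  rw [smul_zero, sub_zero, ← sq] at this
  exact this

/-- The logarithmic derivative of a form without zeros is quasi-modular. -/
theorem UnitForm.isQuasimodularTwo {N : ℕ} (hN : N = 2 ∨ N = 3 ∨ N = 4) {k : ℤ} {f : ℍ → ℂ}
    {o : SL(2, ℤ) → ℚ} (hf : UnitForm N k f o) (ho : ∀ g h, IsRep N g h → 0 ≤ o g) :
    IsQuasimodularTwo (Gamma0 N) (logD f) where
  holo := mdiff_logD hf.holo hf.ne_zero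
  transform := by
    refine ⟨k, fun γ hγ τ => ?_⟩
    obtain ⟨χ, -, hχ⟩ := (hf.quasiPeriodic hN ho).exists_char hN hγ
    have h1 := congrFun (logD_slash (k := k) hf.holo hf.ne_zero γ) τ
    rw [hχ, logD_smul hf.holo χ.ne_zero, SL_slash_apply, zpow_neg, ← div_eq_mul_inv,
      div_eq_iff (zpow_ne_zero _ (denom_ne_zero _ _))] at h1
    rw [h1, ← denom_SL]
    have := denom_ne_zero γ τ
    simp only [Pi.add_apply, Pi.smul_apply, smul_eq_mul, cocycle]
    field_simp
  bdd_at_cusps γ := by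
    rw [logD_slash (k := k) hf.holo hf.ne_zero γ]
    refine Asymptotics.IsBigO.add ?_ (Asymptotics.IsBigO.const_smul_left (bdd_cocycle γ) _)
    obtain ⟨g, h, hg, δ, hδ, j, rfl⟩ := exists_rep hN γ
    obtain ⟨χ, hχ0, hχ⟩ := (hf.quasiPeriodic hN ho).exists_slash_eq hN (g := g) hδ j
    have hl := hf g h hg
    have h1 : IsBoundedAtImInfty fun τ : ℍ => logD (f ∣[k] g) ((j : ℝ) +ᵥ τ) :=
      (hl.bdd_logD (hg.pos (by omega))).comp_tendsto (tendsto_vadd_atImInfty j)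
    have h2 : f ∣[k] (δ * g * T ^ j) = χ • ((f ∣[k] g) ∣[k] (T ^ j)) := by
      ext τ; rw [hχ, Pi.smul_apply, slash_T_zpow_apply, smul_eq_mul]
    rw [h2, logD_smul (mdiff_slash hl.holo k _) hχ0]
    refine h1.congr (fun τ => ?_) fun _ => rfl
    simp only [logD, Pi.div_apply]
    rw [slash_T_zpow_apply, D_vadd fun τ => (slash_T_zpow_apply k (f ∣[k] g) j τ).symm]

end TripleForms

namespace TripleForms

open Derivative Function.Periodic Matrix.SpecialLinearGroup ModularGroup CongruenceSubgroup
open ModularForm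

/-! ### Eta quotients -/

/-- The function `η (a τ + b)`. -/
noncomputable def etaLin (a b : ℝ) (τ : ℍ) : ℂ := η (a * τ + b)

lemma im_linear_pos {a : ℝ} (ha : 0 < a) (b : ℝ) (τ : ℍ) : 0 < ((a : ℂ) * τ + b).im := by
  simpa using mul_pos ha τ.im_pos

lemma etaLin_ne_zero {a : ℝ} (ha : 0 < a) (b : ℝ) (τ : ℍ) : etaLin a b τ ≠ 0 :=
  ModularForm.eta_ne_zero (im_linear_pos ha b τ)

lemma mdiff_etaLin {a : ℝ} (ha : 0 < a) (b : ℝ) : MDiff (etaLin a b) := by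
  rw [UpperHalfPlane.mdifferentiable_iff]
  refine DifferentiableOn.congr (f := fun z : ℂ => η (a * z + b)) ?_ ?_
  · intro z hz
    refine DifferentiableAt.differentiableWithinAt ?_
    have h1 := ModularForm.differentiableAt_eta_of_mem_upperHalfPlaneSet
      (im_linear_pos ha b ⟨z, hz⟩)
    exact h1.comp (f := fun z : ℂ => (a : ℂ) * z + b) z (by fun_prop)
  · intro z hz
    have hz' : 0 < z.im := hz
    simp [etaLin, ofComplex_apply_of_im_pos hz']

lemma eta_add_one (z : ℂ) : η (z + 1) = cexp (2 * Real.pi * I / 24) * η z := by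
  have h1 : qParam 24 (z + 1) = cexp (2 * Real.pi * I / 24) * qParam 24 z := by
    rw [qParam, qParam, ← Complex.exp_add]; congr 1; push_cast; ring
  have h2 : qParam 1 (z + 1) = qParam 1 z := by
    rw [qParam, qParam, ← Complex.exp_periodic (2 * Real.pi * I * z / (1 : ℝ))]
    congr 1; push_cast; ring
  simp only [ModularForm.eta, ModularForm.eta_q, h1, h2, mul_assoc]

lemma eta_add_nat (n : ℕ) (z : ℂ) : η (z + n) = cexp (2 * Real.pi * I / 24) ^ n * η z := by
  induction n with
  | zero => simp
  | succ n ih => rw [Nat.cast_succ, ← add_assoc, eta_add_one, ih, pow_succ']; ring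

lemma tendsto_eta_tprod :
    Tendsto (fun z : ℍ => ∏' n, (1 - ModularForm.eta_q n z)) atImInfty (𝓝 1) := by
  have h1 := (ModularForm.differentiableOn_tprod_one_sub_pow.differentiableAt
    (Metric.isOpen_ball.mem_nhds (Metric.mem_ball_self one_pos))).continuousAt.tendsto
  have h2 : ∏' n : ℕ, (1 - (0 : ℂ) ^ (n + 1)) = 1 := by simp
  rw [h2] at h1
  exact h1.comp (qParam_tendsto_atImInfty one_pos)

lemma lead_etaLin {a : ℝ} (ha : 0 < a) (b : ℝ) {h m : ℕ} (hh : 0 < h) (hm : a * h = m) :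
    Lead h (m / 24) (etaLin a b) where
  holo := mdiff_etaLin ha b
  ne_zero := etaLin_ne_zero ha b
  period := by
    refine ⟨cexp (2 * Real.pi * I / 24) ^ m, fun τ => ?_⟩
    rw [etaLin, etaLin, ← eta_add_nat]
    congr 1
    have : (m : ℂ) = a * h := by exact_mod_cast hm.symm
    rw [this, coe_vadd]; push_cast; ring
  lim := by
    refine ⟨cexp (2 * Real.pi * I * (b / 24)), exp_ne_zero _, ?_⟩
    have h1 : Tendsto (fun τ : ℍ => (⟨a * τ + b, im_linear_pos ha b τ⟩ : ℍ)) atImInfty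
        atImInfty := by
      simp only [atImInfty, tendsto_comap_iff]
      have : (UpperHalfPlane.im ∘ fun τ : ℍ => (⟨a * τ + b, im_linear_pos ha b τ⟩ : ℍ))
          = fun τ : ℍ => a * τ.im := by
        ext τ; simp [← coe_im]
      rw [this]
      exact tendsto_comap.const_mul_atTop ha
    have h2 := (tendsto_eta_tprod.comp h1).const_mul (cexp (2 * Real.pi * I * (b / 24)))
    rw [mul_one] at h2
    refine h2.congr fun τ => ?_
    have hhc : (h : ℂ) ≠ 0 := by exact_mod_cast hh.ne'
    have hmc : (m : ℂ) = a * h := by exact_mod_cast hm.symm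
    have h3 : qParam 24 (a * τ + b) * expTwoPi (-(((m / 24 : ℚ) : ℂ) / h)) τ
        = cexp (2 * Real.pi * I * (b / 24)) := by
      rw [qParam, expTwoPi, ← Complex.exp_add]
      congr 1
      push_cast
      rw [hmc]
      field_simp
      ring
    rw [← h3]
    simp only [etaLin, ModularForm.eta, Function.comp_apply]
    ring

lemma logD_etaLin {n : ℕ} (hn : 0 < n) (τ : ℍ) :
    logD (etaLin n 0) τ = n * EisensteinSeries.E2 (scale n hn τ) / 24 := by
  have h1 := ModularForm.logDeriv_eta_eq_E2 (scale n hn τ)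
  have h0 := ModularForm.eta_ne_zero (scale n hn τ).2
  have h2 : etaLin n 0 ∘ ofComplex =ᶠ[𝓝 (τ : ℂ)] fun z => η (n * z) := by
    filter_upwards [isOpen_upperHalfPlaneSet.mem_nhds τ.im_pos] with w hw
    have hw' : 0 < w.im := hw
    simp [etaLin, ofComplex_apply_of_im_pos hw']
  have h3 : HasDerivAt (fun z : ℂ => η (n * z)) (deriv η (scale n hn τ) * n) (τ : ℂ) := by
    have h4 := (ModularForm.differentiableAt_eta_of_mem_upperHalfPlaneSet
      (scale n hn τ).2).hasDerivAt
    have h5 : HasDerivAt (fun z : ℂ => (n : ℂ) * z) n (τ : ℂ) := by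
      simpa using (hasDerivAt_id (τ : ℂ)).const_mul (n : ℂ)
    exact HasDerivAt.comp (τ : ℂ) h4 h5
  have h6 : etaLin n 0 τ = η (scale n hn τ) := by simp [etaLin, scale]
  rw [logDeriv_apply, div_eq_iff h0] at h1
  simp only [logD, Pi.div_apply, normalizedDerivOfComplex]
  rw [h2.deriv_eq, h3.deriv, h6, h1]
  have hpi : (2 * Real.pi * I : ℂ) ≠ 0 := Complex.two_pi_I_ne_zero
  have hpi' : (Real.pi * I : ℂ) ≠ 0 := fun h => hpi (by linear_combination 2 * h)
  field_simp
  ring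

/-- The values of `x` at `γ • τ` and of `x'` at `τ` are related as by a transformation law of
weight `1 / 2`, up to a constant; `s` is a choice of the square root of `cτ + d`, and the law
is only required for `p`-th powers, to avoid the choice of a branch. -/
def HalfRel (p : ℕ) (s : ℍ → ℂ) (γ : SL(2, ℤ)) (x x' : ℍ → ℂ) : Prop :=
  ∃ c : ℂ, c ≠ 0 ∧ ∀ τ, x (γ • τ) ^ p = c * (s τ ^ p * x' τ ^ p)

lemma HalfRel.quot_slash {p : ℕ} {s : ℍ → ℂ} {γ : SL(2, ℤ)} (hs : ∀ τ, s τ ^ 2 = denom γ τ)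
    {x x' y y' : ℍ → ℂ} (hx : HalfRel p s γ x x') (hy : HalfRel p s γ y y')
    {m n k : ℕ} (hk : p * m = p * n + 2 * k) :
    ∃ c : ℂ, c ≠ 0 ∧ (x ^ (p * m) / y ^ (p * n)) ∣[(k : ℤ)] γ
      = c • (x' ^ (p * m) / y' ^ (p * n)) := by
  obtain ⟨c, hc, hx⟩ := hx
  obtain ⟨d, hd, hy⟩ := hy
  refine ⟨c ^ m / d ^ n, div_ne_zero (pow_ne_zero _ hc) (pow_ne_zero _ hd), ?_⟩
  ext τ
  have h0 : s τ ≠ 0 := fun h => denom_ne_zero γ τ (by rw [← hs, h]; simp)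
  rw [SL_slash_apply]
  simp only [Pi.div_apply, Pi.pow_apply, Pi.smul_apply, smul_eq_mul]
  rw [pow_mul (x _), pow_mul (y _), hx, hy, zpow_neg, zpow_natCast, ← hs]
  have h1 : ((s τ) ^ p) ^ m = ((s τ) ^ p) ^ n * (s τ ^ 2) ^ k := by
    rw [← pow_mul, ← pow_mul, ← pow_mul, hk, pow_add]
  simp only [mul_pow]
  rw [h1, pow_mul (x' _), pow_mul (y' _)]
  have h2 : ((s τ) ^ p) ^ n ≠ 0 := pow_ne_zero _ (pow_ne_zero _ h0)
  have h3 : ((s τ) ^ 2) ^ k ≠ 0 := pow_ne_zero _ (pow_ne_zero _ h0)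
  rw [mul_inv_eq_iff_eq_mul₀ h3, div_mul_div_comm, div_mul_eq_mul_div]
  rw [show c ^ m * ((s τ ^ p) ^ n * (s τ ^ 2) ^ k * (x' τ ^ p) ^ m)
    = (s τ ^ p) ^ n * (c ^ m * (x' τ ^ p) ^ m * (s τ ^ 2) ^ k) by ring,
    show d ^ n * ((s τ ^ p) ^ n * (y' τ ^ p) ^ n) = (s τ ^ p) ^ n * (d ^ n * (y' τ ^ p) ^ n) by
      ring,
    mul_div_mul_left _ _ h2]

lemma csqrt_sq {z : ℂ} (hz : z ≠ 0) : Complex.sqrt z ^ 2 = z := by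
  rw [sqrt_eq_exp hz, ← Complex.exp_nat_mul, Nat.cast_ofNat, mul_div_cancel₀ _ two_ne_zero,
    Complex.exp_log hz]

lemma sqrt_ofReal_mul {a : ℝ} (ha : 0 < a) (τ : ℍ) :
    Complex.sqrt (a * τ) = Complex.sqrt a * Complex.sqrt τ := by
  have ha' : (a : ℂ) ≠ 0 := by exact_mod_cast ha.ne'
  rw [sqrt_eq_exp (mul_ne_zero ha' τ.ne_zero), sqrt_eq_exp ha', sqrt_eq_exp τ.ne_zero,
    log_ofReal_mul ha τ.ne_zero, ← Complex.exp_add, Complex.ofReal_log ha.le]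
  ring_nf

lemma halfRel_S {n : ℕ} (hn : 0 < n) :
    HalfRel 1 (fun τ => Complex.sqrt τ) S (etaLin n 0) (etaLin (n : ℝ)⁻¹ 0) := by
  have hn' : (0 : ℝ) < (n : ℝ)⁻¹ := by positivity
  have h0 : ∀ z : ℂ, z ≠ 0 → Complex.sqrt z ≠ 0 := fun z hz => by
    rw [sqrt_eq_exp hz]; exact exp_ne_zero _
  have hr : (((n : ℝ)⁻¹ : ℝ) : ℂ) ≠ 0 := by exact_mod_cast hn'.ne'
  refine ⟨(Complex.sqrt I)⁻¹ * Complex.sqrt ((n : ℝ)⁻¹ : ℝ),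
    mul_ne_zero (inv_ne_zero (h0 _ I_ne_zero)) (h0 _ hr), fun τ => ?_⟩
  have h1 : 0 < ((((n : ℝ)⁻¹ : ℝ) : ℂ) * τ).im := by simpa using mul_pos hn' τ.im_pos
  have h2 := ModularForm.eta_comp_eq_csqrt_I_inv h1
  simp only [Function.comp_apply, Pi.smul_apply, Pi.mul_apply, smul_eq_mul,
    sqrt_ofReal_mul hn'] at h2
  have h3 : (((n : ℝ) : ℂ) * ((S • τ : ℍ) : ℂ) + ((0 : ℝ) : ℂ))
      = -1 / ((((n : ℝ)⁻¹ : ℝ) : ℂ) * τ) := by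
    rw [modular_S_smul]
    have := τ.ne_zero
    push_cast
    have hnc : (n : ℂ) ≠ 0 := by exact_mod_cast hn.ne'
    simp
    field_simp
  simp only [etaLin, pow_one]
  rw [h3, h2]
  simp only [ofReal_zero, add_zero]
  ring

/-- The transformation law of `η ^ 2` under the full modular group, up to constants. -/
lemma eta_sq_smul (γ : SL(2, ℤ)) :
    ∃ c : ℂ, c ≠ 0 ∧ ∀ τ : ℍ, η ((γ • τ : ℍ) : ℂ) ^ 2 = c * (denom γ τ * η τ ^ 2) := by
  let f : ℍ → ℂ := fun τ => η τ ^ 2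
  have hf : ∀ γ : SL(2, ℤ), γ ∈ multiplierSubgroup 1 f ⊤ := by
    intro γ
    have hS : S ∈ multiplierSubgroup 1 f ⊤ := by
      obtain ⟨c, hc, h⟩ := halfRel_S one_pos
      refine ⟨Units.mk0 (c ^ 2) (pow_ne_zero 2 hc), trivial, ?_⟩
      ext τ
      have h1 := h τ
      simp only [pow_one, etaLin, Nat.cast_one, inv_one, ofReal_one, one_mul, ofReal_zero,
        add_zero] at h1
      have h2 : Complex.sqrt τ ^ 2 = τ := csqrt_sq τ.ne_zero
      have := τ.ne_zero
      simp only [SL_slash_apply, denom_S, f, Pi.smul_apply, smul_eq_mul, Units.val_mk0, h1]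
      rw [mul_pow, mul_pow, h2]
      field_simp
    have hT : T ∈ multiplierSubgroup 1 f ⊤ := by
      refine ⟨Units.mk0 (cexp (2 * Real.pi * I / 24) ^ 2) (pow_ne_zero 2 (exp_ne_zero _)),
        trivial, ?_⟩
      ext τ
      have h1 := slash_T_zpow_apply 1 f 1 τ
      rw [zpow_one] at h1
      rw [h1]
      simp only [f, coe_vadd, Pi.smul_apply, smul_eq_mul, Units.val_mk0, ← mul_pow, ← eta_add_one]
      push_cast
      rw [add_comm]
    have h3 : Subgroup.closure {S, T} ≤ multiplierSubgroup 1 f ⊤ := by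
      rw [Subgroup.closure_le]
      rintro x (rfl | rfl)
      · exact hS
      · exact hT
    rw [SpecialLinearGroup.SL2Z_generators] at h3
    exact h3 trivial
  obtain ⟨χ, -, h⟩ := hf γ
  refine ⟨χ, χ.ne_zero, fun τ => ?_⟩
  have h1 := congrFun h τ
  rw [SL_slash_apply, zpow_neg, zpow_one, mul_inv_eq_iff_eq_mul₀ (denom_ne_zero γ τ)] at h1
  simp only [f, Pi.smul_apply, smul_eq_mul] at h1
  rw [h1]; ring

lemma halfRel_of_sq {γ : SL(2, ℤ)} {x x' : ℍ → ℂ}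
    (h : ∃ c : ℂ, c ≠ 0 ∧ ∀ τ, x (γ • τ) ^ 2 = c * (denom γ τ * x' τ ^ 2)) :
    HalfRel 2 (fun τ => Complex.sqrt (denom γ τ)) γ x x' := by
  obtain ⟨c, hc, h⟩ := h
  refine ⟨c, hc, fun τ => ?_⟩
  rw [h, csqrt_sq (denom_ne_zero γ τ)]

lemma coe_halfCusp_smul (τ : ℍ) : ((halfCusp • τ : ℍ) : ℂ) = τ / (2 * τ + 1) := by
  obtain ⟨h1, h2, h3, h4⟩ := halfCusp_entries
  rw [specialLinearGroup_apply]
  simp [h1, h2, h3, h4]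

lemma denom_halfCusp (τ : ℍ) : denom halfCusp τ = 2 * τ + 1 := by
  obtain ⟨-, -, h3, h4⟩ := halfCusp_entries
  rw [denom_SL, h3, h4]; simp

lemma two_mul_add_one_ne_zero (τ : ℍ) : (2 * τ + 1 : ℂ) ≠ 0 := by
  rw [← denom_halfCusp]; exact denom_ne_zero _ _

/-- If `n (U τ) = δ (aτ + b)` for a matrix `δ ∈ SL(2, ℤ)`, where `U τ = τ / (2τ + 1)`, then
`η (n (U τ))` is expressed by `η (aτ + b)`. -/
lemma halfRel_halfCusp {a b : ℝ} (ha : 0 < a) {n : ℕ} {δ : SL(2, ℤ)} {r : ℂ} (hr : r ≠ 0)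
    (h : ∀ τ : ℍ, n * (τ / (2 * τ + 1) : ℂ)
      = ((δ 0 0 : ℂ) * (a * τ + b) + (δ 0 1 : ℂ)) / ((δ 1 0 : ℂ) * (a * τ + b) + (δ 1 1 : ℂ)))
    (hd : ∀ τ : ℍ, (δ 1 0 : ℂ) * (a * τ + b) + (δ 1 1 : ℂ) = r * (2 * τ + 1)) :
    HalfRel 2 (fun τ => Complex.sqrt (denom halfCusp τ)) halfCusp (etaLin n 0) (etaLin a b) := by
  refine halfRel_of_sq ?_
  obtain ⟨c, hc, hδ⟩ := eta_sq_smul δ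
  refine ⟨c * r, mul_ne_zero hc hr, fun τ => ?_⟩
  have h1 := hδ ⟨a * τ + b, im_linear_pos ha b τ⟩
  have h2 := h τ
  rw [coe_specialLinearGroup_apply, denom_SL] at h1
  simp only [algebraMap_int_eq, eq_intCast, ofReal_intCast] at h1
  rw [← h τ, hd] at h1
  simp only [etaLin, ofReal_natCast, ofReal_zero, add_zero]
  rw [coe_halfCusp_smul, h1, denom_halfCusp]
  ring

lemma halfRel_halfCusp_one :
    HalfRel 2 (fun τ => Complex.sqrt (denom halfCusp τ)) halfCusp (etaLin (1 : ℕ) 0)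
      (etaLin 1 0) := by
  obtain ⟨h1, h2, h3, h4⟩ := halfCusp_entries
  refine halfRel_halfCusp (δ := halfCusp) one_pos one_ne_zero (fun τ => ?_) fun τ => ?_
  · rw [h1, h2, h3, h4]; simp
  · rw [h3, h4]; simp

lemma halfRel_halfCusp_two :
    HalfRel 2 (fun τ => Complex.sqrt (denom halfCusp τ)) halfCusp (etaLin (2 : ℕ) 0)
      (etaLin 2 0) := by
  obtain ⟨δ, h1, h2, h3, h4⟩ : ∃ δ : SL(2, ℤ), δ 0 0 = 1 ∧ δ 0 1 = 0 ∧ δ 1 0 = 1 ∧ δ 1 1 = 1 :=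
    ⟨⟨!![1, 0; 1, 1], by simp⟩, by simp⟩
  refine halfRel_halfCusp (δ := δ) two_pos one_ne_zero (fun τ => ?_) fun τ => ?_
  · rw [h1, h2, h3, h4]
    simp
    ring
  · rw [h3, h4]; simp

lemma halfRel_halfCusp_four :
    HalfRel 2 (fun τ => Complex.sqrt (denom halfCusp τ)) halfCusp (etaLin (4 : ℕ) 0)
      (etaLin 1 (1 / 2)) := by
  obtain ⟨δ, h1, h2, h3, h4⟩ : ∃ δ : SL(2, ℤ), δ 0 0 = 2 ∧ δ 0 1 = -1 ∧ δ 1 0 = 1 ∧ δ 1 1 = 0 :=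
    ⟨⟨!![2, -1; 1, 0], by simp⟩, by simp⟩
  refine halfRel_halfCusp (δ := δ) one_pos (r := 1 / 2) (by norm_num) (fun τ => ?_) fun τ => ?_
  · have h5 := two_mul_add_one_ne_zero τ
    have h6 : (τ + 2⁻¹ : ℂ) ≠ 0 := fun h => h5 (by linear_combination 2 * h)
    rw [h1, h2, h3, h4]
    push_cast
    rw [show (1 * (1 * (τ : ℂ) + 1 / 2) + 0) = (2 * τ + 1) / 2 by ring]
    field_simp
    ring
  · rw [h3, h4]
    push_cast
    ring

/-- Quotients of powers of two functions `η (nτ)`. -/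
noncomputable def etaQuot (m n M L : ℕ) : ℍ → ℂ := etaLin m 0 ^ M / etaLin n 0 ^ L

lemma lead_quot {a a' : ℝ} (ha : 0 < a) (ha' : 0 < a') (b b' : ℝ) {h m m' : ℕ} (hh : 0 < h)
    (hm : a * h = m) (hm' : a' * h = m') (M L : ℕ) :
    Lead h ((M * m - L * m') / 24) (etaLin a b ^ M / etaLin a' b' ^ L) := by
  have := ((lead_etaLin ha b hh hm).pow M).div ((lead_etaLin ha' b' hh hm').pow L)
  convert this using 1
  ring

lemma etaQuot_slash_S {m n : ℕ} (hm : 0 < m) (hn : 0 < n) {M L k : ℕ} (hk : M = L + 2 * k) :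
    ∃ c : ℂ, c ≠ 0 ∧ etaQuot m n M L ∣[(k : ℤ)] S
      = c • (etaLin (m : ℝ)⁻¹ 0 ^ M / etaLin (n : ℝ)⁻¹ 0 ^ L) := by
  have hs : ∀ τ : ℍ, Complex.sqrt τ ^ 2 = denom S τ := fun τ => by
    rw [csqrt_sq τ.ne_zero, denom_S]
  have := (halfRel_S hm).quot_slash hs (halfRel_S hn) (m := M) (n := L) (k := k) (by omega)
  rwa [one_mul, one_mul] at this

/-- Eta quotients as modular forms. The argument `hU` is the behaviour at the cusp `1 / 2`, which
is only needed for `N = 4`. -/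
lemma unitForm_etaQuot {N m n m' n' : ℕ} (hm : m * m' = N) (hn : n * n' = N)
    (hN0 : 0 < N) {M L k : ℕ} (hk : M = L + 2 * k) {o : SL(2, ℤ) → ℚ}
    (h1 : o 1 = (M * m - L * n) / 24) (hS : o S = (M * m' - L * n') / 24)
    (hU : N = 4 → Lead 1 (o halfCusp) (etaQuot m n M L ∣[(k : ℤ)] halfCusp)) :
    UnitForm N k (etaQuot m n M L) o := by
  have hm0 : 0 < m := Nat.pos_of_ne_zero fun h => by subst h; omega
  have hn0 : 0 < n := Nat.pos_of_ne_zero fun h => by subst h; omega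
  have hmr : (0 : ℝ) < m := by exact_mod_cast hm0
  have hnr : (0 : ℝ) < n := by exact_mod_cast hn0
  intro g h hg
  rcases hg with _ | _ | h4
  · rw [SlashAction.slash_one, h1]
    exact lead_quot hmr hnr 0 0 one_pos (by simp) (by simp) M L
  · obtain ⟨c, hc, h⟩ := etaQuot_slash_S hm0 hn0 hk
    rw [h, hS]
    refine Lead.smul (lead_quot (inv_pos.mpr hmr) (inv_pos.mpr hnr) 0 0 hN0 ?_ ?_ M L) hc
    · rw [← hm]; push_cast; field_simp
    · rw [← hn]; push_cast; field_simp
  · exact hU h4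

lemma lead_etaQuot_halfCusp {m n m' n' : ℕ} (hm' : 0 < m') (hn' : 0 < n') {b b' : ℝ}
    (hm : HalfRel 2 (fun τ => Complex.sqrt (denom halfCusp τ)) halfCusp (etaLin m 0)
      (etaLin m' b))
    (hn : HalfRel 2 (fun τ => Complex.sqrt (denom halfCusp τ)) halfCusp (etaLin n 0)
      (etaLin n' b'))
    {M L k : ℕ} (hk : M = L + k) :
    Lead 1 ((2 * M * m' - 2 * L * n') / 24) (etaQuot m n (2 * M) (2 * L) ∣[(k : ℤ)] halfCusp) := by
  obtain ⟨c, hc, h⟩ := hm.quot_slash (fun τ => csqrt_sq (denom_ne_zero _ τ)) hn (m := M) (n := L)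
    (k := k) (by omega)
  rw [etaQuot, h]
  have := (lead_quot (a := m') (a' := n') (by exact_mod_cast hm') (by exact_mod_cast hn') b b'
    one_pos (m := m') (m' := n') (by simp) (by simp) (2 * M) (2 * L)).smul hc
  exact_mod_cast this

end TripleForms

namespace TripleForms

open Derivative Function.Periodic Matrix.SpecialLinearGroup ModularGroup CongruenceSubgroup
open ModularForm

/-! ### Identities between forms -/

/-- A form of weight `k` on `Γ₀(N)` whose expansions at the representatives of
the cusps are bounded and invariant under translation by the width of the cusp. -/
structure PeriodicForm (N : ℕ) (k : ℤ) (f : ℍ → ℂ) : Prop where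
  holo : MDiff f
  period : ∀ g h, IsRep N g h → HasPeriod h (f ∣[k] g)
  bdd : ∀ g h, IsRep N g h → IsBoundedAtImInfty (f ∣[k] g)

lemma HasPeriod.mul {h : ℕ} {f g : ℍ → ℂ} (hf : HasPeriod h f) (hg : HasPeriod h g) :
    HasPeriod h (f * g) := fun τ => by simp only [Pi.mul_apply, hf τ, hg τ]

lemma HasPeriod.sub {h : ℕ} {f g : ℍ → ℂ} (hf : HasPeriod h f) (hg : HasPeriod h g) :
    HasPeriod h (f - g) := fun τ => by simp only [Pi.sub_apply, hf τ, hg τ]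

lemma HasPeriod.div {h : ℕ} {f g : ℍ → ℂ} (hf : HasPeriod h f) (hg : HasPeriod h g) :
    HasPeriod h (f / g) := fun τ => by simp only [Pi.div_apply, hf τ, hg τ]

lemma sub_slash (k : ℤ) (g : SL(2, ℤ)) (f f' : ℍ → ℂ) :
    (f - f') ∣[k] g = f ∣[k] g - f' ∣[k] g := by
  rw [sub_eq_add_neg, SlashAction.add_slash, SlashAction.neg_slash, ← sub_eq_add_neg]

lemma isBoundedAtImInfty_mul {f g : ℍ → ℂ} (hf : IsBoundedAtImInfty f)
    (hg : IsBoundedAtImInfty g) : IsBoundedAtImInfty (f * g) := by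
  exact BoundedAtFilter.mul hf hg

namespace PeriodicForm

variable {N : ℕ} {k l m : ℤ} {f g : ℍ → ℂ}

lemma quasiPeriodic (hf : PeriodicForm N k f) : QuasiPeriodic N k f :=
  ⟨hf.holo, fun g h hg => ⟨1, one_ne_zero, fun τ => by rw [hf.period g h hg τ, one_mul]⟩, hf.bdd⟩

lemma mul (hf : PeriodicForm N k f) (hg : PeriodicForm N l g) (hm : k + l = m) :
    PeriodicForm N m (f * g) := by
  subst hm
  refine ⟨hf.holo.mul hg.holo, fun γ h hγ => ?_, fun γ h hγ => ?_⟩ <;> rw [mul_slash_SL2]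
  · exact (hf.period γ h hγ).mul (hg.period γ h hγ)
  · exact isBoundedAtImInfty_mul (hf.bdd γ h hγ) (hg.bdd γ h hγ)

lemma sub (hf : PeriodicForm N k f) (hg : PeriodicForm N k g) : PeriodicForm N k (f - g) := by
  refine ⟨hf.holo.sub hg.holo, fun γ h hγ => ?_, fun γ h hγ => ?_⟩ <;> rw [sub_slash]
  · exact (hf.period γ h hγ).sub (hg.period γ h hγ)
  · exact Asymptotics.IsBigO.sub (hf.bdd γ h hγ) (hg.bdd γ h hγ)

/-- Division by a form without zeros on `ℍ` of order at most `1` at the cusps. -/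
lemma div (hN : N ≠ 0) (hf : PeriodicForm N k f) {o : SL(2, ℤ) → ℚ} (hg : UnitForm N l g o)
    (ho : ∀ γ h, IsRep N γ h →
      o γ = 0 ∨ (o γ = 1 ∧ Tendsto (f ∣[k] γ) atImInfty (𝓝 0))) (hm : k - l = m) :
    PeriodicForm N m (f / g) := by
  subst hm
  have hpos : ∀ γ h, IsRep N γ h → 0 < h := by
    intro γ h hγ; rcases hγ with _ | _ | _ <;> omega
  refine ⟨hf.holo.div hg.holo hg.ne_zero, fun γ h hγ => ?_, fun γ h hγ => ?_⟩ <;>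
    rw [div_slash_SL2]
  · have h1 := hg γ h hγ
    have h2 : ∃ n : ℤ, o γ = n := by
      rcases ho γ h hγ with h2 | h2
      · exact ⟨0, by simpa using h2⟩
      · exact ⟨1, by simpa using h2.1⟩
    obtain ⟨n, hn⟩ := h2
    rw [hn] at h1
    exact (hf.period γ h hγ).div (h1.hasPeriod (hpos γ h hγ))
  · have h1 := hg γ h hγ
    rcases ho γ h hγ with h2 | ⟨h2, h3⟩ <;> rw [h2] at h1
    · rw [div_eq_mul_inv]
      exact isBoundedAtImInfty_mul (hf.bdd γ h hγ) h1.bdd_inv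
    · refine h1.bdd_div (hpos γ h hγ) (hf.period γ h hγ) (mdiff_slash hf.holo k γ) h3

lemma eq_const (hN : N = 2 ∨ N = 3 ∨ N = 4) (hf : PeriodicForm N 0 f) : ∃ c : ℂ, ∀ τ, f τ = c :=
  eq_const_of_hasPeriod hN hf.holo hf.period hf.bdd

/-- A form which vanishes wherever the form `g` without zeros on `ℍ` does is a multiple of `g`. -/
lemma eq_smul (hN : N = 2 ∨ N = 3 ∨ N = 4) (hf : PeriodicForm N k f) {o : SL(2, ℤ) → ℚ}
    (hg : UnitForm N k g o) (ho : ∀ γ h, IsRep N γ h →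
      o γ = 0 ∨ (o γ = 1 ∧ Tendsto (f ∣[k] γ) atImInfty (𝓝 0))) :
    ∃ c : ℂ, f = c • g := by
  obtain ⟨c, hc⟩ := (hf.div (by omega) hg ho (sub_self k)).eq_const hN
  refine ⟨c, ?_⟩
  ext τ
  have := hc τ
  rw [Pi.div_apply, div_eq_iff (hg.ne_zero τ)] at this
  rw [this, Pi.smul_apply, smul_eq_mul]

end PeriodicForm

namespace UnitForm

variable {N : ℕ} {k l : ℤ} {f g : ℍ → ℂ} {o o' : SL(2, ℤ) → ℚ}

lemma congr_order (hf : UnitForm N k f o) (h : ∀ γ n, IsRep N γ n → o γ = o' γ) :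
    UnitForm N k f o' := fun γ n hγ => h γ n hγ ▸ hf γ n hγ

lemma periodicForm (hN : N ≠ 0) (hf : UnitForm N k f o)
    (ho : ∀ γ h, IsRep N γ h → o γ = 0 ∨ o γ = 1) : PeriodicForm N k f := by
  have hpos : ∀ γ h, IsRep N γ h → 0 < h := by
    intro γ h hγ; rcases hγ with _ | _ | _ <;> omega
  refine ⟨hf.holo, fun γ h hγ => ?_, fun γ h hγ => ?_⟩
  · have h1 := hf γ h hγ
    have h2 : ∃ n : ℤ, o γ = n := by
      rcases ho γ h hγ with h2 | h2
      · exact ⟨0, by simpa using h2⟩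
      · exact ⟨1, by simpa using h2⟩
    obtain ⟨n, hn⟩ := h2
    rw [hn] at h1
    exact h1.hasPeriod (hpos γ h hγ)
  · refine (hf γ h hγ).bdd (hpos γ h hγ) ?_
    rcases ho γ h hγ with h2 | h2 <;> rw [h2]
    exact zero_le_one

lemma logD_sub_slash (hf : UnitForm N k f o) (hg : UnitForm N k g o') (γ : SL(2, ℤ)) :
    (logD f - logD g) ∣[(2 : ℤ)] γ = logD (f ∣[k] γ) - logD (g ∣[k] γ) := by
  rw [sub_slash, logD_slash hf.holo hf.ne_zero γ, logD_slash hg.holo hg.ne_zero γ,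
    add_sub_add_right_eq_sub]

lemma tendsto_logD_sub (hf : UnitForm N k f o) (hg : UnitForm N k g o') {γ : SL(2, ℤ)} {h : ℕ}
    (hγ : IsRep N γ h) (hh : 0 < h) :
    Tendsto ((logD f - logD g) ∣[(2 : ℤ)] γ) atImInfty (𝓝 ((o γ - o' γ) / h)) := by
  rw [hf.logD_sub_slash hg, sub_div]
  exact ((hf γ h hγ).tendsto_logD hh).sub ((hg γ h hγ).tendsto_logD hh)

/-- The difference of two logarithmic derivatives is a form of weight `2`. -/
lemma logD_sub (hN : N ≠ 0) (hf : UnitForm N k f o) (hg : UnitForm N k g o') :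
    PeriodicForm N 2 (logD f - logD g) := by
  have hpos : ∀ γ h, IsRep N γ h → 0 < h := by
    intro γ h hγ; rcases hγ with _ | _ | _ <;> omega
  refine ⟨(mdiff_logD hf.holo hf.ne_zero).sub (mdiff_logD hg.holo hg.ne_zero),
    fun γ h hγ => ?_, fun γ h hγ =>
      isBoundedAtImInfty_of_tendsto (hf.tendsto_logD_sub hg hγ (hpos γ h hγ))⟩
  rw [hf.logD_sub_slash hg]
  exact (hf γ h hγ).logD_hasPeriod.sub (hg γ h hγ).logD_hasPeriod

lemma tendsto_quadCov (hf : UnitForm N k f o) {γ : SL(2, ℤ)} {h : ℕ}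
    (hγ : IsRep N γ h) (hh : 0 < h) :
    Tendsto (quadCov k f ∣[(4 : ℤ)] γ) atImInfty (𝓝 ((o γ / h) ^ 2)) := by
  rw [quadCov_slash hf.holo hf.ne_zero]
  exact (hf γ h hγ).tendsto_quadCov hh k

lemma quadCov (hN : N ≠ 0) (hf : UnitForm N k f o) : PeriodicForm N 4 (quadCov k f) := by
  have hpos : ∀ γ h, IsRep N γ h → 0 < h := by
    intro γ h hγ; rcases hγ with _ | _ | _ <;> omega
  refine ⟨mdiff_quadCov k hf.holo hf.ne_zero, fun γ h hγ => ?_, fun γ h hγ =>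
    isBoundedAtImInfty_of_tendsto (hf.tendsto_quadCov hγ (hpos γ h hγ))⟩
  rw [quadCov_slash hf.holo hf.ne_zero]
  exact (hf γ h hγ).quadCov_hasPeriod k

end UnitForm

lemma one_ne_S : (1 : SL(2, ℤ)) ≠ S := by decide

lemma one_ne_halfCusp : (1 : SL(2, ℤ)) ≠ halfCusp := by decide

lemma S_ne_halfCusp : S ≠ halfCusp := by decide

lemma exists_pow_eq_complex (c : ℂ) {n : ℕ} (hn : n ≠ 0) : ∃ z : ℂ, z ^ n = c :=
  IsAlgClosed.exists_pow_nat_eq c (Nat.pos_of_ne_zero hn)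

lemma logD_etaQuot {m n : ℕ} (hm : 0 < m) (hn : 0 < n) (M L : ℕ) (τ : ℍ) :
    logD (etaQuot m n M L) τ = (M * m * EisensteinSeries.E2 (scale m hm τ)
      - L * n * EisensteinSeries.E2 (scale n hn τ)) / 24 := by
  have hmr : (0 : ℝ) < m := by exact_mod_cast hm
  have hnr : (0 : ℝ) < n := by exact_mod_cast hn
  rw [etaQuot, logD_div ((mdiff_etaLin hmr 0).pow M) ((mdiff_etaLin hnr 0).pow L)
    (fun τ => pow_ne_zero _ (etaLin_ne_zero hmr 0 τ))
    (fun τ => pow_ne_zero _ (etaLin_ne_zero hnr 0 τ)),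
    logD_pow (mdiff_etaLin hmr 0) (etaLin_ne_zero hmr 0),
    logD_pow (mdiff_etaLin hnr 0) (etaLin_ne_zero hnr 0)]
  simp only [Pi.sub_apply, Pi.smul_apply, smul_eq_mul, logD_etaLin hm, logD_etaLin hn]
  ring

end TripleForms

namespace TripleForms

open Derivative Function.Periodic Matrix.SpecialLinearGroup ModularGroup CongruenceSubgroup
open ModularForm

/-! ### The triples of forms -/

lemma UnitForm.pow_single {N r : ℕ} (hr : r ≠ 0) {f : ℍ → ℂ} {g : SL(2, ℤ)}
    (hf : UnitForm N 1 f (Pi.single g (1 / r))) : UnitForm N r (f ^ r) (Pi.single g 1) := by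
  have h := (hf.pow r).congr_order (o' := Pi.single g 1) fun γ n _ => by
    have : (r : ℚ) ≠ 0 := by exact_mod_cast hr
    simp only [Pi.mul_apply, Pi.natCast_apply, Pi.single_apply]
    split_ifs <;> field_simp; simp
  rwa [mul_one] at h

lemma single_eq_zero_or_one (g γ : SL(2, ℤ)) :
    (Pi.single g 1 : SL(2, ℤ) → ℚ) γ = 0 ∨ (Pi.single g 1 : SL(2, ℤ) → ℚ) γ = 1 := by
  rw [Pi.single_apply]; split_ifs <;> simp

/-- The system of differential equations, in terms of logarithmic derivatives. -/
lemma coupledSystem_of_logD {r : ℕ} {A B C E : ℍ → ℂ} (hB : MDiff (B ^ r)) (hC : MDiff (C ^ r))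
    (hB0 : ∀ τ, (B ^ r) τ ≠ 0) (hC0 : ∀ τ, (C ^ r) τ ≠ 0) (hE : logD (C ^ r) = E)
    (hrel : A ^ r = B ^ r + C ^ r) (hX : logD (C ^ r) - logD (B ^ r) = A ^ 2)
    (hF : quadCov r (C ^ r) = A ^ (4 - r) * B ^ r) : CoupledSystem r A B C E := by
  subst hE
  have h2 : logD (B ^ r) = logD (C ^ r) - A ^ 2 := by rw [← hX, sub_sub_cancel]
  have eqB := D_eq_mul_logD hB0
  have eqC := D_eq_mul_logD hC0
  rw [h2, sub_mul] at eqB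
  refine ⟨?_, eqB, eqC, ?_⟩
  · rw [hrel, normalizedDerivOfComplex_add _ _ hB hC, eqB, eqC]
    ring
  · rw [← hF, quadCov]
    simp

/-- The Eisenstein series `(N E₂(N τ) - E₂(τ)) / (N - 1)` of weight `2` on `Γ₀(N)`. -/
noncomputable def eisTwo (N : ℕ) (hN : 0 < N) (τ : ℍ) : ℂ :=
  (N * EisensteinSeries.E2 (scale N hN τ) - EisensteinSeries.E2 τ) / (N - 1)

/-- A triple of forms of weight `1` as in the theory of signature `r`, where `A` may be
multivalued. -/
structure IsTriple (s : Signature) (A B C : ℍ → ℂ) : Prop where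
  unitB : UnitForm s.level 1 B (Pi.single S (1 / s.r))
  unitC : UnitForm s.level 1 C (Pi.single 1 (1 / s.r))
  sqA : PeriodicForm s.level 2 (A ^ 2)
  rel : A ^ s.r = B ^ s.r + C ^ s.r
  logD_C : logD (C ^ s.r) = eisE s
  logD_sub : logD (C ^ s.r) - logD (B ^ s.r) = A ^ 2
  coupled : CoupledSystem s.r A B C (eisE s)

lemma smul_pow_eq {c z : ℂ} {n : ℕ} (h : z ^ n = c) (f : ℍ → ℂ) : (z • f) ^ n = c • f ^ n := by
  rw [smul_pow, h]

section Limits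

variable {N : ℕ} {k : ℤ} {b c : ℍ → ℂ}

lemma single_S_one : Pi.single (M := fun _ => ℚ) S 1 (1 : SL(2, ℤ)) = 0 :=
  Pi.single_eq_of_ne one_ne_S _

lemma single_one_S : Pi.single (M := fun _ => ℚ) (1 : SL(2, ℤ)) 1 S = 0 :=
  Pi.single_eq_of_ne one_ne_S.symm _

lemma UnitForm.tendsto_quadCov_infty (hc : UnitForm N k c (Pi.single 1 1)) :
    Tendsto (TripleForms.quadCov k c) atImInfty (𝓝 1) := by
  have := hc.tendsto_quadCov .infty one_pos
  rw [SlashAction.slash_one, Pi.single_eq_same] at this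
  simpa using this

lemma UnitForm.tendsto_quadCov_zero (hN : 0 < N) (hc : UnitForm N k c (Pi.single 1 1)) :
    Tendsto (TripleForms.quadCov k c ∣[(4 : ℤ)] S) atImInfty (𝓝 0) := by
  have := hc.tendsto_quadCov .zero hN
  rw [single_one_S] at this
  simpa using this

lemma UnitForm.tendsto_logD_sub_infty (hc : UnitForm N k c (Pi.single 1 1))
    (hb : UnitForm N k b (Pi.single S 1)) :
    Tendsto (logD c - logD b) atImInfty (𝓝 1) := by
  have := hc.tendsto_logD_sub hb .infty one_pos
  rw [SlashAction.slash_one, Pi.single_eq_same, single_S_one] at this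
  simpa using this

lemma UnitForm.tendsto_logD_sub_zero (hN : 0 < N) (hc : UnitForm N k c (Pi.single 1 1))
    (hb : UnitForm N k b (Pi.single S 1)) :
    Tendsto ((logD c - logD b) ∣[(2 : ℤ)] S) atImInfty (𝓝 (-1 / N)) := by
  have := hc.tendsto_logD_sub hb .zero hN
  rw [Pi.single_eq_same, single_one_S] at this
  simpa using this

end Limits

lemma scale_one (τ : ℍ) : scale 1 one_pos τ = τ := by ext; simp [scale]

/-- In signature `4`, the forms `B` and `C` are the eta quotients `η(τ)^4 / η(2τ)^2` and
`η(2τ)^4 / η(τ)^2`, up to constants. -/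
theorem exists_triple_four :
    ∃ A B C : ℍ → ℂ, IsTriple .four A B C ∧ A ^ 2 = eisTwo 2 two_pos := by
  have hB₀ : UnitForm 2 1 (etaQuot 1 2 4 2) (Pi.single S (1 / (4 : ℕ))) := by
    refine unitForm_etaQuot (N := 2) (m := 1) (n := 2) (m' := 2) (n' := 1) (M := 4) (L := 2)
      (k := 1) rfl rfl two_pos rfl ?_ ?_ (by norm_num)
    · rw [Pi.single_eq_of_ne one_ne_S]; norm_num
    · rw [Pi.single_eq_same]; norm_num
  have hC₀ : UnitForm 2 1 (etaQuot 2 1 4 2) (Pi.single 1 (1 / (4 : ℕ))) := by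
    refine unitForm_etaQuot (N := 2) (m := 2) (n := 1) (m' := 1) (n' := 2) (M := 4) (L := 2)
      (k := 1) rfl rfl two_pos rfl ?_ ?_ (by norm_num)
    · rw [Pi.single_eq_same]; norm_num
    · rw [Pi.single_eq_of_ne one_ne_S.symm]; norm_num
  have hN : 2 = 2 ∨ 2 = 3 ∨ 2 = 4 := by norm_num
  have hb₀ := hB₀.pow_single four_ne_zero
  have hc₀ := hC₀.pow_single four_ne_zero
  set b₀ := etaQuot 1 2 4 2 ^ 4
  set c₀ := etaQuot 2 1 4 2 ^ 4
  set F := quadCov (4 : ℕ) c₀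
  set X := logD c₀ - logD b₀
  have hF : PeriodicForm 2 4 F := hc₀.quadCov two_ne_zero
  have hX : PeriodicForm 2 2 X := hc₀.logD_sub two_ne_zero hb₀
  have hF1 : Tendsto F atImInfty (𝓝 1) := hc₀.tendsto_quadCov_infty
  have hFS : Tendsto (F ∣[(4 : ℤ)] S) atImInfty (𝓝 0) := hc₀.tendsto_quadCov_zero two_pos
  have hX1 : Tendsto X atImInfty (𝓝 1) := hc₀.tendsto_logD_sub_infty hb₀
  have hXS := hc₀.tendsto_logD_sub_zero two_pos hb₀
  -- `F` is a multiple of `b₀`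
  obtain ⟨κ, hκ⟩ : ∃ κ : ℂ, F = κ • b₀ := by
    refine hF.eq_smul hN hb₀ ?_
    rintro γ h (_ | _ | h4)
    · exact .inl single_S_one
    · exact .inr ⟨Pi.single_eq_same _ _, hFS⟩
    · norm_num at h4
  have hκ0 : κ ≠ 0 := by
    rintro rfl
    rw [hκ, zero_smul] at hF1
    exact one_ne_zero (tendsto_nhds_unique hF1 tendsto_const_nhds)
  have hb : UnitForm 2 4 F (Pi.single S 1) := hκ ▸ hb₀.smul hκ0
  -- `X ^ 2 - F` is a multiple of `c₀`
  have hX2 : PeriodicForm 2 4 (X ^ 2) := by rw [sq]; exact hX.mul hX rfl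
  have hX2S : (X ^ 2) ∣[(4 : ℤ)] S = (X ∣[(2 : ℤ)] S) ^ 2 := slash_pow 2 S X 2
  obtain ⟨μ, hμ⟩ : ∃ μ : ℂ, X ^ 2 - F = μ • c₀ := by
    refine (hX2.sub hF).eq_smul hN hc₀ ?_
    rintro γ h (_ | _ | h4)
    · refine .inr ⟨Pi.single_eq_same _ _, ?_⟩
      rw [SlashAction.slash_one]
      have := (hX1.pow 2).sub hF1
      rwa [one_pow, sub_self] at this
    · exact .inl single_one_S
    · norm_num at h4
  have hμ0 : μ ≠ 0 := by
    rintro rfl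
    rw [zero_smul, sub_eq_zero] at hμ
    have h1 := hXS.pow 2
    have h2 : (fun τ => (X ∣[(2 : ℤ)] S) τ ^ 2) = F ∣[(4 : ℤ)] S := by
      rw [← hμ, hX2S]; rfl
    rw [h2] at h1
    have := tendsto_nhds_unique h1 hFS
    norm_num at this
  obtain ⟨x, hx⟩ := exists_pow_eq_complex κ four_ne_zero
  obtain ⟨y, hy⟩ := exists_pow_eq_complex μ four_ne_zero
  have hx0 : x ≠ 0 := by rintro rfl; exact hκ0 (by rw [← hx]; simp)
  have hy0 : y ≠ 0 := by rintro rfl; exact hμ0 (by rw [← hy]; simp)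
  -- `X` has zeros of odd order on `ℍ`, so that `A` can only be a pointwise square root
  choose A hA using fun τ => exists_pow_eq_complex (X τ) two_ne_zero
  have hA2 : A ^ 2 = X := funext hA
  have hA4 : A ^ 4 = X ^ 2 := by rw [← hA2, ← pow_mul]
  have hBp : (x • etaQuot 1 2 4 2) ^ 4 = F := by rw [smul_pow_eq hx, hκ]
  have hCp : (y • etaQuot 2 1 4 2) ^ 4 = μ • c₀ := smul_pow_eq hy _
  have hrel : A ^ 4 = (x • etaQuot 1 2 4 2) ^ 4 + (y • etaQuot 2 1 4 2) ^ 4 := by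
    rw [hBp, hCp, ← hμ, hA4, add_sub_cancel]
  have hlC : logD (μ • c₀) = logD c₀ := logD_smul hc₀.holo hμ0
  have hE : logD c₀ = eisE .four := by
    ext τ
    rw [show c₀ = etaQuot 2 1 4 2 ^ 4 from rfl, logD_pow hC₀.holo hC₀.ne_zero]
    simp only [Pi.smul_apply, smul_eq_mul, logD_etaQuot two_pos one_pos, eisE]
    rw [scale_one]
    push_cast; ring
  have hsub : logD ((y • etaQuot 2 1 4 2) ^ 4) - logD ((x • etaQuot 1 2 4 2) ^ 4) = A ^ 2 := by
    rw [hCp, hBp, hlC, hκ, logD_smul hb₀.holo hκ0, hA2]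
  have hXE : X = eisTwo 2 two_pos := by
    ext τ
    change logD c₀ τ - logD (etaQuot 1 2 4 2 ^ 4) τ = _
    rw [hE, logD_pow hB₀.holo hB₀.ne_zero]
    simp only [Pi.smul_apply, smul_eq_mul, logD_etaQuot one_pos two_pos, eisE, eisTwo]
    rw [scale_one]
    push_cast; ring
  refine ⟨A, x • etaQuot 1 2 4 2, y • etaQuot 2 1 4 2, ⟨hB₀.smul hx0, hC₀.smul hy0, ?_, hrel, ?_,
    hsub, ?_⟩, hA2.trans hXE⟩
  · rw [hA2]; exact hX
  · change logD ((y • etaQuot 2 1 4 2) ^ 4) = _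
    rw [hCp, hlC, hE]
  · refine coupledSystem_of_logD (r := 4) (hBp ▸ hF.holo) (hCp ▸ hc₀.holo.const_smul μ)
      (fun τ => ?_) (fun τ => ?_) ?_ hrel hsub ?_
    · rw [hBp]; exact hb.ne_zero τ
    · rw [hCp]; exact mul_ne_zero hμ0 (hc₀.ne_zero τ)
    · rw [hCp, hlC, hE]
    · rw [hCp, quadCov_smul _ hc₀.holo hμ0, hBp]
      simp [F]

/-- In signature `3`, the forms `B` and `C` are the eta quotients `η(τ)^3 / η(3τ)` and
`η(3τ)^3 / η(τ)`, up to constants. -/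
theorem exists_triple_three : ∃ A B C : ℍ → ℂ,
    IsTriple .three A B C ∧ PeriodicForm 3 1 A ∧ A ^ 2 = eisTwo 3 three_pos := by
  have hB₀ : UnitForm 3 1 (etaQuot 1 3 3 1) (Pi.single S (1 / (3 : ℕ))) := by
    refine unitForm_etaQuot (N := 3) (m := 1) (n := 3) (m' := 3) (n' := 1) (M := 3) (L := 1)
      (k := 1) rfl rfl three_pos rfl ?_ ?_ (by norm_num)
    · rw [Pi.single_eq_of_ne one_ne_S]; norm_num
    · rw [Pi.single_eq_same]; norm_num
  have hC₀ : UnitForm 3 1 (etaQuot 3 1 3 1) (Pi.single 1 (1 / (3 : ℕ))) := by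
    refine unitForm_etaQuot (N := 3) (m := 3) (n := 1) (m' := 1) (n' := 3) (M := 3) (L := 1)
      (k := 1) rfl rfl three_pos rfl ?_ ?_ (by norm_num)
    · rw [Pi.single_eq_same]; norm_num
    · rw [Pi.single_eq_of_ne one_ne_S.symm]; norm_num
  have hN : 3 = 2 ∨ 3 = 3 ∨ 3 = 4 := by norm_num
  have hb₀ := hB₀.pow_single three_ne_zero
  have hc₀ := hC₀.pow_single three_ne_zero
  set b₀ := etaQuot 1 3 3 1 ^ 3
  set c₀ := etaQuot 3 1 3 1 ^ 3
  set F := quadCov (3 : ℕ) c₀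
  set X := logD c₀ - logD b₀
  have hF : PeriodicForm 3 4 F := hc₀.quadCov three_ne_zero
  have hX : PeriodicForm 3 2 X := hc₀.logD_sub three_ne_zero hb₀
  have hF1 : Tendsto F atImInfty (𝓝 1) := hc₀.tendsto_quadCov_infty
  have hFS : Tendsto (F ∣[(4 : ℤ)] S) atImInfty (𝓝 0) := hc₀.tendsto_quadCov_zero three_pos
  have hX1 : Tendsto X atImInfty (𝓝 1) := hc₀.tendsto_logD_sub_infty hb₀
  have hXS : Tendsto (X ∣[(2 : ℤ)] S) atImInfty (𝓝 (-1 / (3 : ℕ))) :=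
    hc₀.tendsto_logD_sub_zero three_pos hb₀
  -- the multiple `b` of `b₀` has limit `1` at `i∞`
  obtain ⟨κ, hκ0, hκ⟩ : ∃ κ : ℂ, κ ≠ 0 ∧ Tendsto (κ • b₀) atImInfty (𝓝 1) := by
    have h1 := hb₀ 1 1 .infty
    rw [SlashAction.slash_one, single_S_one] at h1
    obtain ⟨c, hc, hl⟩ := h1.tendsto_ne_zero
    refine ⟨c⁻¹, inv_ne_zero hc, ?_⟩
    have := hl.const_smul c⁻¹
    rwa [smul_eq_mul, inv_mul_cancel₀ hc] at this
  have hb := hb₀.smul hκ0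
  have hlb : logD (κ • b₀) = logD b₀ := logD_smul hb₀.holo hκ0
  obtain ⟨x, hx⟩ := exists_pow_eq_complex κ three_ne_zero
  have hx0 : x ≠ 0 := by rintro rfl; exact hκ0 (by rw [← hx]; simp)
  have hBp : (x • etaQuot 1 3 3 1) ^ 3 = κ • b₀ := smul_pow_eq hx _
  set b := κ • b₀
  have hbS : Tendsto (b ∣[(3 : ℤ)] S) atImInfty (𝓝 0) := by
    have := hb S 3 .zero
    rw [Pi.single_eq_same] at this
    exact this.tendsto_zero three_pos one_pos
  have hbP : PeriodicForm 3 3 b := hb.periodicForm three_ne_zero fun _ _ _ =>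
    single_eq_zero_or_one _ _
  -- the system requires `F = A b`, and `F` vanishes at the cusp `0` as `b` does
  set A := F / b
  have hA : PeriodicForm 3 1 A := by
    refine hF.div three_ne_zero hb ?_ (by norm_num)
    rintro γ h (_ | _ | h4)
    · exact .inl single_S_one
    · exact .inr ⟨Pi.single_eq_same _ _, hFS⟩
    · norm_num at h4
  have hAb : A * b = F := by ext τ; simp [A, hb.ne_zero τ]
  have hA1 : Tendsto A atImInfty (𝓝 1) := by
    have := hF1.div hκ one_ne_zero
    rwa [div_one] at this
  have hA2P : PeriodicForm 3 2 (A ^ 2) := by rw [sq]; exact hA.mul hA rfl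
  -- `(A ^ 2 - X) ^ 3 / c₀ ^ 2` has weight `0`, and vanishes at `i∞`
  have hA2 : A ^ 2 = X := by
    have hY : PeriodicForm 3 2 (A ^ 2 - X) := hA2P.sub hX
    have hY1 : Tendsto (A ^ 2 - X) atImInfty (𝓝 0) := by
      have := (hA1.pow 2).sub hX1
      rwa [one_pow, sub_self] at this
    have hQ : PeriodicForm 3 (-1) ((A ^ 2 - X) / c₀) := by
      refine hY.div three_ne_zero hc₀ ?_ (by norm_num)
      rintro γ h (_ | _ | h4)
      · refine .inr ⟨Pi.single_eq_same _ _, ?_⟩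
        rwa [SlashAction.slash_one]
      · exact .inl single_one_S
      · norm_num at h4
    have hQ2 : PeriodicForm 3 (-2) ((A ^ 2 - X) / c₀ * ((A ^ 2 - X) / c₀)) := hQ.mul hQ rfl
    obtain ⟨c, hc⟩ := (hQ2.mul hY (by norm_num : (-2 : ℤ) + 2 = 0)).eq_const hN
    have h1 : Tendsto ((A ^ 2 - X) / c₀ * ((A ^ 2 - X) / c₀) * (A ^ 2 - X)) atImInfty (𝓝 0) := by
      have h2 := hQ2.bdd 1 1 .infty
      rw [SlashAction.slash_one] at h2
      have h3 := h2.mul_isLittleO ((Asymptotics.isLittleO_one_iff ℝ).mpr hY1)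
      have h4 := h3.congr_right (g₂ := fun _ => (1 : ℝ)) fun _ => by simp
      exact (Asymptotics.isLittleO_one_iff ℝ).mp h4
    have hc0 : c = 0 := by
      rw [show (A ^ 2 - X) / c₀ * ((A ^ 2 - X) / c₀) * (A ^ 2 - X) = fun _ => c from funext hc]
        at h1
      exact tendsto_nhds_unique tendsto_const_nhds h1
    ext τ
    have h2 := hc τ
    have h3 := hc₀.ne_zero τ
    simp only [hc0, Pi.mul_apply, Pi.div_apply, mul_eq_zero, div_eq_zero_iff, h3, or_false,
      or_self] at h2
    exact sub_eq_zero.mp h2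
  -- `A ^ 3 - b` is a multiple of `c₀`
  have hA3P : PeriodicForm 3 3 (A ^ 3) := by rw [pow_succ]; exact hA2P.mul hA rfl
  obtain ⟨μ, hμ⟩ : ∃ μ : ℂ, A ^ 3 - b = μ • c₀ := by
    refine (hA3P.sub hbP).eq_smul hN hc₀ ?_
    rintro γ h (_ | _ | h4)
    · refine .inr ⟨Pi.single_eq_same _ _, ?_⟩
      rw [SlashAction.slash_one]
      have := (hA1.pow 3).sub hκ
      rwa [one_pow, sub_self] at this
    · exact .inl single_one_S
    · norm_num at h4
  have hμ0 : μ ≠ 0 := by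
    rintro rfl
    rw [zero_smul, sub_eq_zero] at hμ
    have h2 : (X ∣[(2 : ℤ)] S) ^ 3 = (b ∣[(3 : ℤ)] S) ^ 2 := by
      rw [← hA2, ← hμ, show (A ^ 2) ∣[(2 : ℤ)] S = (A ∣[(1 : ℤ)] S) ^ 2 from slash_pow 1 S A 2,
        show (A ^ 3) ∣[(3 : ℤ)] S = (A ∣[(1 : ℤ)] S) ^ 3 from slash_pow 1 S A 3, ← pow_mul,
        ← pow_mul]
    have h1 : Tendsto ((X ∣[(2 : ℤ)] S) ^ 3) atImInfty (𝓝 ((-1 / ((3 : ℕ) : ℂ)) ^ 3)) := hXS.pow 3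
    rw [h2] at h1
    have h3 : Tendsto ((b ∣[(3 : ℤ)] S) ^ 2) atImInfty (𝓝 ((0 : ℂ) ^ 2)) := hbS.pow 2
    have := tendsto_nhds_unique h1 h3
    norm_num at this
  obtain ⟨y, hy⟩ := exists_pow_eq_complex μ three_ne_zero
  have hy0 : y ≠ 0 := by rintro rfl; exact hμ0 (by rw [← hy]; simp)
  have hCp : (y • etaQuot 3 1 3 1) ^ 3 = μ • c₀ := smul_pow_eq hy _
  have hrel : A ^ 3 = (x • etaQuot 1 3 3 1) ^ 3 + (y • etaQuot 3 1 3 1) ^ 3 := by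
    rw [hBp, hCp, ← hμ, add_sub_cancel]
  have hlC : logD (μ • c₀) = logD c₀ := logD_smul hc₀.holo hμ0
  have hE : logD c₀ = eisE .three := by
    ext τ
    rw [show c₀ = etaQuot 3 1 3 1 ^ 3 from rfl, logD_pow hC₀.holo hC₀.ne_zero]
    simp only [Pi.smul_apply, smul_eq_mul, logD_etaQuot three_pos one_pos, eisE]
    rw [scale_one]
    push_cast; ring
  have hsub : logD ((y • etaQuot 3 1 3 1) ^ 3) - logD ((x • etaQuot 1 3 3 1) ^ 3) = A ^ 2 := by
    rw [hCp, hBp, hlC, hlb, hA2]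
  have hXE : X = eisTwo 3 three_pos := by
    ext τ
    change logD c₀ τ - logD (etaQuot 1 3 3 1 ^ 3) τ = _
    rw [hE, logD_pow hB₀.holo hB₀.ne_zero]
    simp only [Pi.smul_apply, smul_eq_mul, logD_etaQuot one_pos three_pos, eisE, eisTwo]
    rw [scale_one]
    push_cast; ring
  refine ⟨A, x • etaQuot 1 3 3 1, y • etaQuot 3 1 3 1,
    ⟨hB₀.smul hx0, hC₀.smul hy0, hA2P, hrel, ?_, hsub, ?_⟩, hA, hA2.trans hXE⟩
  · change logD ((y • etaQuot 3 1 3 1) ^ 3) = _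
    rw [hCp, hlC, hE]
  · refine coupledSystem_of_logD (r := 3) (hBp ▸ hbP.holo) (hCp ▸ hc₀.holo.const_smul μ)
      (fun τ => ?_) (fun τ => ?_) ?_ hrel hsub ?_
    · rw [hBp]; exact hb.ne_zero τ
    · rw [hCp]; exact mul_ne_zero hμ0 (hc₀.ne_zero τ)
    · rw [hCp, hlC, hE]
    · rw [hCp, quadCov_smul _ hc₀.holo hμ0, hBp, pow_one, hAb]

lemma UnitForm.tendsto_logD_sub_of_single {N : ℕ} {k : ℤ} {f f' : ℍ → ℂ} {g g' γ : SL(2, ℤ)}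
    {h : ℕ} (hf : UnitForm N k f (Pi.single g 1)) (hf' : UnitForm N k f' (Pi.single g' 1))
    (hγ : IsRep N γ h) (hh : 0 < h) (hg : γ ≠ g) (hg' : γ ≠ g') :
    Tendsto ((logD f - logD f') ∣[(2 : ℤ)] γ) atImInfty (𝓝 0) := by
  have := hf.tendsto_logD_sub hf' hγ hh
  rw [Pi.single_eq_of_ne hg, Pi.single_eq_of_ne hg'] at this
  simpa using this

lemma unitForm_levelFour_zero : UnitForm 4 1 (etaQuot 1 2 4 2) (Pi.single S (1 / (2 : ℕ))) := by
  have r1 := halfRel_halfCusp_one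
  have r2 := halfRel_halfCusp_two
  rw [show etaLin 1 0 = etaLin (1 : ℕ) 0 by simp] at r1
  rw [show etaLin 2 0 = etaLin (2 : ℕ) 0 by simp] at r2
  have hN0 : 0 < 4 := by norm_num
  refine unitForm_etaQuot (N := 4) (m := 1) (n := 2) (m' := 4) (n' := 2) (M := 4) (L := 2)
    (k := 1) rfl rfl hN0 rfl ?_ ?_ fun _ => ?_
  · rw [Pi.single_eq_of_ne one_ne_S]; norm_num
  · rw [Pi.single_eq_same]; norm_num
  · have := lead_etaQuot_halfCusp one_pos two_pos r1 r2 (M := 2) (L := 1) (k := 1) rfl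
    rw [Pi.single_eq_of_ne S_ne_halfCusp.symm]
    convert this using 1; norm_num

lemma unitForm_levelFour_infty : UnitForm 4 1 (etaQuot 4 2 4 2) (Pi.single 1 (1 / (2 : ℕ))) := by
  have r2 := halfRel_halfCusp_two
  have r4 := halfRel_halfCusp_four
  rw [show etaLin 2 0 = etaLin (2 : ℕ) 0 by simp] at r2
  rw [show etaLin 1 (1 / 2) = etaLin (1 : ℕ) (1 / 2) by simp] at r4
  have hN0 : 0 < 4 := by norm_num
  refine unitForm_etaQuot (N := 4) (m := 4) (n := 2) (m' := 1) (n' := 2) (M := 4) (L := 2)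
    (k := 1) rfl rfl hN0 rfl ?_ ?_ fun _ => ?_
  · rw [Pi.single_eq_same]; norm_num
  · rw [Pi.single_eq_of_ne one_ne_S.symm]; norm_num
  · have := lead_etaQuot_halfCusp one_pos two_pos r4 r2 (M := 2) (L := 1) (k := 1) rfl
    rw [Pi.single_eq_of_ne one_ne_halfCusp.symm]
    convert this using 1; norm_num

/-- The form `η(2τ)^10 / (η(τ)^4 η(4τ)^4)`, which has order `1 / 2` at the cusp `1 / 2` only, split
into two quotients of powers of two eta functions. -/
lemma unitForm_levelFour_half : UnitForm 4 1 (etaQuot 2 1 6 4 * etaQuot 2 4 4 4)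
      (Pi.single halfCusp (1 / (2 : ℕ))) := by
  have r1 := halfRel_halfCusp_one
  have r2 := halfRel_halfCusp_two
  have r4 := halfRel_halfCusp_four
  rw [show etaLin 1 0 = etaLin (1 : ℕ) 0 by simp] at r1
  rw [show etaLin 2 0 = etaLin (2 : ℕ) 0 by simp] at r2
  rw [show etaLin 1 (1 / 2) = etaLin (1 : ℕ) (1 / 2) by simp] at r4
  have hN0 : 0 < 4 := by norm_num
  have h1 : UnitForm 4 1 (etaQuot 2 1 6 4)
      (Pi.single 1 (1 / 3) + Pi.single S (-1 / 6) + Pi.single halfCusp (1 / 3)) := by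
    refine unitForm_etaQuot (N := 4) (m := 2) (n := 1) (m' := 2) (n' := 4) (M := 6) (L := 4)
      (k := 1) rfl rfl hN0 rfl ?_ ?_ fun _ => ?_
    · simp [one_ne_S, one_ne_halfCusp]; norm_num
    · simp [one_ne_S.symm, S_ne_halfCusp]; norm_num
    · have := lead_etaQuot_halfCusp two_pos one_pos r2 r1 (M := 3) (L := 2) (k := 1) rfl
      convert this using 1
      simp [one_ne_halfCusp.symm, S_ne_halfCusp.symm]; norm_num
  have h2 : UnitForm 4 0 (etaQuot 2 4 4 4)
      (Pi.single 1 (-1 / 3) + Pi.single S (1 / 6) + Pi.single halfCusp (1 / 6)) := by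
    refine unitForm_etaQuot (N := 4) (m := 2) (n := 4) (m' := 2) (n' := 1) (M := 4) (L := 4)
      (k := 0) rfl rfl hN0 rfl ?_ ?_ fun _ => ?_
    · simp [one_ne_S, one_ne_halfCusp]; norm_num
    · simp [one_ne_S.symm, S_ne_halfCusp]; norm_num
    · have := lead_etaQuot_halfCusp two_pos one_pos r2 r4 (M := 2) (L := 2) (k := 0) rfl
      convert this using 1
      simp [one_ne_halfCusp.symm, S_ne_halfCusp.symm]; norm_num
  have h3 := h1.mul h2
  rw [add_zero] at h3
  refine h3.congr_order ?_
  rintro γ h (_ | _ | h4)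
  · simp [one_ne_S, one_ne_halfCusp]; norm_num
  · simp [one_ne_S.symm, S_ne_halfCusp]; norm_num
  · simp [one_ne_halfCusp.symm, S_ne_halfCusp.symm]; norm_num

/-- The covariant of weight `4` vanishes at the cusps `0` and `1 / 2`. -/
lemma quadCov_eq_smul_mul {a b c₀ : ℍ → ℂ} (ha : UnitForm 4 2 a (Pi.single halfCusp 1))
    (hb : UnitForm 4 2 b (Pi.single S 1)) (hc₀ : UnitForm 4 2 c₀ (Pi.single 1 1))
    (ha1 : Tendsto a atImInfty (𝓝 1)) (hb1 : Tendsto b atImInfty (𝓝 1)) :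
    quadCov 2 c₀ = a * b := by
  have hN0 : 0 < 4 := by norm_num
  have hN : 4 = 2 ∨ 4 = 3 ∨ 4 = 4 := by norm_num
  set F := quadCov 2 c₀
  have hF : PeriodicForm 4 4 F := hc₀.quadCov (by norm_num)
  have hF1 : Tendsto F atImInfty (𝓝 1) := hc₀.tendsto_quadCov_infty
  have hFS : Tendsto (F ∣[(4 : ℤ)] S) atImInfty (𝓝 0) := hc₀.tendsto_quadCov_zero hN0
  have hFU : Tendsto (F ∣[(4 : ℤ)] halfCusp) atImInfty (𝓝 0) := by
    have := hc₀.tendsto_quadCov (.half rfl) one_pos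
    rw [Pi.single_eq_of_ne one_ne_halfCusp.symm] at this
    simpa using this
  have hm := ha.mul hb
  rw [show (2 : ℤ) + 2 = 4 by norm_num] at hm
  obtain ⟨t, ht⟩ : ∃ t : ℂ, F = t • (a * b) := by
    refine hF.eq_smul hN hm ?_
    have o1 : (Pi.single halfCusp 1 + Pi.single S 1 : SL(2, ℤ) → ℚ) 1 = 0 := by
      rw [Pi.add_apply, Pi.single_eq_of_ne one_ne_halfCusp, Pi.single_eq_of_ne one_ne_S, add_zero]
    have oS : (Pi.single halfCusp 1 + Pi.single S 1 : SL(2, ℤ) → ℚ) S = 1 := by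
      rw [Pi.add_apply, Pi.single_eq_of_ne S_ne_halfCusp, Pi.single_eq_same, zero_add]
    have oU : (Pi.single halfCusp 1 + Pi.single S 1 : SL(2, ℤ) → ℚ) halfCusp = 1 := by
      rw [Pi.add_apply, Pi.single_eq_of_ne S_ne_halfCusp.symm, Pi.single_eq_same, add_zero]
    rintro γ h (_ | _ | h4)
    · exact .inl o1
    · exact .inr ⟨oS, hFS⟩
    · exact .inr ⟨oU, hFU⟩
  have h1 : Tendsto (t • (a * b)) atImInfty (𝓝 (t • (1 * 1))) := (ha1.mul hb1).const_smul t
  rw [← ht] at h1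
  have h2 := tendsto_nhds_unique h1 hF1
  rw [mul_one, smul_eq_mul, mul_one] at h2
  rw [ht, h2, one_smul]

/-- The linear relations between the logarithmic derivatives of the forms of weight `2` on `Γ₀(4)`
that vanish at one of the three cusps. -/
lemma levelFour_relations {a₀ b₀ c₀ : ℍ → ℂ} (ha₀ : UnitForm 4 2 a₀ (Pi.single halfCusp 1))
    (hb₀ : UnitForm 4 2 b₀ (Pi.single S 1)) (hc₀ : UnitForm 4 2 c₀ (Pi.single 1 1)) :
    ∃ κ ν μ : ℂ, κ ≠ 0 ∧ ν ≠ 0 ∧ μ ≠ 0 ∧ logD c₀ - logD b₀ = κ • a₀ ∧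
      logD c₀ - logD a₀ = ν • b₀ ∧ logD a₀ - logD b₀ = μ • c₀ ∧
      quadCov 2 c₀ = (κ • a₀) * (ν • b₀) := by
  have hN0 : 0 < 4 := by norm_num
  have hN : 4 = 2 ∨ 4 = 3 ∨ 4 = 4 := by norm_num
  have hN0' : 4 ≠ 0 := by norm_num
  -- the differences of the logarithmic derivatives are multiples of `a₀`, `b₀`, `c₀`
  obtain ⟨κ, hκ⟩ : ∃ κ : ℂ, logD c₀ - logD b₀ = κ • a₀ := by
    refine (hc₀.logD_sub hN0' hb₀).eq_smul hN ha₀ ?_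
    rintro γ h (_ | _ | h4)
    · exact .inl (Pi.single_eq_of_ne one_ne_halfCusp _)
    · exact .inl (Pi.single_eq_of_ne S_ne_halfCusp _)
    · exact .inr ⟨Pi.single_eq_same _ _, hc₀.tendsto_logD_sub_of_single hb₀ (.half rfl) one_pos
        one_ne_halfCusp.symm S_ne_halfCusp.symm⟩
  obtain ⟨ν, hν⟩ : ∃ ν : ℂ, logD c₀ - logD a₀ = ν • b₀ := by
    refine (hc₀.logD_sub hN0' ha₀).eq_smul hN hb₀ ?_
    rintro γ h (_ | _ | h4)
    · exact .inl (Pi.single_eq_of_ne one_ne_S _)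
    · exact .inr ⟨Pi.single_eq_same _ _, hc₀.tendsto_logD_sub_of_single ha₀ .zero hN0
        one_ne_S.symm S_ne_halfCusp⟩
    · exact .inl (Pi.single_eq_of_ne S_ne_halfCusp.symm _)
  obtain ⟨μ, hμ⟩ : ∃ μ : ℂ, logD a₀ - logD b₀ = μ • c₀ := by
    refine (ha₀.logD_sub hN0' hb₀).eq_smul hN hc₀ ?_
    rintro γ h (_ | _ | h4)
    · exact .inr ⟨Pi.single_eq_same _ _, ha₀.tendsto_logD_sub_of_single hb₀ .infty one_pos
        one_ne_halfCusp one_ne_S⟩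
    · exact .inl (Pi.single_eq_of_ne one_ne_S.symm _)
    · exact .inl (Pi.single_eq_of_ne one_ne_halfCusp.symm _)
  have hκ1 : Tendsto (κ • a₀) atImInfty (𝓝 1) := hκ ▸ hc₀.tendsto_logD_sub_infty hb₀
  have hν1 : Tendsto (ν • b₀) atImInfty (𝓝 1) := by
    have := hc₀.tendsto_logD_sub ha₀ .infty one_pos
    rw [SlashAction.slash_one, hν, Pi.single_eq_same, Pi.single_eq_of_ne one_ne_halfCusp] at this
    simpa using this
  have hκ0 : κ ≠ 0 := by
    rintro rfl
    rw [zero_smul] at hκ1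
    exact one_ne_zero (tendsto_nhds_unique hκ1 tendsto_const_nhds)
  have hν0 : ν ≠ 0 := by
    rintro rfl
    rw [zero_smul] at hν1
    exact one_ne_zero (tendsto_nhds_unique hν1 tendsto_const_nhds)
  have hμ0 : μ ≠ 0 := by
    rintro rfl
    have h1 := ha₀.tendsto_logD_sub hb₀ .zero hN0
    rw [hμ, zero_smul, Pi.single_eq_same, Pi.single_eq_of_ne S_ne_halfCusp,
      SlashAction.zero_slash] at h1
    have h2 : Tendsto (0 : ℍ → ℂ) atImInfty (𝓝 0) := tendsto_const_nhds
    have := tendsto_nhds_unique h1 h2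
    norm_num at this
  exact ⟨κ, ν, μ, hκ0, hν0, hμ0, hκ, hν, hμ,
    quadCov_eq_smul_mul (ha₀.smul hκ0) (hb₀.smul hν0) hc₀ hκ1 hν1⟩

/-- In signature `2`, the forms `A`, `B` and `C` are the eta quotients
`η(2τ)^10 / (η(τ)^4 η(4τ)^4)`, `η(τ)^4 / η(2τ)^2` and `η(4τ)^4 / η(2τ)^2`, up to constants. -/
theorem exists_triple_two :
    ∃ A B C : ℍ → ℂ, IsTriple .two A B C ∧ UnitForm 4 1 A (Pi.single halfCusp (1 / (2 : ℕ))) := by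
  have hN0 : 0 < 4 := by norm_num
  have hA₀ := unitForm_levelFour_half
  have hB₀ := unitForm_levelFour_zero
  have hC₀ := unitForm_levelFour_infty
  have hN0' : 4 ≠ 0 := by norm_num
  set A₀ := etaQuot 2 1 6 4 * etaQuot 2 4 4 4
  have ha₀ := hA₀.pow_single two_ne_zero
  have hb₀ := hB₀.pow_single two_ne_zero
  have hc₀ := hC₀.pow_single two_ne_zero
  set a₀ := A₀ ^ 2
  set b₀ := etaQuot 1 2 4 2 ^ 2
  set c₀ := etaQuot 4 2 4 2 ^ 2
  obtain ⟨κ, ν, μ, hκ0, hν0, hμ0, hκ, hν, hμ, hab⟩ := levelFour_relations ha₀ hb₀ hc₀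
  obtain ⟨x, hx⟩ := exists_pow_eq_complex κ two_ne_zero
  obtain ⟨y, hy⟩ := exists_pow_eq_complex ν two_ne_zero
  obtain ⟨z, hz⟩ := exists_pow_eq_complex μ two_ne_zero
  have hx0 : x ≠ 0 := by rintro rfl; exact hκ0 (by rw [← hx]; simp)
  have hy0 : y ≠ 0 := by rintro rfl; exact hν0 (by rw [← hy]; simp)
  have hz0 : z ≠ 0 := by rintro rfl; exact hμ0 (by rw [← hz]; simp)
  have hAp : (x • A₀) ^ 2 = κ • a₀ := smul_pow_eq hx _
  have hBp : (y • etaQuot 1 2 4 2) ^ 2 = ν • b₀ := smul_pow_eq hy _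
  have hCp : (z • etaQuot 4 2 4 2) ^ 2 = μ • c₀ := smul_pow_eq hz _
  have hrel : (x • A₀) ^ 2 = (y • etaQuot 1 2 4 2) ^ 2 + (z • etaQuot 4 2 4 2) ^ 2 := by
    rw [hAp, hBp, hCp, ← hκ, ← hν, ← hμ, sub_add_sub_cancel]
  have hlC : logD (μ • c₀) = logD c₀ := logD_smul hc₀.holo hμ0
  have hE : logD c₀ = eisE .two := by
    ext τ
    rw [show c₀ = etaQuot 4 2 4 2 ^ 2 from rfl, logD_pow hC₀.holo hC₀.ne_zero]
    simp only [Pi.smul_apply, smul_eq_mul, logD_etaQuot hN0 two_pos, eisE]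
    push_cast; ring
  have hsub : logD ((z • etaQuot 4 2 4 2) ^ 2) - logD ((y • etaQuot 1 2 4 2) ^ 2)
      = (x • A₀) ^ 2 := by
    rw [hCp, hBp, hlC, logD_smul hb₀.holo hν0, hκ, hAp]
  refine ⟨x • A₀, y • etaQuot 1 2 4 2, z • etaQuot 4 2 4 2,
    ⟨hB₀.smul hy0, hC₀.smul hz0, ?_, hrel, ?_, hsub, ?_⟩, hA₀.smul hx0⟩
  · rw [hAp, ← hκ]; exact hc₀.logD_sub hN0' hb₀
  · change logD ((z • etaQuot 4 2 4 2) ^ 2) = _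
    rw [hCp, hlC, hE]
  · refine coupledSystem_of_logD (r := 2) (hBp ▸ hb₀.holo.const_smul ν)
      (hCp ▸ hc₀.holo.const_smul μ) (fun τ => ?_) (fun τ => ?_) ?_ hrel hsub ?_
    · rw [hBp]; exact mul_ne_zero hν0 (hb₀.ne_zero τ)
    · rw [hCp]; exact mul_ne_zero hμ0 (hc₀.ne_zero τ)
    · rw [hCp, hlC, hE]
    · rw [hCp, quadCov_smul _ hc₀.holo hμ0, hBp, hAp, ← hab, Nat.cast_ofNat]

end TripleForms

namespace TripleForms

open Derivative

/-! ### Elimination: the generalized Chazy equations -/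

lemma dot_eq (f : ℍ → ℂ) (τ : ℍ) : dot f τ = 2 * Real.pi * I * D f τ := by
  rw [dot, normalizedDerivOfComplex, mul_inv_cancel_left₀ Complex.two_pi_I_ne_zero]

lemma dot_smul (c : ℂ) {f : ℍ → ℂ} (hf : MDiff f) (τ : ℍ) :
    dot (c • f) τ = 2 * Real.pi * I * (c * D f τ) := by
  rw [dot_eq, normalizedDerivOfComplex_smul c f hf]; rfl

section Chazy

variable {r : ℕ} {E : ℍ → ℂ}

/-- In terms of `E` and of the derivation `q d/dq`, the functions `u_4`, `u_6`, … are, up to powers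
of `2πi / r`, obtained by iterating the covariant derivative `f ↦ r f' - k E f`. -/
lemma chazyU_zero (hr : r ≠ 0) (hE : MDiff E) {G : ℍ → ℂ}
    (h : (r : ℂ) • D E = E * E - G) :
    chazyU (uOf r E) 0 = (-(2 * Real.pi * I / r) ^ 2 : ℂ) • G := by
  ext τ
  have h1 : uOf r E = (2 * Real.pi * I / r : ℂ) • E := rfl
  have h2 := congrFun h τ
  have hr' : (r : ℂ) ≠ 0 := by exact_mod_cast hr
  simp only [Pi.smul_apply, smul_eq_mul, Pi.sub_apply, Pi.mul_apply] at h2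
  simp only [chazyU, h1, dot_smul _ hE, Pi.smul_apply, smul_eq_mul]
  rw [show G τ = E τ * E τ - r * D E τ by rw [h2]; ring]
  field_simp
  ring

lemma chazyU_succ (hr : r ≠ 0) {j : ℕ} {c : ℂ} {G H : ℍ → ℂ} (hG : MDiff G)
    (hu : chazyU (uOf r E) j = c • G)
    (h : ∀ τ, r * D G τ - (2 * j + 4 : ℕ) * (E τ * G τ) = H τ) :
    chazyU (uOf r E) (j + 1) = (c * (2 * Real.pi * I / r) : ℂ) • H := by
  ext τ
  have hr' : (r : ℂ) ≠ 0 := by exact_mod_cast hr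
  simp only [chazyU, hu, dot_smul _ hG, Pi.smul_apply, smul_eq_mul, ← h τ, uOf]
  field_simp

end Chazy

lemma chazyPoly_ne_zero (s : Signature) : chazyPoly s ≠ 0 := by
  intro h
  have h1 := congrArg (MvPolynomial.eval ![(1 : ℂ), 0, 0]) h
  cases s <;> simp [chazyPoly] at h1

lemma chazyPoly_isWeightedHomogeneous (s : Signature) :
    ∃ n : ℕ, (chazyPoly s).IsWeightedHomogeneous (![4, 6, 8] : Fin 3 → ℕ) n := by
  have h0 := MvPolynomial.isWeightedHomogeneous_X ℂ (![4, 6, 8] : Fin 3 → ℕ) 0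
  have h1 := MvPolynomial.isWeightedHomogeneous_X ℂ (![4, 6, 8] : Fin 3 → ℕ) 1
  have h2 := MvPolynomial.isWeightedHomogeneous_X ℂ (![4, 6, 8] : Fin 3 → ℕ) 2
  have hC := fun c : ℂ => MvPolynomial.isWeightedHomogeneous_C (![4, 6, 8] : Fin 3 → ℕ) c
  have c8 := hC 8
  have c24 := hC 24
  have c15 := hC 15
  have c144 := hC 144
  rw [map_ofNat] at c8 c24 c15 c144
  have four : MvPolynomial.IsWeightedHomogeneous (![4, 6, 8] : Fin 3 → ℕ)
      (chazyPoly .four) 12 :=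
    Submodule.add_mem (MvPolynomial.weightedHomogeneousSubmodule ℂ _ 12)
      (Submodule.sub_mem _ (h0.mul h2) (h1.pow 2)) (c8.mul (h0.pow 3))
  cases s
  · exact ⟨12, four⟩
  · refine ⟨20, Submodule.add_mem (MvPolynomial.weightedHomogeneousSubmodule ℂ _ 20)
      (Submodule.sub_mem _ (Submodule.add_mem _ (Submodule.sub_mem _ (h0.mul (h2.pow 2))
        ((h1.pow 2).mul h2)) ((c24.mul (h0.pow 3)).mul h2))
        ((c15.mul (h0.pow 2)).mul (h1.pow 2))) (c144.mul (h0.pow 5))⟩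
  · exact ⟨12, four⟩

section Elimination

variable {A B C E : ℍ → ℂ}

lemma eq_zero_of_mul_left {f g : ℍ → ℂ} (hf : MDiff f) (hg : MDiff g) (hf0 : f ≠ 0)
    (h : f * g = 0) :
    g = 0 := by
  rcases (UpperHalfPlane.mul_eq_zero_iff hf hg).mp h with h | h
  · exact absurd h hf0
  · exact h

/-- In signature `4`, the equation for `A ^ 4` divided by `A ^ 2`. -/
lemma CoupledSystem.two_mul_D_sq (h : CoupledSystem 4 A B C E) (hb : MDiff (B ^ 4)) (hE : MDiff E)
    (hX : MDiff (A ^ 2)) (hA : A ≠ 0) (τ : ℍ) :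
    2 * D (A ^ 2) τ = E τ * (A ^ 2) τ - (B ^ 4) τ := by
  have eA := h.eqA
  have hX0 : A ^ 2 ≠ 0 := pow_ne_zero_iff two_ne_zero |>.mpr hA
  rw [show A ^ 4 = A ^ 2 * A ^ 2 by ring] at eA
  set X := A ^ 2
  set b := B ^ 4
  have h1 : X * ((2 : ℂ) • D X - (E * X - b)) = 0 := by
    ext τ
    have := congrFun eA τ
    rw [D_mul_apply hX hX] at this
    simp only [Pi.mul_apply, Pi.sub_apply, Pi.smul_apply, smul_eq_mul, Pi.zero_apply] at this ⊢
    linear_combination this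
  have h2 := eq_zero_of_mul_left hX (((normalizedDerivOfComplex_mdifferentiable hX).const_smul 2).sub
    ((hE.mul hX).sub hb)) hX0 h1
  have := congrFun h2 τ
  simp only [Pi.mul_apply, Pi.sub_apply, Pi.smul_apply, smul_eq_mul, Pi.zero_apply] at this
  linear_combination this

/-- In signature `3`, the equation for `A ^ 3` divided by `A ^ 2`. -/
lemma CoupledSystem.three_mul_D (h : CoupledSystem 3 A B C E) (hb : MDiff (B ^ 3)) (hE : MDiff E)
    (hAd : MDiff A) (hA : A ≠ 0) (τ : ℍ) : 3 * D A τ = E τ * A τ - (B ^ 3) τ := by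
  have eA := h.eqA
  set b := B ^ 3
  have h1 : A ^ 2 * ((3 : ℂ) • D A - (E * A - b)) = 0 := by
    ext τ
    have := congrFun eA τ
    rw [normalizedDerivOfComplex_pow A 3 hAd] at this
    simp only [Pi.mul_apply, Pi.sub_apply, Pi.pow_apply, Pi.smul_apply, smul_eq_mul,
      Pi.zero_apply, Pi.natCast_apply] at this ⊢
    push_cast at this
    linear_combination this
  have h2 := eq_zero_of_mul_left (hAd.pow 2) (((normalizedDerivOfComplex_mdifferentiable
    hAd).const_smul 3).sub ((hE.mul hAd).sub hb)) (pow_ne_zero_iff two_ne_zero |>.mpr hA) h1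
  have := congrFun h2 τ
  simp only [Pi.mul_apply, Pi.sub_apply, Pi.smul_apply, smul_eq_mul, Pi.zero_apply] at this
  linear_combination this

lemma satisfiesChazy_four (hb : MDiff (B ^ 4)) (hE : MDiff E) (hX : MDiff (A ^ 2)) (hA : A ≠ 0)
    (h : CoupledSystem 4 A B C E) : SatisfiesChazy (chazyPoly .four) (uOf 4 E) := by
  refine ⟨chazyPoly_ne_zero _, chazyPoly_isWeightedHomogeneous _, ?_⟩
  have h' := h
  obtain ⟨-, eB, -, eE⟩ := h
  rw [Nat.sub_self, pow_zero, one_mul] at eE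
  set X := A ^ 2
  set b := B ^ 4
  have dX : ∀ τ, 2 * D X τ = E τ * X τ - b τ := h'.two_mul_D_sq hb hE hX hA
  have dB : ∀ τ, D b τ = E τ * b τ - X τ * b τ := congrFun eB
  have u0 := chazyU_zero four_ne_zero hE eE
  have u1 := chazyU_succ (H := (-4 : ℂ) • (X * b)) four_ne_zero hb u0 fun τ => by
    simp only [dB, Pi.smul_apply, Pi.mul_apply, smul_eq_mul]; push_cast; ring
  have u2 := chazyU_succ (H := (8 : ℂ) • (b * b) + (16 : ℂ) • (X * X * b)) four_ne_zero
      ((hX.mul hb).const_smul _) u1 fun τ => by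
    rw [normalizedDerivOfComplex_smul _ _ (hX.mul hb)]
    simp only [Pi.smul_apply, Pi.mul_apply, Pi.add_apply, smul_eq_mul, D_mul_apply hX hb, dB]
    push_cast
    linear_combination (-8 * b τ) * dX τ
  intro τ
  rw [show (0 + 1 + 1) = 2 from rfl] at u2
  rw [show (0 + 1) = 1 from rfl] at u1
  simp only [chazyPoly, u0, u1, u2, map_add, map_sub, map_mul, map_pow, map_ofNat,
    MvPolynomial.eval_X, Matrix.cons_val, Pi.smul_apply, Pi.mul_apply, Pi.add_apply, smul_eq_mul]
  ring

lemma satisfiesChazy_three (hb : MDiff (B ^ 3)) (hE : MDiff E) (hAd : MDiff A) (hA : A ≠ 0)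
    (h : CoupledSystem 3 A B C E) : SatisfiesChazy (chazyPoly .three) (uOf 3 E) := by
  refine ⟨chazyPoly_ne_zero _, chazyPoly_isWeightedHomogeneous _, ?_⟩
  have h' := h
  obtain ⟨-, eB, -, eE⟩ := h
  rw [pow_one] at eE
  set b := B ^ 3
  have dA : ∀ τ, 3 * D A τ = E τ * A τ - b τ := h'.three_mul_D hb hE hAd hA
  have dB : ∀ τ, D b τ = E τ * b τ - A τ ^ 2 * b τ := congrFun eB
  have u0 := chazyU_zero three_ne_zero hE eE
  have u1 := chazyU_succ (H := -(b * b) - (3 : ℂ) • (A ^ 3 * b)) three_ne_zero (hAd.mul hb) u0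
      fun τ => by
    simp only [dB, Pi.smul_apply, Pi.mul_apply, Pi.sub_apply, Pi.neg_apply, Pi.pow_apply,
      smul_eq_mul, D_mul_apply hAd hb]
    push_cast
    linear_combination b τ * dA τ
  have hbb := hb.mul hb
  have hA3 := hAd.pow 3
  have u2 := chazyU_succ (H := (15 : ℂ) • (A ^ 2 * b * b) + (9 : ℂ) • (A ^ 5 * b)) three_ne_zero
      (hbb.neg.sub ((hA3.mul hb).const_smul _)) u1 fun τ => by
    rw [normalizedDerivOfComplex_sub _ _ hbb.neg ((hA3.mul hb).const_smul _),
      normalizedDerivOfComplex_neg _ hbb, normalizedDerivOfComplex_smul _ _ (hA3.mul hb)]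
    simp only [Pi.smul_apply, Pi.mul_apply, Pi.add_apply, Pi.sub_apply, Pi.neg_apply, smul_eq_mul,
      D_mul_apply hb hb, D_mul_apply hA3 hb, normalizedDerivOfComplex_pow A 3 hAd, dB,
      Pi.pow_apply, Pi.natCast_apply]
    push_cast
    linear_combination (-9 * b τ * A τ ^ 2) * dA τ
  intro τ
  rw [show (0 + 1 + 1) = 2 from rfl] at u2
  rw [show (0 + 1) = 1 from rfl] at u1
  simp only [chazyPoly, u0, u1, u2, map_add, map_sub, map_mul, map_pow, map_ofNat,
    MvPolynomial.eval_X, Matrix.cons_val, Pi.smul_apply, Pi.mul_apply, Pi.add_apply,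
    Pi.sub_apply, Pi.neg_apply, Pi.pow_apply, smul_eq_mul]
  ring

lemma satisfiesChazy_two (ha : MDiff (A ^ 2)) (hb : MDiff (B ^ 2)) (hE : MDiff E)
    (h : CoupledSystem 2 A B C E) : SatisfiesChazy (chazyPoly .two) (uOf 2 E) := by
  refine ⟨chazyPoly_ne_zero _, chazyPoly_isWeightedHomogeneous _, ?_⟩
  obtain ⟨eA, eB, -, eE⟩ := h
  rw [show 4 - 2 = 2 from rfl] at eE
  set a := A ^ 2
  set b := B ^ 2
  have dA : ∀ τ, D a τ = E τ * a τ - a τ * b τ := congrFun eA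
  have dB : ∀ τ, D b τ = E τ * b τ - a τ * b τ := congrFun eB
  have hab := ha.mul hb
  have u0 := chazyU_zero two_ne_zero hE eE
  have u1 := chazyU_succ (H := (-2 : ℂ) • (a * b * (a + b))) two_ne_zero hab u0 fun τ => by
    simp only [dA, dB, Pi.smul_apply, Pi.mul_apply, Pi.add_apply, smul_eq_mul, D_mul_apply ha hb]
    push_cast
    ring
  have hs := ha.add hb
  have u2 := chazyU_succ (H := (4 : ℂ) • (a * b * ((a + b) ^ 2 + (2 : ℂ) • (a * b)))) two_ne_zero
      ((hab.mul hs).const_smul _) u1 fun τ => by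
    rw [normalizedDerivOfComplex_smul _ _ (hab.mul hs)]
    simp only [Pi.smul_apply, Pi.mul_apply, Pi.add_apply, smul_eq_mul, D_mul_apply hab hs,
      D_mul_apply ha hb, normalizedDerivOfComplex_add _ _ ha hb, dA, dB, Pi.pow_apply]
    push_cast
    ring
  intro τ
  rw [show (0 + 1 + 1) = 2 from rfl] at u2
  rw [show (0 + 1) = 1 from rfl] at u1
  simp only [chazyPoly, u0, u1, u2, map_add, map_sub, map_mul, map_pow, map_ofNat,
    MvPolynomial.eval_X, Matrix.cons_val, Pi.smul_apply, Pi.mul_apply, Pi.add_apply,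
    Pi.pow_apply, smul_eq_mul]
  ring

theorem satisfiesChazy (s : Signature) (hb : MDiff (B ^ s.r)) (hE : MDiff E) (hX : MDiff (A ^ 2))
    (hA' : MDiff (A ^ (4 - s.r))) (hA : A ≠ 0) (h : CoupledSystem s.r A B C E) :
    SatisfiesChazy (chazyPoly s) (uOf s.r E) := by
  cases s
  · exact satisfiesChazy_four hb hE hX hA h
  · exact satisfiesChazy_three hb hE (by simpa [Signature.r] using hA') hA h
  · exact satisfiesChazy_two hX hb hE h

end Elimination

end TripleForms

namespace TripleForms

open EisensteinSeries ArithmeticFunction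

/-! ### Divisor sums -/

/-- `σ₁(n / m)`, understood to be `0` if `m` does not divide `n`. -/
noncomputable def sigmaDiv (m n : ℕ) : ℂ := if m ∣ n then (sigma 1 (n / m) : ℂ) else 0

lemma sigmaDiv_one (n : ℕ) : sigmaDiv 1 n = sigma 1 n := by simp [sigmaDiv]

lemma sigma_one_eq (n : ℕ) : (sigma 1 n : ℂ) = ∑ d ∈ n.divisors, (d : ℂ) := by
  rw [sigma_apply]; simp

lemma sum_divisors_dvd {m n : ℕ} (hm : 0 < m) (hn : n ≠ 0) (g : ℕ → ℂ) :
    ∑ d ∈ n.divisors, (if m ∣ d then g d else 0)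
      = if m ∣ n then ∑ d ∈ (n / m).divisors, g (m * d) else 0 := by
  split_ifs with h
  · obtain ⟨k, rfl⟩ := h
    rw [Nat.mul_div_cancel_left k hm, ← Finset.sum_filter]
    refine Finset.sum_nbij' (fun d => d / m) (fun d => m * d) ?_ ?_ ?_ ?_ ?_
    · intro d hd
      simp only [Finset.mem_filter, Nat.mem_divisors] at hd ⊢
      obtain ⟨⟨h1, h2⟩, e, rfl⟩ := hd
      rw [Nat.mul_div_cancel_left e hm]
      exact ⟨Nat.dvd_of_mul_dvd_mul_left hm h1, right_ne_zero_of_mul hn⟩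
    · intro d hd
      simp only [Finset.mem_filter, Nat.mem_divisors] at hd ⊢
      exact ⟨⟨mul_dvd_mul_left m hd.1, hn⟩, dvd_mul_right m d⟩
    · intro d hd
      simp only [Finset.mem_filter] at hd
      exact Nat.mul_div_cancel' hd.2
    · intro d _
      exact Nat.mul_div_cancel_left d hm
    · intro d hd
      simp only [Finset.mem_filter] at hd
      rw [Nat.mul_div_cancel' hd.2]
  · refine Finset.sum_eq_zero fun d hd => if_neg fun h' => h (h'.trans (Nat.dvd_of_mem_divisors hd))

lemma sigmaC_eq {N n : ℕ} (χ : ZMod N → ℂ) :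
    sigmaC 1 n χ = ∑ e ∈ n.divisors, χ (e : ZMod N) * ((n / e : ℕ) : ℂ) := by
  rw [← Nat.sum_div_divisors n fun e => χ (e : ZMod N) * ((n / e : ℕ) : ℂ), sigmaC]
  refine Finset.sum_congr rfl fun d hd => ?_
  rw [Nat.div_div_self (Nat.dvd_of_mem_divisors hd) (Nat.ne_zero_of_mem_divisors hd), pow_one]

lemma sum_divisors_dvd_self {m n : ℕ} (hm : 0 < m) (hn : n ≠ 0) :
    ∑ d ∈ n.divisors, (if m ∣ d then (d : ℂ) else 0) = m * sigmaDiv m n := by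
  rw [sum_divisors_dvd hm hn, sigmaDiv, mul_ite, mul_zero]
  simp only [sigma_one_eq, Finset.mul_sum, Nat.cast_mul]

lemma sum_divisors_dvd_div {m n : ℕ} (hm : 0 < m) (hn : n ≠ 0) :
    ∑ d ∈ n.divisors, (if m ∣ d then ((n / d : ℕ) : ℂ) else 0) = sigmaDiv m n := by
  rw [sum_divisors_dvd hm hn, sigmaDiv]
  simp only [sigma_one_eq, ← Nat.div_div_eq_div_mul]
  rw [Nat.sum_div_divisors (n / m) fun d => (d : ℂ)]

lemma sum_divisors_div (n : ℕ) : ∑ d ∈ n.divisors, ((n / d : ℕ) : ℂ) = sigma 1 n := by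
  rw [Nat.sum_div_divisors n fun d => (d : ℂ), sigma_one_eq]

lemma char_two (a b : ℂ) (d : ℕ) :
    (![a, b] : ZMod 2 → ℂ) (d : ZMod 2) = b + (a - b) * if d % 2 = 0 then 1 else 0 := by
  rw [← ZMod.natCast_mod d 2]
  have h : d % 2 < 2 := Nat.mod_lt _ two_pos
  interval_cases d % 2
  · change a = _; simp
  · change b = _; simp

lemma char_three (a b : ℂ) (d : ℕ) :
    (![a, b, b] : ZMod 3 → ℂ) (d : ZMod 3) = b + (a - b) * if d % 3 = 0 then 1 else 0 := by
  rw [← ZMod.natCast_mod d 3]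
  have h : d % 3 < 3 := Nat.mod_lt _ three_pos
  interval_cases d % 3
  · change a = _; simp
  · change b = _; simp
  · change b = _; simp

lemma char_four (a b : ℂ) (d : ℕ) :
    (![a, 0, b, 0] : ZMod 4 → ℂ) (d : ZMod 4)
      = if 2 ∣ d then (![a, b] : ZMod 2 → ℂ) ((d / 2 : ℕ) : ZMod 2) else 0 := by
  have h2 : (2 ∣ d) = (d % 4 = 0 ∨ d % 4 = 2) := by ext; omega
  have h3 : (d / 2 % 2 = 0) = (d % 4 < 2) := by ext; omega
  rw [char_two, ← ZMod.natCast_mod d 4]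
  have h : d % 4 < 4 := Nat.mod_lt _ four_pos
  simp only [h2, h3]
  interval_cases d % 4
  · change a = _; simp
  · change 0 = _; simp
  · change b = _; simp
  · change 0 = _; simp

lemma sum_add_mul_ite {n m : ℕ} (a b : ℂ) (g : ℕ → ℂ) :
    ∑ d ∈ n.divisors, (b + (a - b) * if d % m = 0 then 1 else 0) * g d
      = b * ∑ d ∈ n.divisors, g d + (a - b) * ∑ d ∈ n.divisors, if m ∣ d then g d else 0 := by
  rw [Finset.mul_sum, Finset.mul_sum, ← Finset.sum_add_distrib]
  refine Finset.sum_congr rfl fun d _ => ?_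
  simp only [Nat.dvd_iff_mod_eq_zero]
  split_ifs <;> ring

section Weights

variable {N m n : ℕ} {χ : ZMod N → ℂ} {a b : ℂ}

/-- The case of a weight which is `a` on the multiples of `m`, and `b` elsewhere. -/
lemma sigmaW_eq_of_two_values (hm : 0 < m) (hn : n ≠ 0)
    (hχ : ∀ d : ℕ, χ (d : ZMod N) = b + (a - b) * if d % m = 0 then 1 else 0) :
    sigmaW 1 n χ = b * sigma 1 n + m * (a - b) * sigmaDiv m n := by
  simp only [sigmaW, hχ, pow_one]
  rw [sum_add_mul_ite, sum_divisors_dvd_self hm hn, sigma_one_eq]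
  ring

lemma sigmaC_eq_of_two_values (hm : 0 < m) (hn : n ≠ 0)
    (hχ : ∀ d : ℕ, χ (d : ZMod N) = b + (a - b) * if d % m = 0 then 1 else 0) :
    sigmaC 1 n χ = b * sigma 1 n + (a - b) * sigmaDiv m n := by
  simp only [sigmaC_eq, hχ]
  rw [sum_add_mul_ite, sum_divisors_dvd_div hm hn, sum_divisors_div]

lemma sigmaDiv_div {m n : ℕ} (hn : 2 ∣ n) : sigmaDiv m (n / 2) = sigmaDiv (2 * m) n := by
  obtain ⟨k, rfl⟩ := hn
  rw [Nat.mul_div_cancel_left k two_pos]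
  simp only [sigmaDiv, Nat.mul_dvd_mul_iff_left two_pos, Nat.mul_div_mul_left _ _ two_pos]

lemma sigmaDiv_of_not_dvd {m n : ℕ} (hn : ¬ 2 ∣ n) : sigmaDiv (2 * m) n = 0 :=
  if_neg fun h => hn ((dvd_mul_right 2 m).trans h)

variable {ψ : ZMod 2 → ℂ}

lemma sigmaW_of_even (hn : n ≠ 0)
    (hχ : ∀ d : ℕ, χ (d : ZMod N) = if 2 ∣ d then ψ ((d / 2 : ℕ) : ZMod 2) else 0) :
    sigmaW 1 n χ = if 2 ∣ n then 2 * sigmaW 1 (n / 2) ψ else 0 := by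
  simp only [sigmaW, hχ, ite_mul, zero_mul]
  rw [sum_divisors_dvd two_pos hn]
  simp only [Nat.mul_div_cancel_left _ two_pos, Finset.mul_sum]
  refine if_congr Iff.rfl (Finset.sum_congr rfl fun d _ => ?_) rfl
  push_cast; ring

lemma sigmaC_of_even (hn : n ≠ 0)
    (hχ : ∀ d : ℕ, χ (d : ZMod N) = if 2 ∣ d then ψ ((d / 2 : ℕ) : ZMod 2) else 0) :
    sigmaC 1 n χ = if 2 ∣ n then sigmaC 1 (n / 2) ψ else 0 := by
  simp only [sigmaC_eq, hχ, ite_mul, zero_mul]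
  rw [sum_divisors_dvd two_pos hn]
  simp only [Nat.mul_div_cancel_left _ two_pos, Nat.div_div_eq_div_mul]

lemma sigmaW_four (hn : n ≠ 0) (a b : ℂ) :
    sigmaW (N := 4) 1 n ![a, 0, b, 0]
      = 2 * (b * sigmaDiv 2 n + 2 * (a - b) * sigmaDiv 4 n) := by
  refine (sigmaW_of_even hn (char_four a b)).trans ?_
  split_ifs with h
  · rw [sigmaW_eq_of_two_values two_pos (by omega) (char_two a b), ← sigmaDiv_one, sigmaDiv_div h,
      sigmaDiv_div h]
    push_cast; norm_num
  · rw [show sigmaDiv 2 n = 0 from sigmaDiv_of_not_dvd (m := 1) h,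
      show sigmaDiv 4 n = 0 from sigmaDiv_of_not_dvd (m := 2) h]
    ring

lemma sigmaC_four (hn : n ≠ 0) (a b : ℂ) :
    sigmaC (N := 4) 1 n ![a, 0, b, 0]
      = b * sigmaDiv 2 n + (a - b) * sigmaDiv 4 n := by
  refine (sigmaC_of_even hn (char_four a b)).trans ?_
  split_ifs with h
  · rw [sigmaC_eq_of_two_values two_pos (by omega) (char_two a b), ← sigmaDiv_one, sigmaDiv_div h,
      sigmaDiv_div h, Nat.mul_one, show 2 * 2 = 4 from rfl]
  · rw [show sigmaDiv 2 n = 0 from sigmaDiv_of_not_dvd (m := 1) h,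
      show sigmaDiv 4 n = 0 from sigmaDiv_of_not_dvd (m := 2) h]
    ring

end Weights

/-! ### Expansions of the Eisenstein series -/

lemma hasSum_of_eq {ι : Type*} {f g : ι → ℂ} {s : ℂ} (h : HasSum g s) (hfg : ∀ n, f n = g n) :
    HasSum f s := by
  rwa [show f = g from funext hfg]

lemma nome_scale {m : ℕ} (hm : 0 < m) (τ : ℍ) : nome (scale m hm τ) = nome τ ^ m := by
  rw [nome, nome, ← Complex.exp_nat_mul]
  congr 1
  simp only [scale]; ring

lemma hasSum_sigma (τ : ℍ) :
    HasSum (fun n : ℕ => (sigma 1 n : ℂ) * nome τ ^ n) ((1 - E2 τ) / 24) := by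
  have h1 := ((hasSum_qExpansion_E2 (z := τ)).sub (hasSum_ite_eq 0 (1 : ℂ))).div_const (-24)
  rw [show (1 - E2 τ) / 24 = (E2 τ - 1) / -24 by ring]
  refine hasSum_of_eq h1 fun n => ?_
  rcases eq_or_ne n 0 with rfl | hn
  · simp
  · simp only [hn, nome, if_false, smul_eq_mul]; ring

lemma hasSum_sigmaDiv {m : ℕ} (hm : 0 < m) (τ : ℍ) :
    HasSum (fun n : ℕ => sigmaDiv m n * nome τ ^ n) ((1 - E2 (scale m hm τ)) / 24) := by
  have h1 := hasSum_sigma (scale m hm τ)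
  have hinj : Function.Injective fun n : ℕ => m * n := fun a b h => Nat.eq_of_mul_eq_mul_left hm h
  rw [← hinj.hasSum_iff]
  · convert h1 using 1
    ext n
    simp [sigmaDiv, nome_scale, pow_mul, Nat.mul_div_cancel_left n hm]
  · intro n hn
    have : ¬ m ∣ n := fun ⟨k, hk⟩ => hn ⟨k, hk.symm⟩
    simp [sigmaDiv, this]

lemma hasSum_pnat {f : ℕ → ℂ} {s : ℂ} (h : HasSum f s) (h0 : f 0 = 0) :
    HasSum (fun n : ℕ+ => f n) s := by
  refine (PNat.coe_injective.hasSum_iff (f := f) ?_).mpr h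
  intro n hn
  rcases Nat.eq_zero_or_pos n with rfl | hp
  · exact h0
  · exact absurd ⟨⟨n, hp⟩, rfl⟩ hn

lemma hasSum_eisE_four (τ : ℍ) :
    HasSum (fun n : ℕ => 8 * (sigma 1 n - 4 * sigmaDiv 2 n) * nome τ ^ n) (eisE .four τ - 1) := by
  have h := ((hasSum_sigma τ).mul_left 8).sub ((hasSum_sigmaDiv two_pos τ).mul_left 32)
  rw [show eisE .four τ = (1 / 3) * (4 * E2 (scale 2 two_pos τ) - E2 τ) from rfl]
  convert hasSum_of_eq h fun n => ?_ using 1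
  · ring
  · ring

lemma hasSum_eisE_three (τ : ℍ) :
    HasSum (fun n : ℕ => 3 * (sigma 1 n - 9 * sigmaDiv 3 n) * nome τ ^ n)
      (eisE .three τ - 1) := by
  have h := ((hasSum_sigma τ).mul_left 3).sub ((hasSum_sigmaDiv three_pos τ).mul_left 27)
  rw [show eisE .three τ = (1 / 8) * (9 * E2 (scale 3 three_pos τ) - E2 τ) from rfl]
  convert hasSum_of_eq h fun n => ?_ using 1
  · ring
  · ring

lemma hasSum_eisE_two (τ : ℍ) :
    HasSum (fun n : ℕ => 8 * (sigmaDiv 2 n - 4 * sigmaDiv 4 n) * nome τ ^ n)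
      (eisE .two τ - 1) := by
  have h := ((hasSum_sigmaDiv two_pos τ).mul_left 8).sub ((hasSum_sigmaDiv four_pos τ).mul_left 32)
  rw [show eisE .two τ = (1 / 3) * (4 * E2 (scale 4 four_pos τ) - E2 (scale 2 two_pos τ)) from rfl]
  convert hasSum_of_eq h fun n => ?_ using 1
  · ring
  · ring

theorem divisor_sums (τ : ℍ) :
      HasSum (fun n : ℕ+ => 8 * sigmaW (N := 2) 1 n ![-1, 1] * nome τ ^ (n : ℕ))
        (eisE .four τ - 1) ∧
      HasSum (fun n : ℕ+ => 8 * sigmaC (N := 2) 1 n ![-3, 1] * nome τ ^ (n : ℕ))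
        (eisE .four τ - 1) ∧
      HasSum (fun n : ℕ+ => 3 * sigmaW (N := 3) 1 n ![-2, 1, 1] * nome τ ^ (n : ℕ))
        (eisE .three τ - 1) ∧
      HasSum (fun n : ℕ+ => 3 * sigmaC (N := 3) 1 n ![-8, 1, 1] * nome τ ^ (n : ℕ))
        (eisE .three τ - 1) ∧
      HasSum (fun n : ℕ+ => 4 * sigmaW (N := 4) 1 n ![-1, 0, 1, 0] * nome τ ^ (n : ℕ))
        (eisE .two τ - 1) ∧
      HasSum (fun n : ℕ+ => 8 * sigmaC (N := 4) 1 n ![-3, 0, 1, 0] * nome τ ^ (n : ℕ))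
        (eisE .two τ - 1) := by
  have h4 := hasSum_pnat (hasSum_eisE_four τ) (by simp [sigmaDiv])
  have h3 := hasSum_pnat (hasSum_eisE_three τ) (by simp [sigmaDiv])
  have h2 := hasSum_pnat (hasSum_eisE_two τ) (by simp [sigmaDiv])
  refine ⟨?_, ?_, ?_, ?_, ?_, ?_⟩
  · refine hasSum_of_eq h4 fun n => ?_
    congr 2
    exact (sigmaW_eq_of_two_values two_pos n.ne_zero (char_two _ _)).trans (by push_cast; ring)
  · refine hasSum_of_eq h4 fun n => ?_
    congr 2
    exact (sigmaC_eq_of_two_values two_pos n.ne_zero (char_two _ _)).trans (by ring)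
  · refine hasSum_of_eq h3 fun n => ?_
    congr 2
    exact (sigmaW_eq_of_two_values three_pos n.ne_zero (char_three _ _)).trans (by push_cast; ring)
  · refine hasSum_of_eq h3 fun n => ?_
    congr 2
    exact (sigmaC_eq_of_two_values three_pos n.ne_zero (char_three _ _)).trans (by ring)
  · refine hasSum_of_eq h2 fun n => ?_
    rw [sigmaW_four n.ne_zero]; ring
  · refine hasSum_of_eq h2 fun n => ?_
    congr 2
    exact (sigmaC_four n.ne_zero _ _).trans (by ring)

lemma eisE_two_eq (τ : ℍ) : eisE .two τ = eisE .four (scale 2 (by norm_num) τ) := by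
  have h : scale 4 (by norm_num) τ = scale 2 (by norm_num) (scale 2 (by norm_num) τ) := by
    ext; simp only [scale]; push_cast; ring
  simp only [eisE, h]

end TripleForms

namespace TripleForms

open Derivative EisensteinSeries ArithmeticFunction

/-! ### The `q`-expansion of the Eisenstein series of weight `2` near its zeros -/

/-- The sum of the divisors of `n` which are not divisible by `N`. -/
def sumNotDvd (N n : ℕ) : ℕ := ∑ d ∈ n.divisors with ¬ N ∣ d, d

lemma sumNotDvd_le (N n : ℕ) : sumNotDvd N n ≤ n ^ 2 := by
  refine le_trans ?_ (sigma_le_pow_succ 1 n)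
  rw [sigma_apply]
  simp only [pow_one]
  exact Finset.sum_le_sum_of_subset (Finset.filter_subset _ _)

lemma sumNotDvd_zero (N : ℕ) : sumNotDvd N 0 = 0 := by simp [sumNotDvd]

lemma sumNotDvd_eq {N : ℕ} (hN : 0 < N) (n : ℕ) :
    (sumNotDvd N n : ℂ) = sigma 1 n - N * sigmaDiv N n := by
  rcases eq_or_ne n 0 with rfl | hn
  · simp [sumNotDvd, sigmaDiv]
  rw [← sum_divisors_dvd_self hN hn, sigma_one_eq, ← Finset.sum_sub_distrib, sumNotDvd,
    Finset.sum_filter]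
  push_cast
  refine Finset.sum_congr rfl fun d _ => ?_
  split_ifs <;> simp_all

lemma hasSum_eisTwo {N : ℕ} (hN : 1 < N) (τ : ℍ) :
    HasSum (fun n : ℕ => (sumNotDvd N n : ℂ) * nome τ ^ n)
      ((eisTwo N (by omega) τ - 1) * ((N - 1) / 24)) := by
  have h := (hasSum_sigma τ).sub ((hasSum_sigmaDiv (m := N) (by omega) τ).mul_left (N : ℂ))
  have hN' : (N : ℂ) - 1 ≠ 0 := sub_ne_zero.mpr (by exact_mod_cast hN.ne')
  convert hasSum_of_eq h fun n => ?_ using 1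
  · rw [eisTwo]; field_simp; ring
  · rw [sumNotDvd_eq (by omega)]; ring

lemma norm_sumNotDvd_le (N n : ℕ) : ‖(sumNotDvd N n : ℂ)‖ ≤ (n : ℝ) ^ 2 := by
  rw [Complex.norm_natCast]
  exact_mod_cast sumNotDvd_le N n

lemma norm_geom_sum₂_le {x y : ℂ} {ρ : ℝ} (hx : ‖x‖ ≤ ρ) (hy : ‖y‖ ≤ ρ) (n : ℕ) :
    ‖∑ i ∈ Finset.range n, x ^ i * y ^ (n - 1 - i)‖ ≤ n * ρ ^ (n - 1) := by
  have hρ : 0 ≤ ρ := (norm_nonneg x).trans hx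
  refine (norm_sum_le_of_le (f := fun i => x ^ i * y ^ (n - 1 - i))
    (n := fun _ => ρ ^ (n - 1)) _ fun i hi => ?_).trans ?_
  · have hi' := Finset.mem_range.mp hi
    rw [norm_mul, norm_pow, norm_pow, show n - 1 = i + (n - 1 - i) by omega, pow_add,
      show i + (n - 1 - i) - i = n - 1 - i by omega]
    gcongr
  · simp

lemma cube_div_pow_le (n : ℕ) :
    ((n + 2 : ℕ) : ℝ) ^ 3 * (1 / 12) ^ (n + 1) ≤ 2 / 3 * (3 / 10) ^ n := by
  induction n with
  | zero => norm_num
  | succ n ih =>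
    have h : ((n + 1 + 2 : ℕ) : ℝ) ^ 3 ≤ 27 / 8 * ((n + 2 : ℕ) : ℝ) ^ 3 := by
      have : ((n + 1 + 2 : ℕ) : ℝ) ≤ 3 / 2 * ((n + 2 : ℕ) : ℝ) := by push_cast; linarith
      calc ((n + 1 + 2 : ℕ) : ℝ) ^ 3 ≤ (3 / 2 * ((n + 2 : ℕ) : ℝ)) ^ 3 := by gcongr
        _ = _ := by ring
    calc ((n + 1 + 2 : ℕ) : ℝ) ^ 3 * (1 / 12) ^ (n + 1 + 1)
        ≤ 27 / 8 * ((n + 2 : ℕ) : ℝ) ^ 3 * (1 / 12) ^ (n + 1 + 1) := by gcongr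
      _ = 27 / 96 * (((n + 2 : ℕ) : ℝ) ^ 3 * (1 / 12) ^ (n + 1)) := by ring
      _ ≤ 3 / 10 * (2 / 3 * (3 / 10) ^ n) := mul_le_mul (by norm_num) ih (by positivity)
          (by norm_num)
      _ = _ := by ring

/-- In level `2`, the power series is injective for `|q| ≤ 1 / 12`, because the coefficient of `q`
dominates the others. -/
theorem eq_of_hasSum_two {x y s : ℂ} (hx : ‖x‖ ≤ 1 / 12) (hy : ‖y‖ ≤ 1 / 12)
    (hsx : HasSum (fun n : ℕ => (sumNotDvd 2 n : ℂ) * x ^ n) s)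
    (hsy : HasSum (fun n : ℕ => (sumNotDvd 2 n : ℂ) * y ^ n) s) : x = y := by
  by_contra hxy
  have hxy' : x - y ≠ 0 := sub_ne_zero.mpr hxy
  set g : ℕ → ℂ := fun n => ∑ i ∈ Finset.range n, x ^ i * y ^ (n - 1 - i)
  have h0 : HasSum (fun n : ℕ => (sumNotDvd 2 n : ℂ) * g n) 0 := by
    have h := (hsx.sub hsy).div_const (x - y)
    rw [sub_self, zero_div] at h
    refine hasSum_of_eq h fun n => ?_
    rw [← mul_sub, ← geom_sum₂_mul, ← mul_assoc, mul_div_cancel_right₀ _ hxy']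
  have h1 : HasSum (fun n : ℕ => (sumNotDvd 2 (n + 2) : ℂ) * g (n + 2)) (-1) := by
    rw [hasSum_nat_add_iff 2 (f := fun n : ℕ => (sumNotDvd 2 n : ℂ) * g n)]
    have h2 : sumNotDvd 2 1 = 1 := rfl
    have h3 : g 1 = 1 := by simp [g]
    simpa [Finset.sum_range_succ, sumNotDvd_zero, h2, h3] using h0
  have hgeo := (hasSum_geometric_of_lt_one (r := (3 / 10 : ℝ)) (by norm_num)
    (by norm_num)).mul_left (2 / 3)
  have h4 := tsum_of_norm_bounded hgeo (f := fun n : ℕ => (sumNotDvd 2 (n + 2) : ℂ) * g (n + 2))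
    fun n => by
      rw [norm_mul]
      refine le_trans (mul_le_mul (norm_sumNotDvd_le 2 (n + 2)) (norm_geom_sum₂_le hx hy (n + 2))
        (norm_nonneg _) (by positivity)) (le_trans (le_of_eq ?_) (cube_div_pow_le n))
      rw [show n + 2 - 1 = n + 1 by omega]
      ring
  rw [h1.tsum_eq] at h4
  norm_num at h4

/-- The quotient of `y ^ n - x ^ n - n x ^ (n - 1) (y - x)` by `(y - x) ^ 2`. -/
noncomputable def secondQuotient (x y : ℂ) : ℕ → ℂ
  | 0 => 0
  | n + 1 => y * secondQuotient x y n + n * x ^ (n - 1)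

lemma pow_eq_add_secondQuotient (x y : ℂ) (n : ℕ) :
    y ^ n = x ^ n + n * x ^ (n - 1) * (y - x) + (y - x) ^ 2 * secondQuotient x y n := by
  induction n with
  | zero => simp [secondQuotient]
  | succ n ih =>
    rw [pow_succ, ih, secondQuotient, Nat.add_sub_cancel]
    rcases n with _ | n
    · simp [secondQuotient]
    · rw [Nat.add_sub_cancel]; push_cast; ring

lemma norm_secondQuotient_le {x y : ℂ} {ρ : ℝ} (hx : ‖x‖ ≤ ρ) (hy : ‖y‖ ≤ ρ) (n : ℕ) :
    ‖secondQuotient x y (n + 2)‖ ≤ (n + 2) * (n + 1) / 2 * ρ ^ n := by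
  have hρ : 0 ≤ ρ := (norm_nonneg x).trans hx
  induction n with
  | zero => simp [secondQuotient]
  | succ n ih =>
    rw [show n + 1 + 2 = n + 2 + 1 by ring, secondQuotient]
    have h1 : ‖((n + 2 : ℕ) : ℂ) * x ^ (n + 2 - 1)‖ ≤ (n + 2) * ρ ^ (n + 1) := by
      rw [norm_mul, Complex.norm_natCast, norm_pow, show n + 2 - 1 = n + 1 by omega]
      push_cast; gcongr
    refine (norm_add_le _ _).trans ((add_le_add ((norm_mul_le _ _).trans
      (mul_le_mul hy ih (norm_nonneg _) hρ)) h1).trans (le_of_eq ?_))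
    push_cast; ring

lemma cube_mul_le_three_pow (n : ℕ) : (n + 6) ^ 3 * (n + 5) ≤ 1080 * 3 ^ n := by
  induction n with
  | zero => norm_num
  | succ n ih =>
    calc (n + 1 + 6) ^ 3 * (n + 1 + 5) ≤ 3 * ((n + 6) ^ 3 * (n + 5)) := by
          ring_nf; nlinarith [Nat.zero_le n, Nat.zero_le (n ^ 2), Nat.zero_le (n ^ 3),
            Nat.zero_le (n ^ 4)]
      _ ≤ 3 * (1080 * 3 ^ n) := by gcongr
      _ = _ := by ring

/-- In level `3`, if the power series has a double zero `x` with `|x| ≤ 1 / 6`, it has no other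
zero in this disc, because in the second divided difference the coefficient of `q ^ 2` dominates the
others. -/
theorem eq_of_hasSum_three {x y s : ℂ} (hx : ‖x‖ ≤ 1 / 6) (hy : ‖y‖ ≤ 1 / 6)
    (hsx : HasSum (fun n : ℕ => (sumNotDvd 3 n : ℂ) * x ^ n) s)
    (hsx' : HasSum (fun n : ℕ => (sumNotDvd 3 n : ℂ) * (n * x ^ (n - 1))) 0)
    (hsy : HasSum (fun n : ℕ => (sumNotDvd 3 n : ℂ) * y ^ n) s) : x = y := by
  by_contra hxy
  have hxy' : (y - x) ^ 2 ≠ 0 := pow_ne_zero 2 (sub_ne_zero.mpr (Ne.symm hxy))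
  set g : ℕ → ℂ := secondQuotient x y with hg
  have h0 : HasSum (fun n : ℕ => (sumNotDvd 3 n : ℂ) * g n) 0 := by
    have h := ((hsy.sub hsx).sub (hsx'.mul_right (y - x))).div_const ((y - x) ^ 2)
    rw [sub_self, zero_mul, sub_zero, zero_div] at h
    refine hasSum_of_eq h fun n => ?_
    rw [eq_div_iff hxy', pow_eq_add_secondQuotient x y n]
    ring
  have hb := norm_secondQuotient_le hx hy
  have h1 : HasSum (fun n : ℕ => (sumNotDvd 3 (n + 6) : ℂ) * g (n + 6))
      (-(3 + g 3 + 7 * g 4 + 6 * g 5)) := by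
    rw [hasSum_nat_add_iff 6 (f := fun n : ℕ => (sumNotDvd 3 n : ℂ) * g n)]
    have c2 : sumNotDvd 3 2 = 3 := rfl
    have c3 : sumNotDvd 3 3 = 1 := rfl
    have c4 : sumNotDvd 3 4 = 7 := rfl
    have c5 : sumNotDvd 3 5 = 6 := rfl
    have g1 : g 1 = 0 := by simp [hg, secondQuotient]
    have g2 : g 2 = 1 := by simp [hg, secondQuotient]
    have hsum : -(3 + g 3 + 7 * g 4 + 6 * g 5)
        + ∑ i ∈ Finset.range 6, (sumNotDvd 3 i : ℂ) * g i = 0 := by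
      simp [Finset.sum_range_succ, sumNotDvd_zero, c2, c3, c4, c5, g1, g2]
      ring
    rwa [hsum]
  have hgeo := (hasSum_geometric_of_lt_one (r := (1 / 2 : ℝ)) (by norm_num)
    (by norm_num)).mul_left (5 / 12)
  have h4 := tsum_of_norm_bounded hgeo (f := fun n : ℕ => (sumNotDvd 3 (n + 6) : ℂ) * g (n + 6))
    fun n => by
      rw [norm_mul]
      refine le_trans (mul_le_mul (norm_sumNotDvd_le 3 (n + 6)) (hb (n + 4))
        (norm_nonneg _) (by positivity)) ?_
      have h5 : ((n : ℝ) + 6) ^ 3 * (n + 5) ≤ 1080 * 3 ^ n := by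
        exact_mod_cast cube_mul_le_three_pow n
      have h6 : (3 : ℝ) ^ n * (1 / 6) ^ n = (1 / 2) ^ n := by rw [← mul_pow]; norm_num
      rw [← h6]
      push_cast
      calc ((n : ℝ) + 6) ^ 2 * ((n + 4 + 2) * (n + 4 + 1) / 2 * (1 / 6) ^ (n + 4))
          = ((n : ℝ) + 6) ^ 3 * (n + 5) * ((1 / 6) ^ n / 2592) := by ring
        _ ≤ 1080 * 3 ^ n * ((1 / 6) ^ n / 2592) := by gcongr
        _ = _ := by ring
  rw [h1.tsum_eq, norm_neg] at h4
  have b3 := hb 1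
  have b4 := hb 2
  have b5 := hb 3
  rw [show 1 + 2 = 3 by norm_num] at b3
  rw [show 2 + 2 = 4 by norm_num] at b4
  rw [show 3 + 2 = 5 by norm_num] at b5
  norm_num at b3 b4 b5 h4
  have h7 : ‖(3 : ℂ)‖ ≤ ‖3 + g 3 + 7 * g 4 + 6 * g 5‖ + ‖g 3‖ + 7 * ‖g 4‖ + 6 * ‖g 5‖ := by
    have e : (3 : ℂ) = 3 + g 3 + 7 * g 4 + 6 * g 5 - g 3 - 7 * g 4 - 6 * g 5 := by ring
    have e7 : ‖7 * g 4‖ = 7 * ‖g 4‖ := by simp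
    have e6 : ‖6 * g 5‖ = 6 * ‖g 5‖ := by simp
    conv_lhs => rw [e]
    rw [← e6, ← e7]
    exact (norm_sub_le _ _).trans (add_le_add_left ((norm_sub_le _ _).trans
      (add_le_add_left (norm_sub_le _ _) _)) _)
  have h8 : ‖(3 : ℂ)‖ = 3 := by simp
  linarith

lemma norm_nome (τ : ℍ) : ‖nome τ‖ = Real.exp (-(2 * Real.pi * τ.im)) := by
  rw [nome, Complex.norm_exp]
  congr 1
  simp [Complex.mul_re, Complex.mul_im]

lemma norm_nome_le_of_le_two {τ : ℍ} (h : 3 ≤ (4 * τ.im) ^ 2) : ‖nome τ‖ ≤ 1 / 12 := by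
  have him := τ.im_pos
  have h1 : 1.73 ≤ 4 * τ.im := abs_le_of_sq_le_sq' (by nlinarith) (by positivity) |>.2
  have hpi := Real.pi_gt_d2
  have h2 : 5 / 2 ≤ 2 * Real.pi * τ.im := by nlinarith
  rw [norm_nome, Real.exp_neg, inv_eq_one_div]
  refine one_div_le_one_div_of_le (by norm_num) ?_
  refine le_trans ?_ (Real.exp_le_exp.mpr h2)
  refine abs_le_of_sq_le_sq' ?_ (Real.exp_pos _).le |>.2
  rw [← Real.exp_nat_mul, show ((2 : ℕ) : ℝ) * (5 / 2) = (5 : ℕ) * 1 by norm_num, Real.exp_nat_mul]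
  have := Real.exp_one_gt_d9
  calc (12 : ℝ) ^ 2 ≤ 2.71 ^ 5 := by norm_num
    _ ≤ _ := by gcongr; linarith

lemma norm_nome_le_of_le_three {τ : ℍ} (h : 3 ≤ (6 * τ.im) ^ 2) : ‖nome τ‖ ≤ 1 / 6 := by
  have him := τ.im_pos
  have h1 : 1.73 ≤ 6 * τ.im := abs_le_of_sq_le_sq' (by nlinarith) (by positivity) |>.2
  have hpi := Real.pi_gt_d2
  have h2 : 9 / 5 ≤ 2 * Real.pi * τ.im := by nlinarith
  rw [norm_nome, Real.exp_neg, inv_eq_one_div]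
  refine one_div_le_one_div_of_le (by norm_num) ?_
  refine le_trans ?_ (Real.exp_le_exp.mpr h2)
  refine le_of_pow_le_pow_left₀ (n := 5) (by norm_num) (Real.exp_pos _).le ?_
  rw [← Real.exp_nat_mul, show ((5 : ℕ) : ℝ) * (9 / 5) = (9 : ℕ) * 1 by norm_num, Real.exp_nat_mul]
  have := Real.exp_one_gt_d9
  calc (6 : ℝ) ^ 5 ≤ 2.71 ^ 9 := by norm_num
    _ ≤ _ := by gcongr; linarith

/-- Termwise differentiation of the expansion. -/
lemma hasSum_deriv_of_D_eq_zero {N : ℕ} (hN : 1 < N) {τ : ℍ} (hτ : ‖nome τ‖ < 1 / 2)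
    (h : D (eisTwo N (by omega)) τ = 0) :
    HasSum (fun n : ℕ => (sumNotDvd N n : ℂ) * (n * nome τ ^ (n - 1))) 0 := by
  set c : ℕ → ℂ := fun n => sumNotDvd N n with hc
  have hN' : (N : ℂ) - 1 ≠ 0 := sub_ne_zero.mpr (by exact_mod_cast hN.ne')
  have hu : Summable fun n : ℕ => (n : ℝ) ^ 2 * (n * (1 / 2) ^ (n - 1)) := by
    have h1 := (summable_pow_mul_geometric_of_norm_lt_one 3 (r := (1 / 2 : ℝ))
      (by norm_num)).mul_left 2
    refine h1.congr fun n => ?_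
    rcases n with _ | n
    · simp
    · rw [Nat.add_sub_cancel, pow_succ (1 / 2 : ℝ) n]; ring
  have hbound : ∀ n : ℕ, ∀ y ∈ Metric.ball (0 : ℂ) (1 / 2),
      ‖c n * (n * y ^ (n - 1))‖ ≤ (n : ℝ) ^ 2 * (n * (1 / 2) ^ (n - 1)) := by
    intro n y hy
    rw [mem_ball_zero_iff] at hy
    rw [norm_mul, norm_mul, norm_pow]
    gcongr
    · exact norm_sumNotDvd_le N n
    · rw [Complex.norm_natCast]
  have hmem : nome τ ∈ Metric.ball (0 : ℂ) (1 / 2) := by rwa [mem_ball_zero_iff]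
  have hder := hasDerivAt_tsum_of_isPreconnected (g := fun n z => c n * z ^ n) hu
    Metric.isOpen_ball (convex_ball (0 : ℂ) (1 / 2)).isPreconnected
    (fun n y _ => (hasDerivAt_pow n y).const_mul (c n)) hbound hmem (hasSum_eisTwo hN τ).summable
    hmem
  have hexp : HasDerivAt (fun z : ℂ => cexp (2 * Real.pi * I * z))
      (nome τ * (2 * Real.pi * I)) (τ : ℂ) := by
    have h1 := ((hasDerivAt_id (τ : ℂ)).const_mul (2 * Real.pi * I : ℂ)).cexp
    simpa [nome] using h1
  have hcomp := ((hder.comp (τ : ℂ) hexp).const_mul (24 / ((N : ℂ) - 1))).const_add 1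
  have heq : eisTwo N (by omega) ∘ ofComplex =ᶠ[𝓝 (τ : ℂ)] fun z =>
      1 + 24 / ((N : ℂ) - 1) * ((fun x => ∑' n, c n * x ^ n) ∘
        fun z : ℂ => cexp (2 * Real.pi * I * z)) z := by
    filter_upwards [isOpen_upperHalfPlaneSet.mem_nhds τ.im_pos] with w hw
    have hw' : 0 < w.im := hw
    have h1 := (hasSum_eisTwo hN ⟨w, hw'⟩).tsum_eq
    simp only [Function.comp_apply, ofComplex_apply_of_im_pos hw']
    change ∑' n, c n * cexp (2 * Real.pi * I * w) ^ n = _ at h1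
    rw [h1]
    field_simp
    ring
  rw [normalizedDerivOfComplex, heq.deriv_eq, hcomp.deriv] at h
  have hx : nome τ ≠ 0 := exp_ne_zero _
  have h24 : (24 : ℂ) / (N - 1) ≠ 0 := div_ne_zero (by norm_num) hN'
  have hpi := Complex.two_pi_I_ne_zero
  have h2 : ∑' n : ℕ, c n * (n * nome τ ^ (n - 1)) = 0 := by
    simpa [hx, h24, hpi] using h
  have hs : Summable fun n : ℕ => c n * (n * nome τ ^ (n - 1)) :=
    Summable.of_norm_bounded hu fun n => hbound n _ hmem
  rw [← h2]
  exact hs.hasSum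

end TripleForms

namespace TripleForms

open Derivative Matrix.SpecialLinearGroup ModularGroup CongruenceSubgroup EisensteinSeries
open ModularForm

/-! ### Elliptic points -/

/-- The generator `(N - 1, -1; N, -1)` of the stabilizer of the elliptic point of `Γ₀(N)`, for
`N = 2` and `N = 3`. -/
def ellGen (N : ℕ) : SL(2, ℤ) := ⟨!![(N : ℤ) - 1, -1; N, -1], by simp⟩

lemma ellGen_entries (N : ℕ) : ellGen N 0 0 = N - 1 ∧ ellGen N 0 1 = -1 ∧ ellGen N 1 0 = N ∧
    ellGen N 1 1 = -1 := by
  simp [ellGen]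

lemma ellGen_mem (N : ℕ) : ellGen N ∈ Gamma0 N := by
  rw [mem_Gamma0_iff, (ellGen_entries N).2.2.1]

lemma ellGen_pow {N : ℕ} (hN : N = 2 ∨ N = 3) : ellGen N ^ N = -1 := by
  rcases hN with rfl | rfl <;> decide

lemma smul_eq_self_iff (γ : SL(2, ℤ)) (τ : ℍ) :
    γ • τ = τ ↔ (γ 1 0 : ℂ) * (τ : ℂ) ^ 2 + ((γ 1 1 : ℂ) - γ 0 0) * τ - γ 0 1 = 0 := by
  have h0 := denom_ne_zero γ τ
  rw [denom_SL] at h0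
  rw [UpperHalfPlane.ext_iff, coe_specialLinearGroup_apply]
  simp only [algebraMap_int_eq, eq_intCast, ofReal_intCast]
  rw [div_eq_iff h0]
  constructor <;> intro h <;> linear_combination -h

lemma ellGen_smul_eq_self_iff (N : ℕ) (τ : ℍ) :
    ellGen N • τ = τ ↔ (N : ℂ) * (τ : ℂ) ^ 2 - N * τ + 1 = 0 := by
  obtain ⟨h1, h2, h3, h4⟩ := ellGen_entries N
  rw [smul_eq_self_iff, h1, h2, h3, h4]
  push_cast
  constructor <;> intro h <;> linear_combination h

lemma toPermHom_neg (γ : SL(2, ℤ)) :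
    MulAction.toPermHom SL(2, ℤ) ℍ (-γ) = MulAction.toPermHom SL(2, ℤ) ℍ γ := by
  ext τ : 1
  exact ModularGroup.SL_neg_smul γ τ

section

variable {N : ℕ} {z₀ : ℍ}

lemma toPermHom_ellGen_ne_one (hN : N ≠ 0) :
    MulAction.toPermHom SL(2, ℤ) ℍ (ellGen N) ≠ 1 := by
  intro h
  have h1 := (ellGen_smul_eq_self_iff N UpperHalfPlane.I).mp
    (congrArg (fun e => e UpperHalfPlane.I) h)
  have h2 := congrArg Complex.im h1
  simp [sq] at h2
  exact hN h2

/-- The stabilizer of the elliptic point in `Γ₀(N)`. -/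
lemma exists_eq_ellGen_pow (hN : N = 2 ∨ N = 3) (hz : (N : ℂ) * (z₀ : ℂ) ^ 2 - N * z₀ + 1 = 0)
    {α : SL(2, ℤ)} (hα : α ∈ Gamma0 N) (hf : α • z₀ = z₀) :
    ∃ j : ℕ, α = ellGen N ^ j ∨ α = -ellGen N ^ j := by
  obtain ⟨k, hk⟩ := mem_Gamma0_iff.mp hα
  rw [smul_eq_self_iff, hk] at hf
  have him := z₀.im_pos
  have h1 : ((k : ℂ) * N + α 1 1 - α 0 0) * z₀ = α 0 1 + k := by
    push_cast at hf
    linear_combination hf - k * hz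
  have h2 : (k * N + α 1 1 - α 0 0 : ℤ) = 0 := by
    have := congrArg Complex.im h1
    rw [show (k : ℂ) * N + α 1 1 - α 0 0 = ((k * N + α 1 1 - α 0 0 : ℤ) : ℂ) by push_cast; ring,
      show (α 0 1 : ℂ) + k = ((α 0 1 + k : ℤ) : ℂ) by push_cast; ring, Complex.mul_im] at this
    simp only [intCast_im, zero_mul, add_zero, intCast_re, mul_eq_zero, Int.cast_eq_zero] at this
    exact this.resolve_right him.ne'
  have h3 : α 0 1 = -k := by
    have h4 : (k : ℂ) * N + α 1 1 - α 0 0 = 0 := by exact_mod_cast h2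
    rw [h4, zero_mul] at h1
    have : (α 0 1 + k : ℤ) = 0 := by exact_mod_cast h1.symm
    linarith
  have h5 : α 1 1 = α 0 0 - k * N := by linarith
  have hdet := det_eq_one α
  rw [hk, h3, h5] at hdet
  have key : ∀ β : SL(2, ℤ), β 0 0 = α 0 0 → β 0 1 = -k → β 1 0 = N * k →
      β 1 1 = α 0 0 - k * N → α = β := fun β e1 e2 e3 e4 =>
    ext_entries e1.symm (h3.trans e2.symm) (hk.trans e3.symm) (h5.trans e4.symm)
  rcases hN with rfl | rfl
  · have hk1 : k ^ 2 ≤ 1 := by push_cast at hdet; nlinarith [sq_nonneg (α 0 0 - k)]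
    have hk2 : -1 ≤ k ∧ k ≤ 1 := abs_le.mp (abs_le_one_iff_mul_self_le_one.mpr (by linarith))
    obtain ⟨hk3, hk4⟩ := hk2
    have ha : (α 0 0 - k) ^ 2 + k ^ 2 = 1 := by push_cast at hdet; linarith
    generalize α 0 0 = a at *
    interval_cases k
    · have : a = -1 := by nlinarith
      subst this
      exact ⟨1, .inr (key _ rfl rfl rfl rfl)⟩
    · have : (a - 1) * (a + 1) = 0 := by linarith
      rcases mul_eq_zero.mp this with h | h
      · obtain rfl : a = 1 := by linarith
        exact ⟨0, .inl (key _ rfl rfl rfl rfl)⟩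
      · obtain rfl : a = -1 := by linarith
        exact ⟨0, .inr (key _ rfl rfl rfl rfl)⟩
    · have : a = 1 := by nlinarith
      subst this
      exact ⟨1, .inl (key _ rfl rfl rfl rfl)⟩
  · have ha : (2 * α 0 0 - 3 * k) ^ 2 + 3 * k ^ 2 = 4 := by push_cast at hdet; linarith
    have hk1 : k ^ 2 ≤ 1 := by nlinarith [sq_nonneg (2 * α 0 0 - 3 * k)]
    have hk2 : -1 ≤ k ∧ k ≤ 1 := abs_le.mp (abs_le_one_iff_mul_self_le_one.mpr (by linarith))
    obtain ⟨hk3, hk4⟩ := hk2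
    generalize α 0 0 = a at *
    interval_cases k
    · have : (a + 1) * (a + 2) = 0 := by linarith
      rcases mul_eq_zero.mp this with h | h
      · obtain rfl : a = -1 := by linarith
        exact ⟨2, .inr (key _ (by decide) (by decide) (by decide) (by decide))⟩
      · obtain rfl : a = -2 := by linarith
        exact ⟨1, .inr (key _ rfl rfl rfl rfl)⟩
    · have : (a - 1) * (a + 1) = 0 := by linarith
      rcases mul_eq_zero.mp this with h | h
      · obtain rfl : a = 1 := by linarith
        exact ⟨0, .inl (key _ rfl rfl rfl rfl)⟩
      · obtain rfl : a = -1 := by linarith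
        exact ⟨0, .inr (key _ rfl rfl rfl rfl)⟩
    · have : (a - 1) * (a - 2) = 0 := by linarith
      rcases mul_eq_zero.mp this with h | h
      · obtain rfl : a = 1 := by linarith
        exact ⟨2, .inl (key _ (by decide) (by decide) (by decide) (by decide))⟩
      · obtain rfl : a = 2 := by linarith
        exact ⟨1, .inl (key _ rfl rfl rfl rfl)⟩

lemma ellipticIndex_smul (hN : N = 2 ∨ N = 3) (hz : (N : ℂ) * (z₀ : ℂ) ^ 2 - N * z₀ + 1 = 0)
    {δ : SL(2, ℤ)} (hδ : δ ∈ Gamma0 N) : ellipticIndex (Gamma0 N) (δ • z₀) = N := by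
  set φ := MulAction.toPermHom SL(2, ℤ) ℍ with hφ
  have hfix := (ellGen_smul_eq_self_iff N z₀).mpr hz
  set β := δ * ellGen N * δ⁻¹ with hβ
  have h1 : φ β ^ N = 1 := by
    rw [← map_pow, hβ, conj_pow, ellGen_pow hN, mul_neg_one, neg_mul, mul_inv_cancel, toPermHom_neg,
      map_one]
  have h2 : φ β ≠ 1 := by
    intro h
    rw [hβ, map_mul, map_mul, map_inv, mul_inv_eq_one, mul_eq_left] at h
    exact toPermHom_ellGen_ne_one (by omega) h
  have hprime : Fact N.Prime := ⟨by rcases hN with rfl | rfl <;> norm_num⟩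
  have heq : (MulAction.stabilizer SL(2, ℤ) (δ • z₀) ⊓ Gamma0 N).map φ
      = Subgroup.zpowers (φ β) := by
    refine le_antisymm ?_ ?_
    · rintro _ ⟨α, ⟨hα1, hα2⟩, rfl⟩
      have h3 : (δ⁻¹ * α * δ) • z₀ = z₀ := by
        rw [mul_smul, mul_smul, MulAction.mem_stabilizer_iff.mp hα1, inv_smul_smul]
      obtain ⟨j, hj⟩ := exists_eq_ellGen_pow hN hz
        ((Gamma0 N).mul_mem ((Gamma0 N).mul_mem ((Gamma0 N).inv_mem hδ) hα2) hδ) h3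
      refine ⟨j, ?_⟩
      have h4 : φ (δ⁻¹ * α * δ) = φ (ellGen N ^ j) := by
        rcases hj with hj | hj <;> rw [hj]
        exact toPermHom_neg _
      have h5 : α = δ * (δ⁻¹ * α * δ) * δ⁻¹ := by group
      change φ β ^ (j : ℤ) = φ α
      rw [zpow_natCast, ← map_pow, hβ, conj_pow, h5, map_mul φ _ δ⁻¹, map_mul φ _ δ⁻¹, map_mul φ δ,
        map_mul φ δ, h4]
    · rw [Subgroup.zpowers_le]
      refine ⟨β, ⟨?_, (Gamma0 N).mul_mem ((Gamma0 N).mul_mem hδ (ellGen_mem N))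
        ((Gamma0 N).inv_mem hδ)⟩, rfl⟩
      change β • δ • z₀ = δ • z₀
      rw [hβ, mul_smul, mul_smul, inv_smul_smul, hfix]
  rw [ellipticIndex, ← hφ, heq, Nat.card_zpowers, orderOf_eq_prime h1 h2]

end

/-! ### The zeros of the Eisenstein series of weight `2` -/

lemma exists_scale_eq {N : ℕ} (hN : 0 < N) (z : ℍ) : ∃ w, scale N hN w = z := by
  have hN' : (0 : ℝ) < N := Nat.cast_pos.mpr hN
  have him : 0 < ((z : ℂ) / N).im := by
    rw [Complex.div_natCast_im]
    exact div_pos z.im_pos hN'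
  refine ⟨⟨(z : ℂ) / N, him⟩, ?_⟩
  ext
  change (N : ℂ) * ((z : ℂ) / N) = z
  rw [mul_div_cancel₀]
  exact_mod_cast hN.ne'

lemma coe_S_smul (τ : ℍ) : ((S • τ : ℍ) : ℂ) = -1 / τ := by
  rw [modular_S_smul]
  simp [neg_div, inv_neg]

lemma scale_S_smul_scale {N : ℕ} (hN : 0 < N) (w : ℍ) :
    scale N hN (S • scale N hN w) = S • w := by
  have hN' : (N : ℂ) ≠ 0 := by exact_mod_cast hN.ne'
  have := ne_zero w
  ext
  rw [coe_S_smul]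
  change (N : ℂ) * ((S • scale N hN w : ℍ) : ℂ) = _
  rw [coe_S_smul]
  change (N : ℂ) * (-1 / ((N : ℂ) * w)) = _
  field_simp

lemma E2_S_smul : ∃ κ : ℂ, ∀ τ : ℍ, E2 (S • τ) = (τ : ℂ) ^ 2 * E2 τ - κ * τ := by
  refine ⟨1 / (2 * riemannZeta 2) * (2 * Real.pi * I), fun τ => ?_⟩
  have h := congrFun (E2_slash_action S) τ
  have hd : denom S τ = (τ : ℂ) := by
    obtain ⟨-, -, h3, h4⟩ := S_entries
    rw [denom_SL, h3, h4]; simp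
  have hτ := ne_zero τ
  rw [SL_slash_apply, hd, zpow_neg, ← div_eq_mul_inv, div_eq_iff (zpow_ne_zero _ hτ)] at h
  rw [h]
  simp only [Pi.sub_apply, Pi.smul_apply, smul_eq_mul, D2, hd, S_entries.2.2.1]
  rw [zpow_ofNat]
  push_cast
  field_simp

/-- The Fricke involution acts on the Eisenstein series. -/
lemma eisTwo_S_smul_scale {N : ℕ} (hN : 0 < N) (w : ℍ) :
    eisTwo N hN (S • scale N hN w) = -(N * (w : ℂ) ^ 2) * eisTwo N hN w := by
  obtain ⟨κ, hκ⟩ := E2_S_smul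
  rw [eisTwo, eisTwo, scale_S_smul_scale, hκ, hκ]
  change (_ - (((N : ℂ) * w) ^ 2 * _ - κ * ((N : ℂ) * w))) / _ = _
  ring

lemma eq_vadd_of_nome_eq {w z : ℍ} (h : nome w = nome z) : ∃ n : ℤ, w = (T ^ n) • z := by
  obtain ⟨n, hn⟩ := Complex.exp_eq_exp_iff_exists_int.mp h
  refine ⟨n, ?_⟩
  rw [modular_T_zpow_smul]
  ext
  rw [coe_vadd]
  have hpi := Complex.two_pi_I_ne_zero
  refine mul_left_cancel₀ hpi ?_
  push_cast
  linear_combination hn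

section

variable {N : ℕ} {z₀ : ℍ} {X : ℍ → ℂ}

lemma PeriodicForm.eq_zero_iff (hN : N = 2 ∨ N = 3 ∨ N = 4) {k : ℤ} (hX : PeriodicForm N k X)
    {γ : SL(2, ℤ)} (hγ : γ ∈ Gamma0 N) (τ : ℍ) : X (γ • τ) = 0 ↔ X τ = 0 := by
  obtain ⟨χ, -, hχ⟩ := hX.quasiPeriodic.exists_char hN hγ
  have h := congrFun hχ τ
  rw [SL_slash_apply, Pi.smul_apply, smul_eq_mul] at h
  rw [← mul_eq_zero_iff_left (zpow_ne_zero (-k) (denom_ne_zero γ τ)), mul_comm, h, mul_eq_zero]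
  simp

/-- A form of weight `2` vanishes at the elliptic point, since the generator of the stabilizer has
an automorphy factor different from `1`. -/
lemma PeriodicForm.eq_zero_of_elliptic (hN : N = 2 ∨ N = 3)
    (hz : (N : ℂ) * (z₀ : ℂ) ^ 2 - N * z₀ + 1 = 0) (hX : PeriodicForm N 2 X) : X z₀ = 0 := by
  have h := congrFun (slash_eq_of_hasPeriod (by omega) even_two hX.period (ellGen_mem N)) z₀
  obtain ⟨-, -, h3, h4⟩ := ellGen_entries N
  rw [SL_slash_apply, (ellGen_smul_eq_self_iff N z₀).mpr hz, denom_SL, h3, h4] at h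
  by_contra h0
  rw [mul_eq_left₀ h0, zpow_neg, inv_eq_one] at h
  norm_cast at h
  push_cast at h
  have h5 : ((N : ℂ) - 2) * z₀ = 1 := by
    have hN0 : (N : ℂ) ≠ 0 := by exact_mod_cast (by omega : N ≠ 0)
    refine mul_left_cancel₀ hN0 ?_
    linear_combination h - N * hz
  rcases hN with rfl | rfl
  · norm_num at h5
  · have := congrArg Complex.im h5
    norm_num at this
    exact z₀.im_pos.ne' this

/-- The zeros of the Eisenstein series on `Γ₀(N)` form the orbit of the elliptic point, as soon as
there are no others in the half plane `Im τ ≥ √3 / (2 N)`, which together with its image under the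
Fricke involution covers a fundamental domain. -/
theorem exists_smul_eq_of_eisTwo_eq_zero (hN : N = 2 ∨ N = 3) (hN0 : 0 < N)
    (hz : (N : ℂ) * (z₀ : ℂ) ^ 2 - N * z₀ + 1 = 0) (hX : PeriodicForm N 2 (eisTwo N hN0))
    (huniq : ∀ w : ℍ, 3 ≤ (2 * N * w.im) ^ 2 → eisTwo N hN0 w = 0 → nome w = nome z₀)
    {τ : ℍ} (hτ : eisTwo N hN0 τ = 0) : ∃ γ ∈ Gamma0 N, γ • z₀ = τ := by
  have hN3 : N = 2 ∨ N = 3 ∨ N = 4 := by omega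
  have hNr : (1 : ℝ) ≤ N := by exact_mod_cast hN0
  obtain ⟨γ, hγ⟩ := exists_smul_mem_fd τ
  obtain ⟨g, h, hg, δ, hδ, j, hj⟩ := exists_rep hN3 γ⁻¹
  have him := three_le_four_mul_im_sq_of_mem_fd hγ
  set z := (T ^ j) • γ • τ with hzdef
  have hzim : z.im = (γ • τ).im := by rw [hzdef, modular_T_zpow_smul, vadd_im]
  rw [← hzim] at him
  have hzτ : τ = δ • g • z := by
    rw [hzdef, ← mul_smul g, ← mul_smul δ, ← mul_assoc, ← hj, inv_smul_smul]
  rw [hzτ, hX.eq_zero_iff hN3 hδ] at hτ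
  rw [hzτ]
  rcases hg with _ | _ | h4
  · rw [one_smul] at hτ ⊢
    have hb : (2 * z.im) ^ 2 ≤ (2 * N * z.im) ^ 2 := by
      have := z.im_pos
      gcongr
      linarith
    obtain ⟨n, hn⟩ := eq_vadd_of_nome_eq (huniq z (by linarith) hτ)
    refine ⟨δ * T ^ n, (Gamma0 N).mul_mem hδ ?_, by rw [mul_smul, ← hn]⟩
    rw [mem_Gamma0_iff, (T_zpow_entries n).2.2.1]
    exact dvd_zero _
  · obtain ⟨w, hw⟩ := exists_scale_eq hN0 z
    rw [← hw, eisTwo_S_smul_scale, mul_eq_zero, neg_eq_zero, mul_eq_zero] at hτ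
    have hN' : (N : ℂ) ≠ 0 := by exact_mod_cast hN0.ne'
    have hτ' : eisTwo N hN0 w = 0 :=
      hτ.resolve_left fun h => h.elim hN' (pow_ne_zero 2 (ne_zero w))
    have hwim : z.im = N * w.im := by
      rw [← hw]
      change ((N : ℂ) * (w : ℂ)).im = _
      rw [← Complex.ofReal_natCast, Complex.im_ofReal_mul]
      rfl
    obtain ⟨n, hn⟩ := eq_vadd_of_nome_eq (huniq w (by rw [mul_assoc, ← hwim]; linarith) hτ')
    have h1 : S • z = (S * T ^ (N * n : ℤ) * S⁻¹ * T ^ (-1 : ℤ)) • z₀ := by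
      have h2 : (T ^ (-1 : ℤ)) • z₀ = S • scale N hN0 z₀ := by
        rw [modular_T_zpow_smul]
        ext
        rw [coe_vadd, coe_S_smul]
        change _ = -1 / ((N : ℂ) * z₀)
        rw [eq_div_iff (mul_ne_zero hN' (ne_zero z₀))]
        push_cast
        linear_combination hz
      rw [mul_smul, h2, mul_smul, inv_smul_smul, mul_smul, ← hw, hn]
      congr 1
      rw [modular_T_zpow_smul, modular_T_zpow_smul]
      ext
      rw [coe_vadd]
      change (N : ℂ) * (((n : ℝ) +ᵥ z₀ : ℍ) : ℂ) = _ + (N : ℂ) * z₀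
      rw [coe_vadd]
      push_cast; ring
    refine ⟨δ * (S * T ^ (N * n : ℤ) * S⁻¹ * T ^ (-1 : ℤ)), (Gamma0 N).mul_mem hδ ?_, by
      rw [mul_smul, ← h1]⟩
    rw [mem_Gamma0_iff, lower_left_mul_T_zpow]
    obtain ⟨q1, q2, q3, q4⟩ := T_zpow_entries (N * n)
    obtain ⟨s1, s2, s3, s4⟩ := S_entries
    obtain ⟨i1, i2, i3, i4⟩ := inv_entries S
    rw [mul_apply_one_zero, mul_apply_one_one, mul_apply_one_zero,
      q1, q2, q3, q4, i1, i3, s3, s4]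
    exact ⟨-n, by ring⟩
  · omega

end

end TripleForms

namespace TripleForms

open Derivative Matrix.SpecialLinearGroup ModularGroup CongruenceSubgroup
open ModularForm

/-! ### Orders of vanishing at the elliptic points -/

lemma PeriodicForm.add {N : ℕ} {k : ℤ} {f g : ℍ → ℂ} (hf : PeriodicForm N k f)
    (hg : PeriodicForm N k g) : PeriodicForm N k (f + g) := by
  refine ⟨hf.holo.add hg.holo, fun γ h hγ τ => ?_, fun γ h hγ => ?_⟩ <;> rw [SlashAction.add_slash]
  · simp only [Pi.add_apply, hf.period γ h hγ τ, hg.period γ h hγ τ]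
  · exact Asymptotics.IsBigO.add (hf.bdd γ h hγ) (hg.bdd γ h hγ)

lemma analyticAt_comp_ofComplex {f : ℍ → ℂ} (hf : MDiff f) (z : ℍ) :
    AnalyticAt ℂ (f ∘ ofComplex) (z : ℂ) :=
  (UpperHalfPlane.mdifferentiable_iff.mp hf).analyticAt
    (isOpen_upperHalfPlaneSet.mem_nhds z.im_pos)

lemma analyticOrderAt_pow_of_D_ne_zero {f : ℍ → ℂ} (hf : MDiff f) {z : ℍ} (h : f z = 0)
    (hD : D f z ≠ 0) (n : ℕ) : analyticOrderAt ((f ^ n) ∘ ofComplex) (z : ℂ) = n := by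
  have han := analyticAt_comp_ofComplex hf z
  have h1 : analyticOrderAt (f ∘ ofComplex) (z : ℂ) = 1 := by
    refine han.analyticOrderAt_eq_one_of_zero_deriv_ne_zero (by simpa using h) fun h0 => hD ?_
    rw [normalizedDerivOfComplex, h0, mul_zero]
  have h2 : (f ^ n) ∘ ofComplex = (f ∘ ofComplex) ^ n := rfl
  rw [h2, analyticOrderAt_pow han, h1]
  simp

/-- A multivalued form of weight `1` whose zeros in `ℍ` are the points of the orbit of the elliptic
point, and which does not vanish at the cusps. -/
theorem vanishesExactlyAt_elliptic {N r : ℕ} (hN : N = 2 ∨ N = 3) (hr : 0 < r) {z₀ : ℍ}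
    (hz : (N : ℂ) * (z₀ : ℂ) ^ 2 - N * z₀ + 1 = 0) {A : ℍ → ℂ} (hq : QuasiPeriodic N r (A ^ r))
    (hcusp : ∀ g h, IsRep N g h →
      ∃ c : ℂ, c ≠ 0 ∧ Tendsto ((A ^ r) ∣[(r : ℤ)] g) atImInfty (𝓝 c))
    (hzero : ∀ τ, A τ = 0 → ∃ γ ∈ Gamma0 N, γ • z₀ = τ)
    (hord : ∀ γ ∈ Gamma0 N, analyticOrderAt ((A ^ r) ∘ ofComplex) ((γ • z₀ : ℍ) : ℂ) = N) :
    VanishesExactlyAt (Gamma0 N) 1 A (.inl z₀) (1 / r) := by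
  have hN3 : N = 2 ∨ N = 3 ∨ N = 4 := by omega
  have hr' : (r : ℚ) ≠ 0 := by exact_mod_cast hr.ne'
  have hN' : (N : ℚ) ≠ 0 := by exact_mod_cast (by omega : N ≠ 0)
  intro s
  refine ⟨fun hs => ⟨r, hr, ?_, ?_⟩, fun hs => ⟨r, hr, ?_, ?_⟩⟩ <;> rw [mul_one]
  · exact hq.isMultiplierForm hN3
  · rcases s with z | s
    · obtain ⟨γ, hγ, rfl⟩ := hs
      exact ⟨N, hord γ hγ, by rw [ellipticIndex_smul hN hz hγ]; field_simp⟩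
    · exact hs.elim
  · exact hq.isMultiplierForm hN3
  · rw [mul_zero]
    rcases s with z | s
    · exact hasFormOrder_of_ne_zero _ _ hq.holo (pow_ne_zero r fun h => hs (hzero z h))
    · refine hq.hasFormOrder_cusp hN3 fun g h hg _ => ?_
      obtain ⟨c, hc, hl⟩ := hcusp g h hg
      exact ⟨c, hc, by simpa [expTwoPi] using hl⟩

namespace IsTriple

variable {s : Signature} {A B C : ℍ → ℂ}

lemma powB (h : IsTriple s A B C) : UnitForm s.level s.r (B ^ s.r) (Pi.single S 1) :=
  h.unitB.pow_single (by cases s <;> simp [Signature.r])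

lemma powC (h : IsTriple s A B C) : UnitForm s.level s.r (C ^ s.r) (Pi.single 1 1) :=
  h.unitC.pow_single (by cases s <;> simp [Signature.r])

lemma periodicB (h : IsTriple s A B C) : PeriodicForm s.level s.r (B ^ s.r) :=
  h.powB.periodicForm (by cases s <;> simp [Signature.level]) fun _ _ _ => single_eq_zero_or_one _ _

lemma periodicC (h : IsTriple s A B C) : PeriodicForm s.level s.r (C ^ s.r) :=
  h.powC.periodicForm (by cases s <;> simp [Signature.level]) fun _ _ _ => single_eq_zero_or_one _ _

lemma periodicA (h : IsTriple s A B C) : PeriodicForm s.level s.r (A ^ s.r) :=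
  h.rel ▸ h.periodicB.add h.periodicC

/-- Only one of the terms of `A ^ r = B ^ r + C ^ r` vanishes at `i∞`, and only the other one at
`0`. -/
lemma tendsto_powA (h : IsTriple s A B C) (hs : s.level ≠ 4) (g : SL(2, ℤ)) (n : ℕ)
    (hg : IsRep s.level g n) :
    ∃ c : ℂ, c ≠ 0 ∧ Tendsto ((A ^ s.r) ∣[(s.r : ℤ)] g) atImInfty (𝓝 c) := by
  have hb := h.powB g n hg
  have hc := h.powC g n hg
  rw [h.rel, SlashAction.add_slash]
  rcases hg with _ | _ | h4
  · rw [single_S_one] at hb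
    rw [Pi.single_eq_same] at hc
    obtain ⟨c, hc0, hl⟩ := hb.tendsto_ne_zero
    have := hl.add (hc.tendsto_zero one_pos one_pos)
    rw [add_zero] at this
    exact ⟨c, hc0, this⟩
  · rw [single_one_S] at hc
    rw [Pi.single_eq_same] at hb
    have hN : 0 < s.level := by cases s <;> simp [Signature.level]
    obtain ⟨c, hc0, hl⟩ := hc.tendsto_ne_zero
    have := (hb.tendsto_zero hN one_pos).add hl
    rw [zero_add] at this
    exact ⟨c, hc0, this⟩
  · exact absurd h4 hs

lemma ne_zero (h : IsTriple s A B C) : A ≠ 0 := by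
  have hN : 0 < s.level := by cases s <;> simp [Signature.level]
  rintro rfl
  have h1 := h.powC.tendsto_logD_sub_infty h.powB
  rw [h.logD_sub, zero_pow two_ne_zero] at h1
  have h2 : Tendsto (0 : ℍ → ℂ) atImInfty (𝓝 0) := tendsto_const_nhds
  exact zero_ne_one (tendsto_nhds_unique h2 h1)

lemma mdiff_eisE (h : IsTriple s A B C) : MDiff (eisE s) :=
  h.logD_C ▸ mdiff_logD h.powC.holo h.powC.ne_zero

end IsTriple

lemma thirdPoint_relation_two (h : 0 < (⟨1 / 2, 1 / 2⟩ : ℂ).im) :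
    ((2 : ℕ) : ℂ) * ((⟨⟨1 / 2, 1 / 2⟩, h⟩ : ℍ) : ℂ) ^ 2
      - (2 : ℕ) * ((⟨⟨1 / 2, 1 / 2⟩, h⟩ : ℍ) : ℂ) + 1 = 0 := by
  apply Complex.ext <;> norm_num [sq]

lemma thirdPoint_relation_three (h : 0 < (⟨1 / 2, √3 / 6⟩ : ℂ).im) :
    ((3 : ℕ) : ℂ) * ((⟨⟨1 / 2, √3 / 6⟩, h⟩ : ℍ) : ℂ) ^ 2
      - (3 : ℕ) * ((⟨⟨1 / 2, √3 / 6⟩, h⟩ : ℍ) : ℂ) + 1 = 0 := by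
  have h3 : √3 * √3 = 3 := Real.mul_self_sqrt (by norm_num)
  apply Complex.ext <;> simp [sq] <;> nlinarith


theorem IsTriple.vanishesExactlyAt_four {A B C : ℍ → ℂ} (h : IsTriple .four A B C)
    (hA : A ^ 2 = eisTwo 2 two_pos) :
    VanishesExactlyAt (Gamma0 2) 1 A (Signature.thirdPoint .four) (1 / (4 : ℕ)) := by
  have hN : 2 = 2 ∨ 2 = 3 := .inl rfl
  have hX : PeriodicForm 2 2 (eisTwo 2 two_pos) := hA ▸ h.sqA
  have hz := thirdPoint_relation_two (by norm_num)
  have hz0 := hX.eq_zero_of_elliptic hN hz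
  refine vanishesExactlyAt_elliptic hN four_pos hz h.periodicA.quasiPeriodic
    (h.tendsto_powA (by decide)) (fun τ hτ => ?_) fun γ hγ => ?_
  · refine exists_smul_eq_of_eisTwo_eq_zero hN two_pos hz hX (fun w hw hw0 => ?_)
      (by rw [← hA, Pi.pow_apply, hτ, zero_pow two_ne_zero])
    have h1 := hasSum_eisTwo one_lt_two w
    have h2 := hasSum_eisTwo one_lt_two (⟨⟨1 / 2, 1 / 2⟩, by norm_num⟩ : ℍ)
    rw [hw0] at h1
    rw [hz0] at h2
    refine eq_of_hasSum_two (norm_nome_le_of_le_two ?_) (norm_nome_le_of_le_two ?_) h1 h2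
    · refine hw.trans (le_of_eq ?_); push_cast; ring
    · norm_num [UpperHalfPlane.im]
  · have h0 : (A ^ 2) (γ • ⟨⟨1 / 2, 1 / 2⟩, by norm_num⟩) = 0 := by
      rw [hA]; exact (hX.eq_zero_iff (.inl rfl) hγ _).mpr hz0
    have hD := h.coupled.two_mul_D_sq h.powB.holo h.mdiff_eisE h.sqA.holo h.ne_zero
      (γ • ⟨⟨1 / 2, 1 / 2⟩, by norm_num⟩)
    rw [h0] at hD
    have h4 : A ^ 4 = (A ^ 2) ^ 2 := by rw [← pow_mul]
    rw [h4]
    refine analyticOrderAt_pow_of_D_ne_zero h.sqA.holo h0 (fun h5 => ?_) 2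
    rw [h5, mul_zero, mul_zero, zero_sub, eq_comm, neg_eq_zero] at hD
    exact h.powB.ne_zero _ hD

theorem IsTriple.vanishesExactlyAt_three {A B C : ℍ → ℂ} (h : IsTriple .three A B C)
    (hAP : PeriodicForm 3 1 A) (hA : A ^ 2 = eisTwo 3 three_pos) :
    VanishesExactlyAt (Gamma0 3) 1 A (Signature.thirdPoint .three) (1 / (3 : ℕ)) := by
  have hN : 3 = 2 ∨ 3 = 3 := .inr rfl
  have hX : PeriodicForm 3 2 (eisTwo 3 three_pos) := hA ▸ h.sqA
  have him : 0 < (⟨1 / 2, √3 / 6⟩ : ℂ).im := by positivity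
  have hz := thirdPoint_relation_three him
  have hz0 := hX.eq_zero_of_elliptic hN hz
  have hA0 : A ⟨⟨1 / 2, √3 / 6⟩, him⟩ = 0 := by
    rw [← hA, Pi.pow_apply] at hz0
    exact pow_eq_zero_iff two_ne_zero |>.mp hz0
  refine vanishesExactlyAt_elliptic hN three_pos hz h.periodicA.quasiPeriodic
    (h.tendsto_powA (by decide)) (fun τ hτ => ?_) fun γ hγ => ?_
  · refine exists_smul_eq_of_eisTwo_eq_zero hN three_pos hz hX (fun w hw hw0 => ?_)
      (by rw [← hA, Pi.pow_apply, hτ, zero_pow two_ne_zero])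
    have h3 : (1 : ℕ) < 3 := by norm_num
    have h1 := hasSum_eisTwo h3 w
    have h2 := hasSum_eisTwo h3 (⟨⟨1 / 2, √3 / 6⟩, him⟩ : ℍ)
    rw [hw0] at h1
    rw [hz0] at h2
    have hb : ‖nome ⟨⟨1 / 2, √3 / 6⟩, him⟩‖ ≤ 1 / 6 := norm_nome_le_of_le_three (by
      change 3 ≤ (6 * (√3 / 6)) ^ 2
      rw [mul_div_cancel₀ _ (by norm_num), Real.sq_sqrt (by norm_num)])
    -- the zero of `A ^ 2` at the elliptic point is double, as `A` is single-valued
    have h4 := hasSum_deriv_of_D_eq_zero h3 (hb.trans_lt (by norm_num)) (by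
      rw [← hA, normalizedDerivOfComplex_pow A 2 hAP.holo]
      simp only [Pi.mul_apply, Pi.pow_apply, hA0]
      simp)
    refine (eq_of_hasSum_three hb (norm_nome_le_of_le_three ?_) h2 h4 h1).symm
    refine hw.trans (le_of_eq ?_); push_cast; ring
  · have h0 : A (γ • ⟨⟨1 / 2, √3 / 6⟩, him⟩) = 0 := (hAP.eq_zero_iff (.inr (.inl rfl)) hγ _).mpr hA0
    have hD := h.coupled.three_mul_D h.powB.holo h.mdiff_eisE hAP.holo h.ne_zero
      (γ • ⟨⟨1 / 2, √3 / 6⟩, him⟩)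
    rw [h0] at hD
    refine analyticOrderAt_pow_of_D_ne_zero hAP.holo h0 (fun h5 => ?_) 3
    rw [h5, mul_zero, mul_zero, zero_sub, eq_comm, neg_eq_zero] at hD
    exact h.powB.ne_zero _ hD

end TripleForms

namespace TripleForms

open Derivative Matrix.SpecialLinearGroup ModularGroup CongruenceSubgroup
open ModularForm

/-! ### Properties of the triples -/

lemma Signature.level_cases (s : Signature) : s.level = 2 ∨ s.level = 3 ∨ s.level = 4 := by
  cases s <;> simp [Signature.level]

lemma Signature.r_ne_zero (s : Signature) : s.r ≠ 0 := by cases s <;> simp [Signature.r]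

lemma single_inv_nonneg {r : ℕ} (g γ : SL(2, ℤ)) :
    0 ≤ (Pi.single g (1 / (r : ℚ)) : SL(2, ℤ) → ℚ) γ := by
  rw [Pi.single_apply]; split_ifs <;> positivity

lemma mapGL_one_smul_infty :
    (mapGL ℚ (1 : SL(2, ℤ)) : GL (Fin 2) ℚ) • (∞ : OnePoint ℚ) = ∞ := by
  rw [map_one, one_smul]

lemma mapGL_S_smul_infty :
    (mapGL ℚ S : GL (Fin 2) ℚ) • (∞ : OnePoint ℚ) = ((0 : ℚ) : OnePoint ℚ) := by
  simp [OnePoint.smul_infty_eq_ite]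

lemma mapGL_halfCusp_smul_infty :
    (mapGL ℚ halfCusp : GL (Fin 2) ℚ) • (∞ : OnePoint ℚ) = ((1 / 2 : ℚ) : OnePoint ℚ) := by
  obtain ⟨h1, -, h3, -⟩ := halfCusp_entries
  rw [OnePoint.smul_infty_eq_ite]
  simp [h1, h3]

/-- A triple for which the form `A` has all required properties. -/
theorem exists_triple (s : Signature) : ∃ A B C : ℍ → ℂ, IsTriple s A B C ∧
    (s ≠ .four → IsMultiplierForm s.group 1 A) ∧
    VanishesExactlyAt s.group 1 A s.thirdPoint (1 / (s.r : ℚ)) := by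
  cases s
  · obtain ⟨A, B, C, h, hA⟩ := exists_triple_four
    exact ⟨A, B, C, h, fun h => absurd rfl h, h.vanishesExactlyAt_four hA⟩
  · obtain ⟨A, B, C, h, hP, hA⟩ := exists_triple_three
    exact ⟨A, B, C, h, fun _ => hP.quasiPeriodic.isMultiplierForm (.inr (.inl rfl)),
      h.vanishesExactlyAt_three hP hA⟩
  · obtain ⟨A, B, C, h, hU⟩ := exists_triple_two
    have hN : 4 = 2 ∨ 4 = 3 ∨ 4 = 4 := by norm_num
    refine ⟨A, B, C, h, fun _ => (hU.quasiPeriodic hN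
      fun _ _ _ => single_inv_nonneg _ _).isMultiplierForm hN, ?_⟩
    have := hU.vanishesExactlyAt hN two_pos (.half rfl)
    rwa [mapGL_halfCusp_smul_infty] at this

namespace IsTriple

variable {s : Signature} {A B C : ℍ → ℂ}

lemma isQuasimodularTwo (h : IsTriple s A B C) : IsQuasimodularTwo s.group (eisE s) := by
  rw [← h.logD_C]
  refine h.powC.isQuasimodularTwo s.level_cases fun g _ _ => ?_
  rcases single_eq_zero_or_one 1 g with h | h <;> rw [h]
  exact zero_le_one

lemma tendsto_eisE (h : IsTriple s A B C) : Tendsto (eisE s) atImInfty (𝓝 1) := by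
  have h1 := (h.powC 1 1 .infty).tendsto_logD one_pos
  rw [SlashAction.slash_one, Pi.single_eq_same, h.logD_C] at h1
  simpa using h1

lemma satisfiesChazy (h : IsTriple s A B C) (hA : s ≠ .four → MDiff A) :
    SatisfiesChazy (chazyPoly s) (uOf s.r (eisE s)) := by
  refine TripleForms.satisfiesChazy s h.powB.holo h.mdiff_eisE h.sqA.holo ?_ h.ne_zero h.coupled
  by_cases hs : s = .four
  · subst hs
    have : A ^ (4 - Signature.four.r) = fun _ => 1 := by simp [Signature.r]; rfl
    rw [this]
    exact mdifferentiable_const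
  · exact (hA hs).pow _

lemma uOf_eq (h : IsTriple s A B C) (τ : ℍ) : uOf s.r (eisE s) τ = dot C τ / C τ := by
  have h1 := congrFun h.logD_C τ
  rw [logD_pow h.unitC.holo h.unitC.ne_zero] at h1
  have hr : (s.r : ℂ) ≠ 0 := by exact_mod_cast s.r_ne_zero
  simp only [Pi.smul_apply, smul_eq_mul, logD, Pi.div_apply] at h1
  rw [uOf, ← h1, dot_eq]
  field_simp

end IsTriple

end TripleForms

open TripleForms in
theorem theorem1 :
    -- for each of the signatures `4`, `3`, `2`:
    (∀ S : Signature,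
      -- `ℰ_r` is quasi-modular, equals `1` at `i∞`, and `(2πi/r) ℰ_r` solves `C_{p_r}`
      (IsQuasimodularTwo S.group (eisE S) ∧
        Tendsto (eisE S) atImInfty (𝓝 1) ∧
        SatisfiesChazy (chazyPoly S) (uOf S.r (eisE S))) ∧
      -- the triple of weight-one forms
      (∃ A B C : ℍ → ℂ,
        (IsRootForm S.group 1 A ∧ IsMultiplierForm S.group 2 (A ^ 2) ∧
          (S ≠ Signature.four → IsMultiplierForm S.group 1 A) ∧
          IsMultiplierForm S.group 1 B ∧ IsMultiplierForm S.group 1 C) ∧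
        -- (a)
        (A ^ S.r = B ^ S.r + C ^ S.r ∧
          IsMultiplierForm S.group S.r (A ^ S.r) ∧
          IsMultiplierForm S.group S.r (B ^ S.r) ∧
          IsMultiplierForm S.group S.r (C ^ S.r)) ∧
        -- (b)
        (VanishesExactlyAt S.group 1 A S.thirdPoint (1 / (S.r : ℚ)) ∧
          VanishesExactlyAt S.group 1 B (Sum.inr ((0 : ℚ) : OnePoint ℚ)) (1 / (S.r : ℚ)) ∧
          VanishesExactlyAt S.group 1 C (Sum.inr (∞ : OnePoint ℚ)) (1 / (S.r : ℚ))) ∧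
        -- (c)
        CoupledSystem S.r A B C (eisE S) ∧
        (∀ τ : ℍ, C τ ≠ 0 ∧ uOf S.r (eisE S) τ = dot C τ / C τ)) ∧
      -- the system alone, with its algebraic relation, implies the generalized Chazy equation
      (∀ A B C E : ℍ → ℂ,
        MDiff (A ^ S.r) → MDiff (B ^ S.r) → MDiff (C ^ S.r) → MDiff E →
        MDiff (A ^ 2) → MDiff (A ^ (4 - S.r)) → A ≠ 0 →
        A ^ S.r = B ^ S.r + C ^ S.r → CoupledSystem S.r A B C E →
        SatisfiesChazy (chazyPoly S) (uOf S.r E))) ∧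
    -- the divisor-sum expansions of `ℰ_4`, `ℰ_3`, `ℰ_2`
    (∀ τ : ℍ,
      HasSum (fun n : ℕ+ => 8 * sigmaW (N := 2) 1 n ![-1, 1] * nome τ ^ (n : ℕ))
        (eisE .four τ - 1) ∧
      HasSum (fun n : ℕ+ => 8 * sigmaC (N := 2) 1 n ![-3, 1] * nome τ ^ (n : ℕ))
        (eisE .four τ - 1) ∧
      HasSum (fun n : ℕ+ => 3 * sigmaW (N := 3) 1 n ![-2, 1, 1] * nome τ ^ (n : ℕ))
        (eisE .three τ - 1) ∧
      HasSum (fun n : ℕ+ => 3 * sigmaC (N := 3) 1 n ![-8, 1, 1] * nome τ ^ (n : ℕ))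
        (eisE .three τ - 1) ∧
      HasSum (fun n : ℕ+ => 4 * sigmaW (N := 4) 1 n ![-1, 0, 1, 0] * nome τ ^ (n : ℕ))
        (eisE .two τ - 1) ∧
      HasSum (fun n : ℕ+ => 8 * sigmaC (N := 4) 1 n ![-3, 0, 1, 0] * nome τ ^ (n : ℕ))
        (eisE .two τ - 1)) ∧
    -- `ℰ_2(q) = ℰ_4(q ^ 2)` and `p_2 = p_4`
    (∀ τ : ℍ, eisE .two τ = eisE .four (scale 2 (by norm_num) τ)) ∧
    chazyPoly .two = chazyPoly .four := by
  refine ⟨fun s => ?_, divisor_sums, eisE_two_eq, rfl⟩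
  obtain ⟨A, B, C, h, hA, hvA⟩ := exists_triple s
  have hN := s.level_cases
  have hB := h.unitB.quasiPeriodic hN fun _ _ _ => single_inv_nonneg _ _
  have hC := h.unitC.quasiPeriodic hN fun _ _ _ => single_inv_nonneg _ _
  have hvB := h.unitB.vanishesExactlyAt hN (Nat.pos_of_ne_zero s.r_ne_zero) .zero
  have hvC := h.unitC.vanishesExactlyAt hN (Nat.pos_of_ne_zero s.r_ne_zero) .infty
  rw [mapGL_S_smul_infty] at hvB
  rw [mapGL_one_smul_infty] at hvC
  have hA2 := h.sqA.quasiPeriodic.isMultiplierForm hN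
  refine ⟨⟨h.isQuasimodularTwo, h.tendsto_eisE, h.satisfiesChazy fun hs => (hA hs).holo⟩,
    ⟨A, B, C, ⟨⟨2, two_pos, by rwa [mul_one]⟩, hA2, hA, hB.isMultiplierForm hN,
      hC.isMultiplierForm hN⟩, ⟨h.rel, h.periodicA.quasiPeriodic.isMultiplierForm hN,
      h.periodicB.quasiPeriodic.isMultiplierForm hN,
      h.periodicC.quasiPeriodic.isMultiplierForm hN⟩,
      ⟨hvA, hvB, hvC⟩, h.coupled, fun τ => ⟨h.unitC.ne_zero τ, h.uOf_eq τ⟩⟩,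
    fun A B C E _ hB _ hE hA2 hA' hA _ h => satisfiesChazy s hB hE hA2 hA' hA h⟩
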